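/- **Machines.** All languages are over an arbitrary finite alphabet. Machines are multitape Turing machines with a read-only two-way input tape (with end markers) and finitely many read/write work tapes. For $t,s:\mathbb N\to\mathbb R$, let $\mathrm{NTISP}(t(n),s(n))$ be the class of languages decided by a nondeterministic Turing machine all of whose computations on inputs of length $n$ run in time $O(t(n))$ and use $O(s(n))$ work-tape cells. (Here and below, a resource is $O(f(n))$ if it is at most $C f(n)+C$ for some constant $C$ and all $n$.) An alternating Turing machine has accepting, rejecting, deterministic, existential and universal states; in each existential or universal state it guesses one bit, which determines the next move. On a computation path, the number of *alternations* is the number of switches between existential and universal guesses, and the *combined binary witness length* is the total number of bits guessed under all quantifiers. Let $\mathrm{ATIME}^{a(n)}_{w(n)}(t(n))$ be the class of languages decided by an alternating Turing machine such that on every input of length $n$ every computation path has length $O(t(n))$, at most $a(n)$ alternations and combined binary witness length at most $w(n)$. Put $$\mathrm{ATIME}^{O(1)}_{w(n)}(t(n))=\bigcup_{a(n)=O(1)}\mathrm{ATIME}^{a(n)}_{w(n)}(t(n)),\qquad \mathrm{ATIME}^{O(1)}_{o(n)}(t(n))=\bigcup_{w(n)=o(n)}\mathrm{ATIME}^{O(1)}_{w(n)}(t(n)),$$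 $$\mathrm{ATIME}^{O(1)}_{\mathrm{SP}}(t(n))=\bigcap_{\delta>0}\mathrm{ATIME}^{O(1)}_{n^{\delta}}(t(n)).$$ A function $g:\mathbb N\to\mathbb R$ is *subpolynomial* if $g(n)=O(n^{\delta})$ as $n\to\infty$ for every real $\delta>0$. **Proposition.** Let $k\in\mathbb N$. For every real $\varepsilon>0$, $$\mathrm{NTISP}(n^k,n^{1-\varepsilon})\subseteq \mathrm{ATIME}^{O(1)}_{o(n)}(n).$$ Furthermore, for every subpolynomial function $g$, $$\mathrm{NTISP}(n^k,g(n))\subseteq \mathrm{ATIME}^{O(1)}_{\mathrm{SP}}(n).$$ -/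

import Mathlib

open Filter Asymptotics

namespace AltTime

/-- The symbols that can be scanned on the read-only input tape `⊢ x ⊣` over the alphabet `α`. -/
inductive InSym (α : Type) : Type where
  | left : InSym α
  | sym (a : α) : InSym α
  | right : InSym α

/-- The symbol in cell `p` of the input tape `⊢ x ⊣`: the left end marker is in cell `0`, the
letters of `x` are in cells `1, …, |x|`, and the right end marker is in cell `|x| + 1`. -/
def inputSym {α : Type} (x : List α) : ℕ → InSym α
  | 0 => InSym.left
  | p + 1 =>
    match x[p]? with
    | some a => InSym.sym a
    | none => InSym.right

/-- Head movements. -/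
inductive Move : Type where
  | left : Move
  | stay : Move
  | right : Move

/-- Movement on a one-way infinite tape (a left move from cell `0` stays there). -/
def Move.shift : Move → ℕ → ℕ
  | Move.left, p => p - 1
  | Move.stay, p => p
  | Move.right, p => p + 1

/-- What a machine with states `Q`, tape alphabet `Γ` and `m` work tapes does in one step: go to a
state, move the input head, and on every work tape write a symbol and then move the head. -/
structure Instr (Q Γ : Type) (m : ℕ) : Type where
  state : Q
  inMove : Move
  write : Fin m → Γ
  move : Fin m → Move

/-- A configuration: the state, the position of the input head, and the contents and head positions
of the `m` one-way infinite work tapes. -/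
structure Cfg (Q Γ : Type) (m : ℕ) : Type where
  state : Q
  inHead : ℕ
  tape : Fin m → ℕ → Γ
  head : Fin m → ℕ

namespace Cfg

variable {Q Γ : Type} {m : ℕ}

/-- The start configuration: all heads on cell `0`, all work tapes blank. -/
def start (q : Q) (blank : Γ) : Cfg Q Γ m where
  state := q
  inHead := 0
  tape := fun _ _ => blank
  head := fun _ => 0

/-- The symbols scanned on the work tapes. -/
def scanned (c : Cfg Q Γ m) : Fin m → Γ := fun i => c.tape i (c.head i)

/-- Execute one instruction on an input of length `n`. The input head stays within the cells
`0, …, n + 1` of the input tape. -/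
def exec (n : ℕ) (c : Cfg Q Γ m) (a : Instr Q Γ m) : Cfg Q Γ m where
  state := a.state
  inHead := min (a.inMove.shift c.inHead) (n + 1)
  tape := fun i => Function.update (c.tape i) (c.head i) (a.write i)
  head := fun i => (a.move i).shift (c.head i)

end Cfg

/-- A nondeterministic multitape Turing machine with a read-only two-way input tape. -/
structure NTM (α : Type) : Type 1 where
  State : Type
  finite_state : Finite State
  Sym : Type
  finite_sym : Finite Sym
  tapes : ℕ
  start : State
  blank : Sym
  accept : Set State
  trans : State → InSym α → (Fin tapes → Sym) → Set (Instr State Sym tapes)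

namespace NTM

variable {α : Type}

/-- `M.Reach x t c`: some computation of `M` on input `x` is in configuration `c` after `t`
steps. -/
inductive Reach (M : NTM α) (x : List α) : ℕ → Cfg M.State M.Sym M.tapes → Prop where
  | start : Reach M x 0 (Cfg.start M.start M.blank)
  | step {t : ℕ} {c : Cfg M.State M.Sym M.tapes} {a : Instr M.State M.Sym M.tapes} :
      Reach M x t c → a ∈ M.trans c.state (inputSym x c.inHead) c.scanned →
      Reach M x (t + 1) (c.exec x.length a)

/-- Some computation of `M` on `x` reaches an accepting state. -/
def Accepts (M : NTM α) (x : List α) : Prop :=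
  ∃ t c, M.Reach x t c ∧ c.state ∈ M.accept

end NTM

/-- `NTISP(t(n), s(n))`: languages decided by a nondeterministic Turing machine that works
simultaneously in time `O(t(n))` and space `O(s(n))`, on all its computations. The cells of a work
tape visited by a computation are those up to the largest head position, so the space bound is a
bound on all head positions that occur; the number of tapes is absorbed by the constant. -/
def NTISP (α : Type) (t s : ℕ → ℝ) : Set (Language α) :=
  {L | ∃ (M : NTM α) (C : ℕ), ∀ x : List α,
    (x ∈ L ↔ M.Accepts x) ∧
    ∀ (i : ℕ) (c : Cfg M.State M.Sym M.tapes), M.Reach x i c →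
      (i : ℝ) ≤ C * t x.length + C ∧
      ∀ j, ((c.head j + 1 : ℕ) : ℝ) ≤ C * s x.length + C}

/-- The two quantifiers. -/
inductive Quantifier : Type where
  | ex : Quantifier
  | all : Quantifier
  deriving DecidableEq

/-- The type of a state of an alternating machine: halting and accepting, halting and rejecting,
deterministic, or quantifying (existentially or universally) over one bit. -/
inductive Mode : Type where
  | accept : Mode
  | reject : Mode
  | det : Mode
  | guess (q : Quantifier) : Mode

/-- An alternating multitape Turing machine with a read-only two-way input tape. In a quantifying
state it has two possible moves, indexed by the bit of the witness that is guessed; in a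
deterministic state only the move with index `false` is used. -/
structure ATM (α : Type) : Type 1 where
  State : Type
  finite_state : Finite State
  Sym : Type
  finite_sym : Finite Sym
  tapes : ℕ
  start : State
  blank : Sym
  mode : State → Mode
  trans : State → InSym α → (Fin tapes → Sym) → Bool → Instr State Sym tapes

namespace ATM

variable {α : Type}

/-- The configuration reached from `c` by the move with index `b`. -/
def next (M : ATM α) (x : List α) (c : Cfg M.State M.Sym M.tapes) (b : Bool) :
    Cfg M.State M.Sym M.tapes :=
  c.exec x.length (M.trans c.state (inputSym x c.inHead) c.scanned b)

/-- `M.Run x c τ`: some computation path of `M` on input `x` leads to `c`, with `τ` listing its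
steps, the latest first: `none` for a deterministic step, `some q` for a bit guessed under the
quantifier `q`. -/
inductive Run (M : ATM α) (x : List α) :
    Cfg M.State M.Sym M.tapes → List (Option Quantifier) → Prop where
  | start : Run M x (Cfg.start M.start M.blank) []
  | det {c : Cfg M.State M.Sym M.tapes} {τ : List (Option Quantifier)} :
      Run M x c τ → M.mode c.state = Mode.det → Run M x (M.next x c false) (none :: τ)
  | guess {c : Cfg M.State M.Sym M.tapes} {τ : List (Option Quantifier)} {q : Quantifier}
      (b : Bool) :
      Run M x c τ → M.mode c.state = Mode.guess q → Run M x (M.next x c b) (some q :: τ)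

/-- Alternating acceptance from a configuration. -/
inductive AcceptsFrom (M : ATM α) (x : List α) : Cfg M.State M.Sym M.tapes → Prop where
  | accept {c : Cfg M.State M.Sym M.tapes} :
      M.mode c.state = Mode.accept → AcceptsFrom M x c
  | det {c : Cfg M.State M.Sym M.tapes} :
      M.mode c.state = Mode.det → AcceptsFrom M x (M.next x c false) → AcceptsFrom M x c
  | ex {c : Cfg M.State M.Sym M.tapes} (b : Bool) :
      M.mode c.state = Mode.guess Quantifier.ex → AcceptsFrom M x (M.next x c b) →
      AcceptsFrom M x c
  | all {c : Cfg M.State M.Sym M.tapes} :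
      M.mode c.state = Mode.guess Quantifier.all → (∀ b, AcceptsFrom M x (M.next x c b)) →
      AcceptsFrom M x c

/-- Acceptance of an input. -/
def Accepts (M : ATM α) (x : List α) : Prop :=
  M.AcceptsFrom x (Cfg.start M.start M.blank)

end ATM

/-- The number of positions at which the quantifier changes in a sequence of quantifiers. -/
def changes : List Quantifier → ℕ
  | [] => 0
  | [_] => 0
  | q :: r :: l => (if q = r then 0 else 1) + changes (r :: l)

/-- The number of alternations of a computation path with step list `τ`. -/
def alternations (τ : List (Option Quantifier)) : ℕ := changes τ.reduceOption

/-- The combined binary witness length of a computation path with step list `τ`: the number of bits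
guessed under either quantifier. -/
def witnessLength (τ : List (Option Quantifier)) : ℕ := τ.reduceOption.length

/-- `ATIME^{a(n)}_{w(n)}(t(n))`: languages decided by an alternating Turing machine in time
`O(t(n))` with at most `a(n)` alternations and combined binary witness length at most `w(n)`, on all
its computation paths. -/
def ATIME (α : Type) (a : ℕ → ℕ) (w t : ℕ → ℝ) : Set (Language α) :=
  {L | ∃ (M : ATM α) (C : ℕ), ∀ x : List α,
    (x ∈ L ↔ M.Accepts x) ∧
    ∀ (c : Cfg M.State M.Sym M.tapes) (τ : List (Option Quantifier)), M.Run x c τ →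
      (τ.length : ℝ) ≤ C * t x.length + C ∧
      alternations τ ≤ a x.length ∧
      (witnessLength τ : ℝ) ≤ w x.length}

/-- `ATIME^{O(1)}_{w(n)}(t(n))`. -/
def ATIMEConstAlt (α : Type) (w t : ℕ → ℝ) : Set (Language α) :=
  {L | ∃ a : ℕ → ℕ, (fun n => (a n : ℝ)) =O[atTop] (fun _ => (1 : ℝ)) ∧ L ∈ ATIME α a w t}

/-- `ATIME^{O(1)}_{o(v(n))}(t(n))`. -/
def ATIMEConstAltLittleO (α : Type) (v t : ℕ → ℝ) : Set (Language α) :=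
  {L | ∃ w : ℕ → ℝ, w =o[atTop] v ∧ L ∈ ATIMEConstAlt α w t}

/-- `ATIME^{O(1)}_{SP}(t(n))`, the intersection of `ATIME^{O(1)}_{n^ε}(t(n))` over all `ε > 0`. -/
def ATIMEConstAltSP (α : Type) (t : ℕ → ℝ) : Set (Language α) :=
  {L | ∀ ε : ℝ, 0 < ε → L ∈ ATIMEConstAlt α (fun n => (n : ℝ) ^ ε) t}

/-- A function is subpolynomial if it is `O(n^ε)` for every `ε > 0`. -/
def IsSubpolynomial (g : ℕ → ℝ) : Prop :=
  ∀ ε : ℝ, 0 < ε → g =O[atTop] (fun n : ℕ => (n : ℝ) ^ ε)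

end AltTime

/-!
# Simulating small space by few alternations and short witnesses

Let `M` be a nondeterministic machine with time `n ^ k` and space `n ^ (i / q)`, where `i + 2 ≤ q`,
and let `r` be about `n ^ (1 / q)`. A configuration of `M` is a word of length `r ^ (i + 1)` over a
finite alphabet (`Column`); the factor `r` that is not needed asymptotically absorbs constants.
Acceptance is the existence of a path from the initial word to a word with an accepting state, and
such a path is found by a recursion over time intervals. A path between two words is cut into
`r + 1` pieces by guessing `r` intermediate words existentially; then one of the pieces is selected
universally, and only this piece is pursued. Each level of this recursion (`LevelRel`, `sp_level`)
shortens the path by the factor `r + 1`, so a constant number of levels, `q * k + 1`, reduces a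
computation to a single step. The number of alternations is therefore constant, and the number of
guessed bits is `O(r ^ (i + 2))`, that is `O(n ^ ((i + 2) / q))` (`exists_atm`). This is `o(n)` if
`i + 2 < q`, and for `i = 1` and large `q` it is below any given power of `n`. On short inputs,
where constants matter, a table is used and nothing is guessed.

The time must be linear. All words involved have length `O(n)`, so copying and comparing them is no
problem; but a step of `M` depends on the symbol scanned by its input head. The position of this
head is encoded in a word by marks at its `q` digits in base `r`. It is decoded by a loop through
all `r ^ q = O(n)` tuples of digits that moves the input head in parallel and stops at the first
tuple at which all marks are seen; after the step, the new position is checked in the same way,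
while the input head moves back (`checkRule`, `FirstMatch`). This is done only once on
every computation path, at the end of the recursion, since there only one pair of words is left.

The machine does no arithmetic. The number `r` is present as the length of *rulers*: every tape has
a mark at its first cell and marks at its first `r` cells, so `q` nested loops along rulers run
through `r ^ q` rounds (`nest`). The rulers are lengthened until `1 ^ (q - 1) + ⋯ + r ^ (q - 1)`,
a number of head moves that nested loops can carry out, exceeds `n` (`buildRulers`); this takes
linear time, and it gives `n < r ^ q = O(n)`.

Machines are written as structured programs (`Prog`), which are compiled to alternating machines by
`Prog.toATM`. Programs are verified by a weakest precondition calculus (`Prog.Sp`) that speaks of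
the acceptance condition and of the bounds for time, guessed bits and alternations at once; its
soundness is `Prog.Sp.spec_toATM`. That words related by a step represent consecutive configurations
is shown in `StepRel.sound` and `StepRel.complete`, and `levelRel_iff_accepts` concludes that the
recursion decides acceptance.
-/


namespace AltTime

/-! ### Resource bounds for alternating machines -/

/-- The quantifier of phase `p`. Phases are counted downwards, so a computation whose guesses pass
through the phases `p, p - 1, …, 0` makes at most `p` alternations. -/
def phaseQuantifier (p : ℕ) : Quantifier := if p % 2 = 0 then Quantifier.ex else Quantifier.all

/-- `M.Bounded x c t w p`: every computation path of `M` from `c` makes at most `t` steps and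
guesses at most `w` bits, and its guesses follow the phases from `p` downwards. -/
inductive ATM.Bounded {α : Type} (M : ATM α) (x : List α) :
    Cfg M.State M.Sym M.tapes → ℕ → ℕ → ℕ → Prop where
  | halt {c : Cfg M.State M.Sym M.tapes} {t w p : ℕ} :
      M.mode c.state = Mode.accept ∨ M.mode c.state = Mode.reject → Bounded M x c t w p
  | det {c : Cfg M.State M.Sym M.tapes} {t w p t' w' p' : ℕ} :
      M.mode c.state = Mode.det → Bounded M x (M.next x c false) t' w' p' →
      t' + 1 ≤ t → w' ≤ w → p' ≤ p → Bounded M x c t w p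
  | guess {c : Cfg M.State M.Sym M.tapes} {t w p t' w' p' : ℕ} :
      M.mode c.state = Mode.guess (phaseQuantifier p') →
      (∀ b, Bounded M x (M.next x c b) t' w' p') →
      t' + 1 ≤ t → w' + 1 ≤ w → p' ≤ p → Bounded M x c t w p

theorem changes_cons_le (q r : Quantifier) (l : List Quantifier) :
    changes (q :: l) ≤ changes (r :: l) + 1 := by
  cases l with
  | nil => simp [changes]
  | cons s l => simp only [changes]; split_ifs <;> omega

theorem changes_le_cons (q : Quantifier) (l : List Quantifier) :
    changes l ≤ changes (q :: l) := by
  cases l with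
  | nil => simp [changes]
  | cons s l => simp [changes]

/-- Lowering the phase by one pays for a switch of the quantifier. -/
theorem changes_phase_mono {p p' : ℕ} (h : p' ≤ p) (l : List Quantifier) :
    changes (phaseQuantifier p' :: l) + p' ≤ changes (phaseQuantifier p :: l) + p := by
  rcases h.eq_or_lt with rfl | h
  · rfl
  · have := changes_cons_le (phaseQuantifier p') (phaseQuantifier p) l
    omega

/-- The invariant of a computation path: what has been used so far and what is still available from
the current configuration on add up to at most the initial bounds. -/
theorem ATM.Bounded.run {α : Type} {M : ATM α} {x : List α} {T W P : ℕ}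
    (h0 : M.Bounded x (Cfg.start M.start M.blank) T W P)
    {c : Cfg M.State M.Sym M.tapes} {τ : List (Option Quantifier)} (hr : M.Run x c τ) :
    ∃ t w p, M.Bounded x c t w p ∧ t + τ.length ≤ T ∧ w + witnessLength τ ≤ W ∧
      changes (phaseQuantifier p :: τ.reduceOption) + p ≤ P := by
  induction hr with
  | start => exact ⟨T, W, P, h0, by simp, by simp [witnessLength], by simp [changes]⟩
  | det _ hm ih =>
    obtain ⟨t, w, p, hb, h1, h2, h3⟩ := ih
    cases hb with
    | halt h => rw [hm] at h; simp at h
    | guess h => rw [hm] at h; simp at h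
    | det h hb ht hw hp =>
      refine ⟨_, _, _, hb, by simp; omega, ?_, ?_⟩
      · simp only [witnessLength, List.reduceOption_cons_of_none] at h2 ⊢; omega
      · rw [List.reduceOption_cons_of_none]
        exact (changes_phase_mono hp _).trans h3
  | guess b _ hm ih =>
    obtain ⟨t, w, p, hb, h1, h2, h3⟩ := ih
    cases hb with
    | halt h => rw [hm] at h; simp at h
    | det h => rw [hm] at h; simp at h
    | guess h hb ht hw hp =>
      rw [hm] at h
      obtain rfl := Mode.guess.inj h
      refine ⟨_, _, _, hb b, by simp; omega, ?_, ?_⟩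
      · simp only [witnessLength, List.reduceOption_cons_of_some, List.length_cons] at h2 ⊢; omega
      · rw [List.reduceOption_cons_of_some]
        simpa [changes] using (changes_phase_mono hp _).trans h3

/-- `M.Spec x c t w p φ`: from the configuration `c`, `M` accepts if and only if `φ` holds, and it
keeps within the bounds `t`, `w`, `p`. -/
def ATM.Spec {α : Type} (M : ATM α) (x : List α) (c : Cfg M.State M.Sym M.tapes)
    (t w p : ℕ) (φ : Prop) : Prop :=
  (M.AcceptsFrom x c ↔ φ) ∧ M.Bounded x c t w p

namespace ATM.Spec

variable {α : Type} {M : ATM α} {x : List α} {c : Cfg M.State M.Sym M.tapes} {t w p : ℕ}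
  {φ : Prop}

theorem of_accept (h : M.mode c.state = Mode.accept) (hφ : φ) : M.Spec x c t w p φ :=
  ⟨⟨fun _ => hφ, fun _ => .accept h⟩, .halt (.inl h)⟩

theorem of_reject (h : M.mode c.state = Mode.reject) (hφ : ¬ φ) : M.Spec x c t w p φ :=
  ⟨⟨fun ha => by cases ha <;> simp_all, fun h' => absurd h' hφ⟩, .halt (.inr h)⟩

theorem of_det {t' w' p' : ℕ} (h : M.mode c.state = Mode.det)
    (hs : M.Spec x (M.next x c false) t' w' p' φ) (ht : t' + 1 ≤ t) (hw : w' ≤ w) (hp : p' ≤ p) :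
    M.Spec x c t w p φ := by
  refine ⟨?_, .det h hs.2 ht hw hp⟩
  rw [← hs.1]
  refine ⟨fun ha => ?_, fun ha => .det h ha⟩
  cases ha with
  | det _ ha => exact ha
  | accept h' => rw [h] at h'; simp at h'
  | ex _ h' => rw [h] at h'; simp at h'
  | all h' => rw [h] at h'; simp at h'

theorem of_guess {t' w' p' : ℕ} {ψ : Bool → Prop}
    (h : M.mode c.state = Mode.guess (phaseQuantifier p'))
    (hs : ∀ b, M.Spec x (M.next x c b) t' w' p' (ψ b)) (ht : t' + 1 ≤ t) (hw : w' + 1 ≤ w)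
    (hp : p' ≤ p)
    (hex : phaseQuantifier p' = Quantifier.ex → (φ ↔ ∃ b, ψ b))
    (hall : phaseQuantifier p' = Quantifier.all → (φ ↔ ∀ b, ψ b)) :
    M.Spec x c t w p φ := by
  refine ⟨?_, .guess h (fun b => (hs b).2) ht hw hp⟩
  cases hq : phaseQuantifier p' with
  | ex =>
    rw [hq] at h
    rw [hex hq]
    simp only [← fun b => (hs b).1]
    refine ⟨fun ha => ?_, fun ⟨b, ha⟩ => .ex b h ha⟩
    cases ha with
    | ex b _ ha => exact ⟨b, ha⟩
    | accept h' => rw [h] at h'; simp at h'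
    | det h' => rw [h] at h'; simp at h'
    | all h' => rw [h] at h'; simp at h'
  | all =>
    rw [hq] at h
    rw [hall hq]
    simp only [← fun b => (hs b).1]
    refine ⟨fun ha => ?_, fun ha => .all h ha⟩
    cases ha with
    | all _ ha => exact ha
    | accept h' => rw [h] at h'; simp at h'
    | det h' => rw [h] at h'; simp at h'
    | ex _ h' => rw [h] at h'; simp at h'

end ATM.Spec

/-! ### Structured programs for machines with ruled tapes -/

/-- The memory of a machine with ruled tapes: every tape `i` carries in cell `p` a datum
`data i p`, a mark telling whether `p = 0`, and a mark telling whether `p < len`. The length `len`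
is common to all tapes, so a tape serves as a ruler that measures `len` cells. -/
structure Store (ι β : Type) : Type where
  len : ℕ
  data : ι → ℕ → β
  head : ι → ℕ
  inp : ℕ

/-- What a machine with ruled tapes sees in one step. -/
structure View (α ι β : Type) : Type where
  inSym : InSym α
  zero : ι → Bool
  inside : ι → Bool
  data : ι → β

/-- What a machine with ruled tapes does in one step to its tapes. -/
structure Action (ι β : Type) : Type where
  write : ι → β
  move : ι → Move
  inMove : Move

namespace Store

variable {α ι β : Type}

/-- What is scanned by the heads. -/
def view (x : List α) (s : Store ι β) : View α ι β where
  inSym := inputSym x s.inp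
  zero := fun i => decide (s.head i = 0)
  inside := fun i => decide (s.head i < s.len)
  data := fun i => s.data i (s.head i)

/-- The movement of the input head on an input of length `n`. -/
def _root_.AltTime.Move.shiftInp (n : ℕ) : Move → ℕ → ℕ
  | Move.left, p => p - 1
  | Move.stay, p => p
  | Move.right, p => min (p + 1) (n + 1)

/-- The effect of an action on an input of length `n`. -/
def exec (n : ℕ) (s : Store ι β) (a : Action ι β) : Store ι β where
  len := s.len
  data := fun i => Function.update (s.data i) (s.head i) (a.write i)
  head := fun i => (a.move i).shift (s.head i)
  inp := a.inMove.shiftInp n s.inp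

end Store

/-- The action that changes nothing. -/
def View.keep {α ι β : Type} (v : View α ι β) : Action ι β where
  write := v.data
  move := fun _ => Move.stay
  inMove := Move.stay

theorem InSym.finite {α : Type} [Finite α] : Finite (InSym α) :=
  Finite.of_surjective
    (fun o : Option (Option α) => match o with
      | none => InSym.left
      | some none => InSym.right
      | some (some a) => InSym.sym a)
    (fun y => match y with
      | .left => ⟨none, rfl⟩
      | .right => ⟨some none, rfl⟩
      | .sym a => ⟨some (some a), rfl⟩)

/-- Structured programs for alternating machines with ruled tapes. The instruction `grow` enlarges
the common length `len` by one; it may be used only when all heads are in cell `len`. -/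
inductive Prog (α ι β : Type) : Type where
  | act (f : View α ι β → Action ι β) : Prog α ι β
  | grow : Prog α ι β
  | halt (b : Bool) : Prog α ι β
  | seq (P Q : Prog α ι β) : Prog α ι β
  | ite (c : View α ι β → Bool) (P Q : Prog α ι β) : Prog α ι β
  | loop (c : View α ι β → Bool) (P : Prog α ι β) : Prog α ι β
  | guess (q : Quantifier) (P : Bool → Prog α ι β) : Prog α ι β
  | caseIn (P : InSym α → Prog α ι β) : Prog α ι β

namespace Prog

variable {α ι β : Type}

/-- The control positions within a program. In a compound program other than a composition, `none`
is the position at which the program branches. -/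
@[reducible]
def Pos : Prog α ι β → Type
  | act _ => Unit
  | grow => Unit
  | halt _ => Unit
  | seq P Q => Pos P ⊕ Pos Q
  | ite _ P Q => Option (Pos P ⊕ Pos Q)
  | loop _ P => Option (Pos P)
  | guess _ P => Option (Σ b, Pos (P b))
  | caseIn P => Option (Σ a, Pos (P a))

theorem finite_pos [Finite α] (P : Prog α ι β) : Finite P.Pos := by
  induction P with
  | act | grow | halt => exact inferInstanceAs (Finite Unit)
  | seq P Q ihP ihQ => exact inferInstanceAs (Finite (Pos P ⊕ Pos Q))
  | ite c P Q ihP ihQ => exact inferInstanceAs (Finite (Option (Pos P ⊕ Pos Q)))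
  | loop c P ih => exact inferInstanceAs (Finite (Option (Pos P)))
  | guess q P ih => exact inferInstanceAs (Finite (Option (Σ b, Pos (P b))))
  | caseIn P ih =>
    have := InSym.finite (α := α)
    exact inferInstanceAs (Finite (Option (Σ a, Pos (P a))))

/-- The position at which a program starts. -/
def entry : (P : Prog α ι β) → P.Pos
  | act _ => ()
  | grow => ()
  | halt _ => ()
  | seq P _ => Sum.inl (entry P)
  | ite _ _ _ => none
  | loop _ _ => none
  | guess _ _ => none
  | caseIn _ => none

/-- The mode of a position. -/
def mode : (P : Prog α ι β) → P.Pos → Mode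
  | act _, _ => Mode.det
  | grow, _ => Mode.det
  | halt b, _ => if b then Mode.accept else Mode.reject
  | seq P _, Sum.inl u => mode P u
  | seq _ Q, Sum.inr u => mode Q u
  | ite _ _ _, none => Mode.det
  | ite _ P _, some (Sum.inl u) => mode P u
  | ite _ _ Q, some (Sum.inr u) => mode Q u
  | loop _ _, none => Mode.det
  | loop _ P, some u => mode P u
  | guess q _, none => Mode.guess q
  | guess _ P, some ⟨b, u⟩ => mode (P b) u
  | caseIn _, none => Mode.det
  | caseIn P, some ⟨a, u⟩ => mode (P a) u

/-- The action carried out at a position, `none` standing for the enlargement of `len`. -/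
def effect : (P : Prog α ι β) → P.Pos → View α ι β → Option (Action ι β)
  | act f, _, v => some (f v)
  | grow, _, _ => none
  | halt _, _, v => some v.keep
  | seq P _, Sum.inl u, v => effect P u v
  | seq _ Q, Sum.inr u, v => effect Q u v
  | ite _ _ _, none, v => some v.keep
  | ite _ P _, some (Sum.inl u), v => effect P u v
  | ite _ _ Q, some (Sum.inr u), v => effect Q u v
  | loop _ _, none, v => some v.keep
  | loop _ P, some u, v => effect P u v
  | guess _ _, none, v => some v.keep
  | guess _ P, some ⟨b, u⟩, v => effect (P b) u v
  | caseIn _, none, v => some v.keep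
  | caseIn P, some ⟨a, u⟩, v => effect (P a) u v

/-- The position after the next step, `none` meaning that the program is left. -/
def control : (P : Prog α ι β) → P.Pos → View α ι β → Bool → Option P.Pos
  | act _, _, _, _ => none
  | grow, _, _, _ => none
  | halt _, _, _, _ => none
  | seq P Q, Sum.inl u, v, b => some ((control P u v b).elim (Sum.inr (entry Q)) Sum.inl)
  | seq _ Q, Sum.inr u, v, b => (control Q u v b).map Sum.inr
  | ite c P Q, none, v, _ =>
      some (some (if c v then Sum.inl (entry P) else Sum.inr (entry Q)))
  | ite _ P _, some (Sum.inl u), v, b => (control P u v b).map (some ∘ Sum.inl)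
  | ite _ _ Q, some (Sum.inr u), v, b => (control Q u v b).map (some ∘ Sum.inr)
  | loop c P, none, v, _ => if c v then some (some (entry P)) else none
  | loop _ P, some u, v, b => some (control P u v b)
  | guess _ P, none, _, b => some (some ⟨b, entry (P b)⟩)
  | guess _ P, some ⟨b', u⟩, v, b => (control (P b') u v b).map fun u' => some ⟨b', u'⟩
  | caseIn P, none, v, _ => some (some ⟨v.inSym, entry (P v.inSym)⟩)
  | caseIn P, some ⟨a, u⟩, v, b => (control (P a) u v b).map fun u' => some ⟨a, u'⟩

end Prog

/-- A specification of what happens from a store on: `k s t w p φ` says that acceptance is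
equivalent to `φ`, within `t` steps, `w` guessed bits, and phases from `p` downwards. -/
abbrev Post (ι β : Type) : Type := Store ι β → ℕ → ℕ → ℕ → Prop → Prop

/-- One deterministic step is made before `k` applies, and bounds may be weakened. -/
def Post.tick {ι β : Type} (k : Post ι β) : Post ι β := fun s t w p φ =>
  ∃ t' w' p', t' + 1 ≤ t ∧ w' ≤ w ∧ p' ≤ p ∧ k s t' w' p' φ

/-- The weakest precondition of a program: if every way of leaving `P` satisfies `k`, then what
happens from the start of `P` on satisfies `P.Sp x k`. For loops it is the least solution of the
unfolding equation. -/
def Prog.Sp {α ι β : Type} (x : List α) : Prog α ι β → Post ι β → Post ι β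
  | .act f, k => fun s t w p φ =>
      k.tick (s.exec x.length (f (s.view x))) t w p φ
  | .grow, k => fun s t w p φ =>
      (∀ i, s.head i = s.len) ∧ k.tick { s with len := s.len + 1 } t w p φ
  | .halt b, _ => fun _ _ _ _ φ => (φ ↔ b = true)
  | .seq P Q, k => P.Sp x (Q.Sp x k)
  | .ite c P Q, k => Post.tick fun s t w p φ =>
      if c (s.view x) then P.Sp x k s t w p φ else Q.Sp x k s t w p φ
  | .loop c P, k => fun s t w p φ => ∀ I : Post ι β,
      (∀ s t w p φ, Post.tick (fun s t w p φ =>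
        if c (s.view x) then P.Sp x I s t w p φ else k s t w p φ) s t w p φ → I s t w p φ) →
      I s t w p φ
  | .guess q P, k => fun s t w p φ => ∃ t' w' p', t' + 1 ≤ t ∧ w' + 1 ≤ w ∧ p' ≤ p ∧
      phaseQuantifier p' = q ∧ ∃ ψ : Bool → Prop,
        (q = Quantifier.ex → (φ ↔ ∃ b, ψ b)) ∧ (q = Quantifier.all → (φ ↔ ∀ b, ψ b)) ∧
        ∀ b, (P b).Sp x k s t' w' p' (ψ b)
  | .caseIn P, k => Post.tick fun s t w p φ => (P (inputSym x s.inp)).Sp x k s t w p φ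

/-! ### Compilation of programs -/

section Compile

variable {α ι β : Type} {m : ℕ}

/-- The tape symbols of a compiled program: the two marks and a datum. -/
abbrev RuledSym (β : Type) : Type := Bool × Bool × β

/-- The view of a compiled program, given the scanned symbols. -/
def viewOf (e : ι ≃ Fin m) (y : InSym α) (g : Fin m → RuledSym β) : View α ι β where
  inSym := y
  zero := fun i => (g (e i)).1
  inside := fun i => (g (e i)).2.1
  data := fun i => (g (e i)).2.2

/-- The machine instruction that carries out an effect and goes to the state `q`. -/
def instrOf {Q : Type} (e : ι ≃ Fin m) (g : Fin m → RuledSym β) (a : Option (Action ι β))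
    (q : Q) : Instr Q (RuledSym β) m where
  state := q
  inMove := a.elim Move.stay Action.inMove
  write := fun i => a.elim ((g i).1, true, (g i).2.2)
    (fun a => ((g i).1, (g i).2.1, a.write (e.symm i)))
  move := fun i => a.elim Move.stay (fun a => a.move (e.symm i))

/-- The machine of a program. Besides the positions of the program it has a start state `none`, in
which cell `0` of each tape is marked, and an exit state `some none`. -/
def Prog.toATM [Finite α] [Finite β] (P : Prog α ι β) (e : ι ≃ Fin m) (b : β) : ATM α where
  State := Option (Option P.Pos)
  finite_state := by
    have := P.finite_pos
    infer_instance
  Sym := RuledSym β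
  finite_sym := inferInstance
  tapes := m
  start := none
  blank := (false, false, b)
  mode := fun q => q.elim Mode.det fun q => q.elim Mode.reject P.mode
  trans := fun q y g b' =>
    match q with
    | none => ⟨some (some P.entry), Move.stay, fun i => (true, (g i).2), fun _ => Move.stay⟩
    | some none => instrOf e g (some (viewOf e y g).keep) (some none)
    | some (some u) =>
        instrOf e g (P.effect u (viewOf e y g)) (some (P.control u (viewOf e y g) b'))

/-- The machine configuration with state `q` that represents a store. -/
def Store.toCfg {Q : Type} (e : ι ≃ Fin m) (s : Store ι β) (q : Q) : Cfg Q (RuledSym β) m where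
  state := q
  inHead := s.inp
  tape := fun i p => (decide (p = 0), decide (p < s.len), s.data (e.symm i) p)
  head := fun i => s.head (e.symm i)

theorem viewOf_scanned {Q : Type} (e : ι ≃ Fin m) (x : List α) (s : Store ι β) (q : Q) :
    viewOf e (inputSym x s.inp) (s.toCfg e q).scanned = s.view x := by
  simp [viewOf, Store.view, Store.toCfg, Cfg.scanned]

/-- The truncated move of `Cfg.exec` agrees with `Move.shiftInp` on positions within the input
tape. -/
theorem shift_min_eq {n p : ℕ} (d : Move) (hp : p ≤ n + 1) :
    min (d.shift p) (n + 1) = d.shiftInp n p := by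
  cases d <;> simp only [Move.shift, Move.shiftInp] <;> omega

theorem toCfg_exec {Q : Type} (e : ι ≃ Fin m) (n : ℕ) (s : Store ι β) (q q' : Q)
    (a : Action ι β) (hs : s.inp ≤ n + 1) :
    (s.toCfg e q).exec n (instrOf e (s.toCfg e q).scanned (some a) q') =
      (s.exec n a).toCfg e q' := by
  simp only [Cfg.exec, Store.toCfg, Store.exec, instrOf, Option.elim, Cfg.scanned, Cfg.mk.injEq,
    true_and, and_true]
  refine ⟨shift_min_eq _ hs, ?_⟩
  funext i p
  by_cases hp : p = s.head (e.symm i)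
  · subst hp; simp; rfl
  · simp [hp]; rfl

theorem toCfg_keep {Q : Type} (e : ι ≃ Fin m) (x : List α) (s : Store ι β) (q q' : Q)
    (hs : s.inp ≤ x.length + 1) :
    (s.toCfg e q).exec x.length
      (instrOf e (s.toCfg e q).scanned (some (s.view x).keep) q') = s.toCfg e q' := by
  rw [toCfg_exec _ _ _ _ _ _ hs]
  congr 1
  simp [Store.exec, View.keep, Store.view, Move.shift, Move.shiftInp]

/-- Enlarging `len` by one means marking one cell on every tape, which is the scanned cell if all
heads are in cell `len`. -/
theorem toCfg_grow {Q : Type} (e : ι ≃ Fin m) (n : ℕ) (s : Store ι β) (q q' : Q)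
    (hs : s.inp ≤ n + 1) (h : ∀ i, s.head i = s.len) :
    (s.toCfg e q).exec n (instrOf e (s.toCfg e q).scanned none q') =
      ({ s with len := s.len + 1 } : Store ι β).toCfg e q' := by
  simp only [Cfg.exec, Store.toCfg, instrOf, Option.elim, Cfg.scanned, Cfg.mk.injEq,
    true_and, Move.shift, and_true]
  refine ⟨by simpa using hs, ?_⟩
  funext i p
  rw [h]
  by_cases hp : p = s.len
  · subst hp; simp
  · simp only [hp, ne_eq, not_false_eq_true, Function.update_of_ne, Prod.mk.injEq, true_and,
      and_true, decide_eq_decide]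
    omega

/-- The program `P` occurs in the program `P₀`: its positions are the positions `f u` of `P₀`, and
leaving `P` means going to `z` in `P₀`. -/
structure Prog.Embeds (P₀ P : Prog α ι β) (f : P.Pos → P₀.Pos) (z : Option P₀.Pos) : Prop where
  mode : ∀ u, P₀.mode (f u) = P.mode u
  effect : ∀ u v, P₀.effect (f u) v = P.effect u v
  control : ∀ u v b, P₀.control (f u) v b = (P.control u v b).elim z (fun u => some (f u))

variable [Finite α] [Finite β] {x : List α}

theorem toATM_next (P : Prog α ι β) (e : ι ≃ Fin m) (b₀ : β) (s : Store ι β) (u : P.Pos)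
    (b : Bool) :
    (P.toATM e b₀).next x (s.toCfg e (some (some u))) b =
      (s.toCfg e (some (some u))).exec x.length
        (instrOf e (s.toCfg (Q := Option (Option P.Pos)) e (some (some u))).scanned
          (P.effect u (s.view x)) (some (P.control u (s.view x) b))) := by
  rw [← viewOf_scanned e x s (some (some u) : Option (Option P.Pos))]
  rfl

theorem toATM_next_act {P : Prog α ι β} (e : ι ≃ Fin m) (b₀ : β) (s : Store ι β) {u : P.Pos}
    {a : Action ι β} (hs : s.inp ≤ x.length + 1) (h : P.effect u (s.view x) = some a) (b : Bool) :
    (P.toATM e b₀).next x (s.toCfg e (some (some u))) b =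
      (s.exec x.length a).toCfg e (some (P.control u (s.view x) b)) := by
  rw [toATM_next, h]
  exact toCfg_exec _ _ _ _ _ _ hs

theorem toATM_next_keep {P : Prog α ι β} (e : ι ≃ Fin m) (b₀ : β) (s : Store ι β) {u : P.Pos}
    (hs : s.inp ≤ x.length + 1) (h : P.effect u (s.view x) = some (s.view x).keep) (b : Bool) :
    (P.toATM e b₀).next x (s.toCfg e (some (some u))) b =
      s.toCfg e (some (P.control u (s.view x) b)) := by
  rw [toATM_next, h]
  exact toCfg_keep _ _ _ _ _ hs

omit [Finite β] in
theorem exec_inp_le {s : Store ι β} {n : ℕ} (a : Action ι β) (hs : s.inp ≤ n + 1) :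
    (s.exec n a).inp ≤ n + 1 := by
  simp only [Store.exec]
  cases a.inMove <;> simp only [Move.shiftInp] <;> omega

/-- Soundness of the weakest preconditions for the compiled program. -/
theorem Prog.Sp.sound (P₀ : Prog α ι β) (e : ι ≃ Fin m) (b₀ : β) (P : Prog α ι β) :
    ∀ (f : P.Pos → P₀.Pos) (z : Option P₀.Pos), P₀.Embeds P f z → ∀ k : Post ι β,
    (∀ s t w p φ, s.inp ≤ x.length + 1 → k s t w p φ →
      (P₀.toATM e b₀).Spec x (s.toCfg e (some z)) t w p φ) →
    ∀ s t w p φ, s.inp ≤ x.length + 1 → P.Sp x k s t w p φ →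
      (P₀.toATM e b₀).Spec x (s.toCfg e (some (some (f P.entry)))) t w p φ := by
  induction P with
  | act g =>
    intro f z hf k hk s t w p φ hs ⟨t', w', p', ht, hw, hp, h⟩
    refine .of_det (hf.mode _) ?_ ht hw hp
    rw [toATM_next_act e b₀ s hs (hf.effect _ _), hf.control]
    exact hk _ _ _ _ _ (exec_inp_le _ hs) h
  | grow =>
    intro f z hf k hk s t w p φ hs ⟨hh, t', w', p', ht, hw, hp, h⟩
    refine .of_det (hf.mode _) ?_ ht hw hp
    rw [toATM_next, hf.effect, hf.control]
    have := toCfg_grow e x.length s (some (some (f ()))) (some z) hs hh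
    simp only [Prog.effect, Prog.control, Option.elim] at this ⊢
    erw [this]
    exact hk _ _ _ _ _ (by exact hs) h
  | halt b =>
    intro f z hf k hk s t w p φ hs h
    have hm := hf.mode ()
    cases b with
    | true => exact .of_accept hm (h.2 rfl)
    | false => exact .of_reject hm (fun h' => by simpa using h.1 h')
  | seq P Q ihP ihQ =>
    intro f z hf k hk s t w p φ hs h
    refine ihP (fun u => f (Sum.inl u)) (some (f (Sum.inr Q.entry)))
      ⟨fun u => hf.mode _, fun u v => hf.effect _ _, fun u v b => ?_⟩ (Q.Sp x k) ?_ s t w p φ hs h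
    · rw [hf.control]
      simp only [Prog.control, Option.elim]
      cases P.control u v b <;> rfl
    · intro s t w p φ hs h
      refine ihQ (fun u => f (Sum.inr u)) z
        ⟨fun u => hf.mode _, fun u v => hf.effect _ _, fun u v b => ?_⟩ k hk s t w p φ hs h
      rw [hf.control]
      simp only [Prog.control]
      cases Q.control u v b <;> rfl
  | ite c P Q ihP ihQ =>
    intro f z hf k hk s t w p φ hs ⟨t', w', p', ht, hw, hp, h⟩
    refine .of_det (hf.mode _) ?_ ht hw hp
    rw [toATM_next_keep e b₀ s hs (hf.effect _ _), hf.control]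
    simp only [Prog.control, Prog.entry]
    dsimp only at h
    split_ifs at h ⊢ with hc
    · refine ihP (fun u => f (some (Sum.inl u))) z
        ⟨fun u => hf.mode _, fun u v => hf.effect _ _, fun u v b => ?_⟩ k hk s _ _ _ φ hs h
      rw [hf.control]
      simp only [Prog.control]
      cases P.control u v b <;> rfl
    · refine ihQ (fun u => f (some (Sum.inr u))) z
        ⟨fun u => hf.mode _, fun u v => hf.effect _ _, fun u v b => ?_⟩ k hk s _ _ _ φ hs h
      rw [hf.control]
      simp only [Prog.control]
      cases Q.control u v b <;> rfl
  | loop c P ih =>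
    intro f z hf k hk s t w p φ hs h
    refine h (fun s t w p φ => s.inp ≤ x.length + 1 →
      (P₀.toATM e b₀).Spec x (s.toCfg e (some (some (f (none : Option P.Pos))))) t w p φ) ?_ hs
    intro s t w p φ ⟨t', w', p', ht, hw, hp, h⟩ hs
    refine .of_det (hf.mode _) ?_ ht hw hp
    rw [toATM_next_keep e b₀ s hs (hf.effect _ _), hf.control]
    simp only [Prog.control]
    dsimp only at h
    split_ifs at h ⊢ with hc
    · refine ih (fun u => f (some u)) (some (f (none : Option P.Pos)))
        ⟨fun u => hf.mode _, fun u v => hf.effect _ _, fun u v b => ?_⟩ _ ?_ s _ _ _ φ hs h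
      · rw [hf.control]
        simp only [Prog.control, Option.elim]
        cases P.control u v b <;> rfl
      · intro s t w p φ hs h
        exact h hs
    · exact hk _ _ _ _ _ hs h
  | guess q P ih =>
    intro f z hf k hk s t w p φ hs ⟨t', w', p', ht, hw, hp, hq, ψ, hex, hall, h⟩
    refine .of_guess (ψ := ψ) (p' := p') ?_ (fun b => ?_) ht hw hp
      (fun h' => hex (hq.symm.trans h')) (fun h' => hall (hq.symm.trans h'))
    · rw [hq]; exact hf.mode _
    · rw [toATM_next_keep e b₀ s hs (hf.effect _ _), hf.control]
      refine ih b (fun u => f (some ⟨b, u⟩)) z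
        ⟨fun u => hf.mode _, fun u v => hf.effect _ _, fun u v b' => ?_⟩ k hk s _ _ _ _ hs (h b)
      rw [hf.control]
      simp only [Prog.control]
      cases (P b).control u v b' <;> rfl
  | caseIn P ih =>
    intro f z hf k hk s t w p φ hs ⟨t', w', p', ht, hw, hp, h⟩
    refine .of_det (hf.mode _) ?_ ht hw hp
    rw [toATM_next_keep e b₀ s hs (hf.effect _ _), hf.control]
    refine ih (inputSym x s.inp) (fun u => f (some ⟨_, u⟩)) z
      ⟨fun u => hf.mode _, fun u v => hf.effect _ _, fun u v b' => ?_⟩ k hk s _ _ _ _ hs h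
    rw [hf.control]
    simp only [Prog.control]
    cases (P (inputSym x s.inp)).control u v b' <;> rfl

/-- The store with blank tapes and all heads in cell `0`. -/
def Store.init (b : β) : Store ι β where
  len := 0
  data := fun _ _ => b
  head := fun _ => 0
  inp := 0

/-- A program whose weakest precondition holds initially yields a machine with the corresponding
acceptance condition and bounds. -/
theorem Prog.Sp.spec_toATM (P : Prog α ι β) (e : ι ≃ Fin m) (b₀ : β) {t w p : ℕ} {φ : Prop}
    (h : P.Sp x (fun _ _ _ _ φ => ¬ φ) (Store.init b₀) t w p φ) :
    (P.toATM e b₀).Spec x (Cfg.start (P.toATM e b₀).start (P.toATM e b₀).blank) (t + 1) w p φ := by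
  have hn : (P.toATM e b₀).next x (Cfg.start (P.toATM e b₀).start (P.toATM e b₀).blank) false =
      (Store.init b₀).toCfg e (some (some P.entry)) := by
    have ht : (fun _ : Fin m => Function.update (fun _ => ((false, false, b₀) : RuledSym β)) 0
        (true, false, b₀)) = fun _ p => (decide (p = 0), decide (p < 0), b₀) := by
      funext i p
      by_cases hp : p = 0
      · subst hp; simp
      · simp [hp]
    change (⟨some (some P.entry), min 0 (x.length + 1), fun _ : Fin m => Function.update
        (fun _ => ((false, false, b₀) : RuledSym β)) 0 (true, false, b₀), fun _ => 0⟩ :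
        Cfg (Option (Option P.Pos)) (RuledSym β) m) = _
    rw [ht, Nat.zero_min]
    rfl
  refine .of_det rfl (t' := t) (w' := w) (p' := p) ?_ le_rfl le_rfl le_rfl
  rw [hn]
  exact Prog.Sp.sound P e b₀ P id none
    ⟨fun _ => rfl, fun _ _ => rfl, fun u v b => by
      simp only [id]; cases P.control u v b <;> rfl⟩ _
    (fun s t w p φ _ h => .of_reject rfl h) (Store.init b₀) t w p φ (by simp [Store.init]) h

end Compile

end AltTime

namespace AltTime

/-! ### Rules for weakest preconditions -/

/-- The bounds of a specification may be weakened. -/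
def Post.relax {ι β : Type} (k : Post ι β) : Post ι β := fun s t w p φ =>
  ∃ t' w' p', t' ≤ t ∧ w' ≤ w ∧ p' ≤ p ∧ k s t' w' p' φ

namespace Prog

variable {α ι β : Type} {x : List α}

theorem Sp.mono {P : Prog α ι β} {k k' : Post ι β}
    (hk : ∀ s t w p φ, k s t w p φ → k' s t w p φ) :
    ∀ {s t w p φ}, P.Sp x k s t w p φ → P.Sp x k' s t w p φ := by
  induction P generalizing k k' with
  | act f => exact fun ⟨t', w', p', ht, hw, hp, h⟩ => ⟨t', w', p', ht, hw, hp, hk _ _ _ _ _ h⟩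
  | grow =>
    exact fun ⟨hh, t', w', p', ht, hw, hp, h⟩ => ⟨hh, t', w', p', ht, hw, hp, hk _ _ _ _ _ h⟩
  | halt b => exact fun h => h
  | seq P Q ihP ihQ => exact fun h => ihP (fun _ _ _ _ _ h => ihQ hk h) h
  | ite c P Q ihP ihQ =>
    rintro s t w p φ ⟨t', w', p', ht, hw, hp, h⟩
    refine ⟨t', w', p', ht, hw, hp, ?_⟩
    dsimp only at h ⊢
    split_ifs at h ⊢ with hc
    · exact ihP hk h
    · exact ihQ hk h
  | loop c P ih =>
    rintro s t w p φ h I hI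
    refine h I fun s t w p φ ⟨t', w', p', ht, hw, hp, h⟩ =>
      hI _ _ _ _ _ ⟨t', w', p', ht, hw, hp, ?_⟩
    dsimp only at h ⊢
    split_ifs at h ⊢ with hc
    · exact h
    · exact hk _ _ _ _ _ h
  | guess q P ih =>
    rintro s t w p φ ⟨t', w', p', ht, hw, hp, hq, ψ, hex, hall, h⟩
    exact ⟨t', w', p', ht, hw, hp, hq, ψ, hex, hall, fun b => ih b hk (h b)⟩
  | caseIn P ih =>
    rintro s t w p φ ⟨t', w', p', ht, hw, hp, h⟩
    exact ⟨t', w', p', ht, hw, hp, ih _ hk h⟩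

theorem _root_.AltTime.Post.tick_of_relax {k : Post ι β} {s : Store ι β} {t w p : ℕ} {φ : Prop}
    (h : k.relax.tick s t w p φ) : k.tick s t w p φ := by
  obtain ⟨t', w', p', ht, hw, hp, t'', w'', p'', ht', hw', hp', h⟩ := h
  exact ⟨t'', w'', p'', by omega, by omega, by omega, h⟩

/-- It does no harm to weaken the bounds at the end of a program. -/
theorem Sp.of_relax {P : Prog α ι β} {k : Post ι β} :
    ∀ {s t w p φ}, P.Sp x k.relax s t w p φ → P.Sp x k s t w p φ := by
  induction P generalizing k with
  | act f => exact fun h => Post.tick_of_relax h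
  | grow => exact fun ⟨hh, h⟩ => ⟨hh, Post.tick_of_relax h⟩
  | halt b => exact fun h => h
  | seq P Q ihP ihQ => exact fun h => Sp.mono (fun _ _ _ _ _ h => ihQ h) h
  | ite c P Q ihP ihQ =>
    rintro s t w p φ ⟨t', w', p', ht, hw, hp, h⟩
    refine ⟨t', w', p', ht, hw, hp, ?_⟩
    dsimp only at h ⊢
    split_ifs at h ⊢ with hc
    · exact ihP h
    · exact ihQ h
  | loop c P ih =>
    rintro s t w p φ h I hI
    refine h I fun s t w p φ ⟨t', w', p', ht, hw, hp, h⟩ => hI _ _ _ _ _ ?_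
    dsimp only at h
    split_ifs at h with hc
    · refine ⟨t', w', p', ht, hw, hp, ?_⟩
      simpa [hc] using h
    · obtain ⟨t'', w'', p'', ht', hw', hp', h⟩ := h
      refine ⟨t'', w'', p'', by omega, by omega, by omega, ?_⟩
      simpa [hc] using h
  | guess q P ih =>
    rintro s t w p φ ⟨t', w', p', ht, hw, hp, hq, ψ, hex, hall, h⟩
    exact ⟨t', w', p', ht, hw, hp, hq, ψ, hex, hall, fun b => ih b (h b)⟩
  | caseIn P ih =>
    rintro s t w p φ ⟨t', w', p', ht, hw, hp, h⟩
    exact ⟨t', w', p', ht, hw, hp, ih _ h⟩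

/-- Consequence rule. -/
theorem Sp.conseq {P : Prog α ι β} {k k' : Post ι β}
    (hk : ∀ s t w p φ, k s t w p φ → k'.relax s t w p φ) {s t w p φ}
    (h : P.Sp x k s t w p φ) : P.Sp x k' s t w p φ :=
  .of_relax (h.mono hk)

theorem Sp.relax {P : Prog α ι β} {k : Post ι β} :
    ∀ {s t w p φ t' w' p'}, P.Sp x k s t w p φ → t ≤ t' → w ≤ w' → p ≤ p' →
      P.Sp x k s t' w' p' φ := by
  have tick : ∀ {k : Post ι β} {s t w p φ t' w' p'}, k.tick s t w p φ →
      t ≤ t' → w ≤ w' → p ≤ p' → k.tick s t' w' p' φ := by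
    rintro k s t w p φ t₁ w₁ p₁ ⟨t', w', p', ht, hw, hp, h⟩ h1 h2 h3
    exact ⟨t', w', p', by omega, by omega, by omega, h⟩
  induction P generalizing k with
  | act f => exact fun {_ _ _ _ _ _ _ _} h h1 h2 h3 => tick h h1 h2 h3
  | grow => exact fun {_ _ _ _ _ _ _ _} ⟨hh, h⟩ h1 h2 h3 => ⟨hh, tick h h1 h2 h3⟩
  | halt b => exact fun {_ _ _ _ _ _ _ _} h _ _ _ => h
  | seq P Q ihP ihQ => exact fun {_ _ _ _ _ _ _ _} h h1 h2 h3 => ihP h h1 h2 h3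
  | ite c P Q ihP ihQ => exact fun {_ _ _ _ _ _ _ _} h h1 h2 h3 => tick h h1 h2 h3
  | loop c P ih =>
    intro s t w p φ t' w' p' h h1 h2 h3 I hI
    refine h (fun s t w p φ => ∀ t' w' p', t ≤ t' → w ≤ w' → p ≤ p' → I s t' w' p' φ) ?_ _ _ _
      h1 h2 h3
    rintro s t w p φ ⟨t', w', p', ht, hw, hp, h⟩ t₁ w₁ p₁ h1 h2 h3
    refine hI _ _ _ _ _ ⟨t', w', p', by omega, by omega, by omega, ?_⟩
    dsimp only at h ⊢
    split_ifs at h ⊢ with hc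
    · exact h.mono fun _ _ _ _ _ h => h _ _ _ le_rfl le_rfl le_rfl
    · exact h
  | guess q P ih =>
    rintro s t w p φ t₁ w₁ p₁ ⟨t', w', p', ht, hw, hp, hq, ψ, hex, hall, h⟩ h1 h2 h3
    exact ⟨t', w', p', by omega, by omega, by omega, hq, ψ, hex, hall, h⟩
  | caseIn P ih => exact fun {_ _ _ _ _ _ _ _} h h1 h2 h3 => tick h h1 h2 h3

/-- Steps that are not needed for `P` are left over at its end. -/
theorem Sp.frame {P : Prog α ι β} {k : Post ι β} (e : ℕ) :
    ∀ {s t w p φ}, P.Sp x k s t w p φ →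
      P.Sp x (fun s t w p φ => ∃ t', t = t' + e ∧ k s t' w p φ) s (t + e) w p φ := by
  have tick : ∀ {k : Post ι β} {s t w p φ}, k.tick s t w p φ →
      Post.tick (fun s t w p φ => ∃ t', t = t' + e ∧ k s t' w p φ) s (t + e) w p φ := by
    rintro k s t w p φ ⟨t', w', p', ht, hw, hp, h⟩
    exact ⟨t' + e, w', p', by omega, hw, hp, t', rfl, h⟩
  induction P generalizing k with
  | act f => exact fun {_ _ _ _ _} h => tick h
  | grow => exact fun {_ _ _ _ _} ⟨hh, h⟩ => ⟨hh, tick h⟩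
  | halt b => exact fun {_ _ _ _ _} h => h
  | seq P Q ihP ihQ =>
    intro s t w p φ h
    exact (ihP h).mono fun s t w p φ ⟨t', ht, h⟩ => ht ▸ ihQ h
  | ite c P Q ihP ihQ =>
    rintro s t w p φ ⟨t', w', p', ht, hw, hp, h⟩
    refine ⟨t' + e, w', p', by omega, hw, hp, ?_⟩
    dsimp only at h ⊢
    split_ifs at h ⊢ with hc
    · exact ihP h
    · exact ihQ h
  | loop c P ih =>
    intro s t w p φ h I hI
    refine h (fun s t w p φ => I s (t + e) w p φ) ?_
    rintro s t w p φ ⟨t', w', p', ht, hw, hp, h⟩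
    refine hI _ _ _ _ _ ⟨t' + e, w', p', by omega, hw, hp, ?_⟩
    dsimp only at h ⊢
    split_ifs at h ⊢ with hc
    · exact (ih h).mono fun s t w p φ ⟨t', ht, h⟩ => ht ▸ h
    · exact ⟨t', rfl, h⟩
  | guess q P ih =>
    rintro s t w p φ ⟨t', w', p', ht, hw, hp, hq, ψ, hex, hall, h⟩
    exact ⟨t' + e, w', p', by omega, hw, hp, hq, ψ, hex, hall, fun b => ih b (h b)⟩
  | caseIn P ih =>
    rintro s t w p φ ⟨t', w', p', ht, hw, hp, h⟩
    exact ⟨t' + e, w', p', by omega, hw, hp, ih _ h⟩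

theorem Sp.loop_true {c : View α ι β → Bool} {P : Prog α ι β} {k : Post ι β} {s : Store ι β}
    {t w p : ℕ} {φ : Prop} (hc : c (s.view x) = true)
    (h : P.Sp x ((P.loop c).Sp x k) s t w p φ) : (P.loop c).Sp x k s (t + 1) w p φ := by
  intro I hI
  refine hI _ _ _ _ _ ⟨t, w, p, le_rfl, le_rfl, le_rfl, ?_⟩
  dsimp only
  rw [if_pos hc]
  exact h.mono fun _ _ _ _ _ h => h I hI

theorem Sp.loop_false {c : View α ι β → Bool} {P : Prog α ι β} {k : Post ι β} {s : Store ι β}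
    {t w p : ℕ} {φ : Prop} (hc : c (s.view x) = false)
    (h : k s t w p φ) : (P.loop c).Sp x k s (t + 1) w p φ := by
  intro I hI
  refine hI _ _ _ _ _ ⟨t, w, p, le_rfl, le_rfl, le_rfl, ?_⟩
  dsimp only
  rwa [if_neg (by simp [hc])]

theorem Sp.ite_true {c : View α ι β → Bool} {P Q : Prog α ι β} {k : Post ι β} {s : Store ι β}
    {t w p : ℕ} {φ : Prop} (hc : c (s.view x) = true)
    (h : P.Sp x k s t w p φ) : (ite c P Q).Sp x k s (t + 1) w p φ := by
  refine ⟨t, w, p, le_rfl, le_rfl, le_rfl, ?_⟩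
  dsimp only
  rwa [if_pos hc]

theorem Sp.ite_false {c : View α ι β → Bool} {P Q : Prog α ι β} {k : Post ι β} {s : Store ι β}
    {t w p : ℕ} {φ : Prop} (hc : c (s.view x) = false)
    (h : Q.Sp x k s t w p φ) : (ite c P Q).Sp x k s (t + 1) w p φ := by
  refine ⟨t, w, p, le_rfl, le_rfl, le_rfl, ?_⟩
  dsimp only
  rwa [if_neg (by simp [hc])]

/-- `P` leads deterministically from `s` to `s'` in at most `n` steps. -/
def Runs (x : List α) (P : Prog α ι β) (s : Store ι β) (n : ℕ) (s' : Store ι β) : Prop :=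
  ∀ (k : Post ι β) (t w p : ℕ) (φ : Prop), k s' t w p φ → P.Sp x k s (t + n) w p φ

namespace Runs

variable {P Q : Prog α ι β} {s s' s'' : Store ι β} {n n' : ℕ}

theorem sp (h : P.Runs x s n s') {k : Post ι β} {t t' w p : ℕ} {φ : Prop} (hk : k s' t w p φ)
    (ht : t + n ≤ t') : P.Sp x k s t' w p φ :=
  (h k t w p φ hk).relax ht le_rfl le_rfl

theorem le (h : P.Runs x s n s') (hn : n ≤ n') : P.Runs x s n' s' :=
  fun _ _ _ _ _ hk => h.sp hk (by omega)

theorem seq (h : P.Runs x s n s') (h' : Q.Runs x s' n' s'') :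
    (P.seq Q).Runs x s (n + n') s'' :=
  fun k t w p φ hk => h.sp (k := Q.Sp x k) (h' k t w p φ hk) (by omega)

theorem act {f : View α ι β → Action ι β} (h : s.exec x.length (f (s.view x)) = s') :
    (act f).Runs x s 1 s' := by
  subst h
  exact fun k t w p φ hk => ⟨t, w, p, le_rfl, le_rfl, le_rfl, hk⟩

theorem grow (h : ∀ i, s.head i = s.len) :
    (grow : Prog α ι β).Runs x s 1 { s with len := s.len + 1 } :=
  fun _ t w p _ hk => ⟨h, t, w, p, le_rfl, le_rfl, le_rfl, hk⟩

theorem ite_true {c : View α ι β → Bool} (hc : c (s.view x) = true) (h : P.Runs x s n s') :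
    (ite c P Q).Runs x s (n + 1) s' :=
  fun k t w p φ hk => (h k t w p φ hk).ite_true hc

theorem ite_false {c : View α ι β → Bool} (hc : c (s.view x) = false) (h : Q.Runs x s n s') :
    (ite c P Q).Runs x s (n + 1) s' :=
  fun k t w p φ hk => (h k t w p φ hk).ite_false hc

theorem loop_true {c : View α ι β → Bool} (hc : c (s.view x) = true) (h : P.Runs x s n s')
    (h' : (loop c P).Runs x s' n' s'') : (loop c P).Runs x s (n + n' + 1) s'' :=
  fun k t w p φ hk => ((h.sp (k := (loop c P).Sp x k) (h' k t w p φ hk) (t' := t + n' + n)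
    le_rfl).loop_true hc).relax (by omega) le_rfl le_rfl

theorem loop_false {c : View α ι β → Bool} (hc : c (s.view x) = false) :
    (loop c P).Runs x s 1 s :=
  fun _ _ _ _ _ hk => .loop_false hc hk

/-- A loop that runs through the stores `f 0, …, f N`, with `n u` steps in round `u`. -/
theorem loop_iterate {c : View α ι β → Bool} (f : ℕ → Store ι β) (N : ℕ) (n : ℕ → ℕ)
    (hc : ∀ u < N, c ((f u).view x) = true) (hc' : c ((f N).view x) = false)
    (h : ∀ u < N, P.Runs x (f u) (n u) (f (u + 1))) :
    (loop c P).Runs x (f 0) (∑ u ∈ Finset.range N, (n u + 1) + 1) (f N) := by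
  induction N generalizing f n with
  | zero => simpa using loop_false hc'
  | succ N ih =>
    have := ih (fun u => f (u + 1)) (fun u => n (u + 1)) (fun u hu => hc _ (by omega)) hc'
      (fun u hu => h _ (by omega))
    refine (loop_true (hc 0 (by omega)) (h 0 (by omega)) this).le ?_
    rw [Finset.sum_range_succ']
    omega

end Runs

/-! ### Moving heads, and loops along rulers -/

/-- Move the heads of the tapes in `J` in direction `d`. -/
def shiftHeads (J : ι → Bool) (d : Move) : Prog α ι β :=
  act fun v => ⟨v.data, fun i => if J i then d else Move.stay, Move.stay⟩

theorem runs_shiftHeads (J : ι → Bool) (d : Move) (s : Store ι β) :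
    (shiftHeads J d).Runs x s 1
      { s with head := fun i => if J i then d.shift (s.head i) else s.head i } := by
  refine .act ?_
  simp only [Store.exec, Store.view, Function.update_eq_self, Move.shiftInp, Store.mk.injEq,
    true_and, and_true]
  funext i
  split_ifs <;> simp [Move.shift]

/-- Move the input head. -/
def moveInp (d : Move) : Prog α ι β := act fun v => ⟨v.data, fun _ => Move.stay, d⟩

theorem runs_moveInp (d : Move) (s : Store ι β) :
    (moveInp d).Runs x s 1 { s with inp := d.shiftInp x.length s.inp } := by
  refine .act ?_
  simp [Store.exec, Store.view, Move.shift]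

open Classical in
/-- Move the heads of the tapes in `J` to cell `0`. -/
noncomputable def rewind (J : ι → Bool) : Prog α ι β :=
  loop (fun v => decide (∃ i, J i ∧ v.zero i = false)) (shiftHeads J Move.left)

theorem runs_rewind (J : ι → Bool) (s : Store ι β) {h : ℕ} (hh : ∀ i, J i → s.head i ≤ h) :
    (rewind J).Runs x s (2 * h + 1)
      { s with head := fun i => if J i then 0 else s.head i } := by
  have base : ∀ s : Store ι β, (∀ i, J i → s.head i = 0) →
      (rewind J).Runs x s 1 { s with head := fun i => if J i then 0 else s.head i } := by
    intro s hz
    have h0 : (fun i => if J i then 0 else s.head i) = s.head := by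
      funext i
      split_ifs with hi
      · exact (hz i hi).symm
      · rfl
    rw [h0]
    refine Runs.loop_false (@decide_eq_false _ (Classical.propDecidable _) ?_)
    simpa [Store.view] using hz
  induction h generalizing s with
  | zero => exact (base s fun i hi => Nat.le_zero.1 (hh i hi)).le (by omega)
  | succ h ih =>
    by_cases hz : ∀ i, J i → s.head i = 0
    · exact (base s hz).le (by omega)
    · have := ih { s with head := fun i => if J i then Move.left.shift (s.head i) else s.head i } ?_
      · have h1 : (fun i => if J i = true then 0 else
            if J i = true then Move.left.shift (s.head i) else s.head i) =
            fun i => if J i = true then 0 else s.head i := by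
          funext i
          split_ifs <;> rfl
        simp only [h1] at this
        refine (Runs.loop_true (@decide_eq_true _ (Classical.propDecidable _) ?_)
          (runs_shiftHeads J _ s) this).le (by omega)
        push Not at hz
        simpa [Store.view] using hz
      · intro i hi
        have := hh i hi
        simp only [hi, if_true, Move.shift]
        omega

variable [DecidableEq ι]

/-- Execute `B` once for every cell `p < len` visited by the head of tape `i`. -/
noncomputable def rulerLoop (i : ι) (B : Prog α ι β) : Prog α ι β :=
  (loop (fun v => v.inside i) (B.seq (shiftHeads (fun j => decide (j = i)) Move.right))).seq
    (rewind fun j => decide (j = i))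

/-- Execute `B` for all positions of the heads of the tapes in `l` within the cells `p < len`, in
lexicographic order. -/
noncomputable def nest : List ι → Prog α ι β → Prog α ι β
  | [], B => B
  | i :: l, B => rulerLoop i (nest l B)

/-- The head position of the tape `k` in the round `u` of the nested loop over `l`, that is, the
digit of `u` in base `r` whose place in `l` is that of `k`. -/
def _root_.AltTime.digit (r : ℕ) : List ι → ℕ → ι → ℕ
  | [], _, _ => 0
  | i :: l, u, k => if k = i then u / r ^ l.length else digit r l (u % r ^ l.length) k

/-- The store `s` with the heads of the tapes in `l` placed as in the round `u` of the nested loop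
over `l`. -/
def _root_.AltTime.Store.atRound (s : Store ι β) (l : List ι) (u : ℕ) : Store ι β :=
  { s with head := fun k => if k ∈ l then digit s.len l u k else s.head k }

/-- Rule for nested loops. The invariant `K u` speaks of the store at the start of round `u` with
the heads of the loop in cell `0`. -/
theorem sp_nest (r : ℕ) (l : List ι) (hl : l.Nodup) (B : Prog α ι β) (K : ℕ → Post ι β)
    (hrest : ∀ u s t w p φ, K u s t w p φ → s.len = r ∧ ∀ i ∈ l, s.head i = 0)
    (hbody : ∀ u < r ^ l.length, ∀ s t w p φ, K u s t w p φ →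
      B.Sp x (fun s' t' w' p' φ' => ∃ s'' t'', s' = s''.atRound l u ∧
        t'' + l.length * (l.length + 3) ≤ t' ∧ K (u + 1) s'' t'' w' p' φ')
        (s.atRound l u) t w p φ) :
    ∀ s t w p φ, K 0 s t w p φ →
      (nest l B).Sp x (K (r ^ l.length)) s (t + 2 * l.length) w p φ := by
  induction l generalizing K with
  | nil =>
    intro s t w p φ h
    have := hbody 0 (by simp) s t w p φ h
    simp only [nest]
    refine (Sp.conseq ?_ this).relax (by simp) le_rfl le_rfl
    rintro s t w p φ ⟨s'', t'', rfl, ht, h⟩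
    exact ⟨t'', w, p, by omega, le_rfl, le_rfl, by simpa [Store.atRound] using h⟩
  | cons i l ih =>
    obtain ⟨hil, hl⟩ := List.nodup_cons.1 hl
    set N := r ^ l.length with hN
    set c := l.length * (l.length + 3) with hcdef
    have hc : (i :: l).length * ((i :: l).length + 3) = c + 2 * l.length + 4 := by
      simp only [List.length_cons, hcdef]; ring
    have hpow : r ^ (i :: l).length = r * N := by
      rw [List.length_cons, pow_succ, mul_comm]
    -- The invariant of the loop over `i`: `v` rounds are done, and `2 * v` steps are saved.
    let J : ℕ → Post ι β := fun v s t w p φ => ∃ s₀ t₀,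
      s = { s₀ with head := Function.update s₀.head i v } ∧
      t₀ + 2 * l.length + 2 + 2 * v ≤ t ∧ K (v * N) s₀ t₀ w p φ
    let sh : Store ι β → Store ι β := fun s => ⟨s.len, s.data,
      fun j => if decide (j = i) = true then Move.right.shift (s.head j) else s.head j, s.inp⟩
    have inner : ∀ v < r, ∀ s t w p φ, J v s t w p φ →
        (nest l B).Sp x (fun s t w p φ => J (v + 1) (sh s) (t - 1) w p φ ∧ 1 ≤ t)
          s (t - 1) w p φ := by
      rintro v hv s t w p φ ⟨s₀, t₀, rfl, ht, hK⟩
      have hNpos : 0 < N := by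
        rw [hN]; exact pow_pos (by omega) _
      -- The saving of one round of the loop over `i` is made in the first inner round.
      let K' : ℕ → Post ι β := fun u s t w p φ => ∃ s₀ t₀,
        s = { s₀ with head := Function.update s₀.head i v } ∧
        t₀ + (if u = 0 then 0 else 2 * l.length + 4) + 1 + 2 * v ≤ t ∧ K (v * N + u) s₀ t₀ w p φ
      have key := ih hl K' ?_ ?_ { s₀ with head := Function.update s₀.head i v }
        (t₀ + 1 + 2 * v) w p φ ⟨s₀, t₀, rfl, by simp, by simpa using hK⟩
      · refine (Sp.conseq ?_ key).relax (by omega) le_rfl le_rfl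
        rintro s t w p φ ⟨s₁, t₁, rfl, ht, hK⟩
        rw [if_neg hNpos.ne'] at ht
        refine ⟨t, w, p, le_rfl, le_rfl, le_rfl, ⟨s₁, t₁, ?_, by omega, ?_⟩, by omega⟩
        · have : (fun j => if decide (j = i) = true then
              Move.right.shift (Function.update s₁.head i v j)
              else Function.update s₁.head i v j) = Function.update s₁.head i (v + 1) := by
            funext j
            by_cases hj : j = i
            · subst hj; simp [Move.shift]
            · simp [hj]
          simp only [sh, this]
        · rwa [Nat.succ_mul]
      · rintro u s t w p φ ⟨s₁, t₁, rfl, ht, hK⟩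
        obtain ⟨h1, h2⟩ := hrest _ _ _ _ _ _ hK
        refine ⟨h1, fun j hj => ?_⟩
        have : j ≠ i := fun h => hil (h ▸ hj)
        simpa [this] using h2 j (List.mem_cons_of_mem _ hj)
      · rintro u hu s t w p φ ⟨s₁, t₁, rfl, ht, hK⟩
        have hlt : v * N + u < r ^ (i :: l).length := by
          rw [hpow]
          calc v * N + u < v * N + N := by omega
            _ = (v + 1) * N := by ring
            _ ≤ r * N := Nat.mul_le_mul_right _ hv
        have hat : ∀ s₁ : Store ι β, s₁.len = r →
            Store.atRound { s₁ with head := Function.update s₁.head i v } l u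
              = s₁.atRound (i :: l) (v * N + u) := by
          intro s₁ h1
          simp only [Store.atRound, Store.mk.injEq, true_and, and_true, h1]
          funext k
          by_cases hk : k = i
          · subst hk
            simp only [hil, if_false, Function.update_self, List.mem_cons_self, if_true, digit]
            rw [← hN, Nat.mul_comm, Nat.mul_add_div hNpos, Nat.div_eq_of_lt hu, Nat.add_zero]
          · simp only [List.mem_cons, hk, false_or, digit, if_false, ← hN,
              Function.update_of_ne hk]
            rw [Nat.mul_comm, Nat.mul_add_mod, Nat.mod_eq_of_lt hu]
        rw [hat s₁ (hrest _ _ _ _ _ _ hK).1]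
        obtain ⟨e, rfl⟩ : ∃ e, t = t₁ + e := ⟨t - t₁, by omega⟩
        refine (Sp.frame e (hbody _ hlt _ _ _ _ _ hK)).mono ?_
        rintro s' t' w' p' φ' ⟨t₂, rfl, s₂, t₃, rfl, ht₃, hK₂⟩
        rw [hc] at ht₃
        refine ⟨{ s₂ with head := Function.update s₂.head i v }, t₂ + e - c,
          (hat s₂ (hrest _ _ _ _ _ _ hK₂).1).symm, by omega, s₂, t₃, rfl, ?_, hK₂⟩
        rw [if_neg (by omega)]
        split_ifs at ht <;> omega
    intro s t w p φ hK
    have outer : ∀ d v s t w p φ, v + d = r → J v s t w p φ →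
        (loop (fun v => v.inside i) ((nest l B).seq
          (shiftHeads (fun j => decide (j = i)) Move.right))).Sp x
          (fun s t w p φ => J r s (t + 1) w p φ) s t w p φ := by
      intro d
      induction d with
      | zero =>
        rintro v s t w p φ hv hJ
        obtain rfl : v = r := hv
        obtain ⟨t, rfl⟩ : ∃ t', t = t' + 1 := by
          obtain ⟨s₀, t₀, rfl, ht, hK⟩ := hJ
          exact ⟨t - 1, by omega⟩
        refine Sp.loop_false ?_ hJ
        obtain ⟨s₀, t₀, rfl, ht, hK⟩ := hJ
        simp [Store.view, (hrest _ _ _ _ _ _ hK).1]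
      | succ d ihd =>
        rintro v s t w p φ hv hJ
        obtain ⟨t, rfl⟩ : ∃ t', t = t' + 1 := by
          obtain ⟨s₀, t₀, rfl, ht, hK⟩ := hJ
          exact ⟨t - 1, by omega⟩
        refine Sp.loop_true ?_ ?_
        · obtain ⟨s₀, t₀, rfl, ht, hK⟩ := hJ
          simp [Store.view, (hrest _ _ _ _ _ _ hK).1]
          omega
        · refine (inner v (by omega) _ _ _ _ _ hJ).mono ?_
          rintro s t w p φ ⟨hJ, ht⟩
          refine (runs_shiftHeads _ _ s).sp (t := t - 1) ?_ (by omega)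
          exact ihd _ _ _ _ _ _ (by omega) hJ
    have hs := (hrest _ _ _ _ _ _ hK).2 i List.mem_cons_self
    refine (outer r 0 s _ w p φ (by omega) ⟨s, t, ?_, ?_, by simpa using hK⟩).conseq ?_
    · rw [← hs, Function.update_eq_self]
    · simp only [List.length_cons]; omega
    · rintro s t w p φ ⟨s₀, t₀, rfl, ht, hK⟩
      refine ⟨t, w, p, le_rfl, le_rfl, le_rfl, ?_⟩
      refine (runs_rewind _ _ (h := r) ?_).sp (t := t₀) ?_ (by omega)
      · intro j hj
        obtain rfl : j = i := by simpa using hj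
        simp
      · have : (fun j => if decide (j = i) = true then 0
            else Function.update s₀.head i r j) = s₀.head := by
          funext j
          by_cases hj : j = i
          · subst hj
            simpa using ((hrest _ _ _ _ _ _ hK).2 j List.mem_cons_self).symm
          · simp [hj]
        simp only [this, hpow]
        exact hK

/-- A nested loop whose rounds lead deterministically through the stores `f 0, f 1, …`. -/
theorem Runs.nest {r : ℕ} {l : List ι} (hl : l.Nodup) {B : Prog α ι β} (f : ℕ → Store ι β)
    {n N : ℕ} (hN : N = r ^ l.length)
    (hrest : ∀ u, (f u).len = r ∧ ∀ i ∈ l, (f u).head i = 0)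
    (hbody : ∀ u < N, B.Runs x ((f u).atRound l u) n ((f (u + 1)).atRound l u)) :
    (nest l B).Runs x (f 0) (N * (n + l.length * (l.length + 3)) + 2 * l.length) (f N) := by
  subst hN
  intro k t w p φ hk
  set c := l.length * (l.length + 3)
  have := sp_nest (x := x) r l hl B (fun u s t' w' p' φ' => u ≤ r ^ l.length ∧
      s = f u ∧ t' = t + (r ^ l.length - u) * (n + c) ∧ w' = w ∧ p' = p ∧ φ' = φ) ?_ ?_
    (f 0) (t + r ^ l.length * (n + c)) w p φ ⟨by omega, rfl, by simp, rfl, rfl, rfl⟩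
  · refine (this.mono ?_).relax (by omega) le_rfl le_rfl
    rintro s t' w' p' φ' ⟨_, rfl, rfl, rfl, rfl, rfl⟩
    simpa using hk
  · rintro u s t' w' p' φ' ⟨_, rfl, -⟩
    exact hrest u
  · rintro u hu s t' w' p' φ' ⟨_, rfl, rfl, rfl, rfl, rfl⟩
    have he : r ^ l.length - u = r ^ l.length - (u + 1) + 1 := by omega
    refine (hbody u hu).sp (t := t + (r ^ l.length - (u + 1)) * (n + c) + c) ?_ ?_
    · exact ⟨_, _, rfl, le_rfl, by omega, rfl, rfl, rfl, rfl, rfl⟩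
    · rw [he, Nat.succ_mul]
      omega

/-- A round of a nested loop is determined by its digits. -/
theorem _root_.AltTime.digit_injective {r : ℕ} {l : List ι} (hl : l.Nodup) {u v : ℕ}
    (hu : u < r ^ l.length) (hv : v < r ^ l.length)
    (h : ∀ i ∈ l, digit r l u i = digit r l v i) : u = v := by
  induction l generalizing u v with
  | nil => simp at hu hv; omega
  | cons i l ih =>
    obtain ⟨hil, hl⟩ := List.nodup_cons.1 hl
    have hr : 0 < r ^ l.length := by
      rcases Nat.eq_zero_or_pos r with rfl | hr
      · simp at hu
      · exact pow_pos hr _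
    have h1 : u / r ^ l.length = v / r ^ l.length := by
      simpa [digit] using h i List.mem_cons_self
    have h2 : u % r ^ l.length = v % r ^ l.length := by
      refine ih hl (Nat.mod_lt _ hr) (Nat.mod_lt _ hr) fun j hj => ?_
      have hji : j ≠ i := fun h => hil (h ▸ hj)
      simpa [digit, hji] using h j (List.mem_cons_of_mem _ hj)
    rw [← Nat.div_add_mod u (r ^ l.length), ← Nat.div_add_mod v (r ^ l.length), h1, h2]

theorem _root_.AltTime.digit_lt {r : ℕ} {l : List ι} {u : ℕ} (hu : u < r ^ l.length) {i : ι}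
    (hi : i ∈ l) : digit r l u i < r := by
  induction l generalizing u with
  | nil => simp at hi
  | cons j l ih =>
    have hr : 0 < r ^ l.length := by
      rcases Nat.eq_zero_or_pos r with rfl | hr
      · simp at hu
      · exact pow_pos hr _
    rw [digit]
    split_ifs with h
    · rw [Nat.div_lt_iff_lt_mul hr]
      rwa [List.length_cons, pow_succ, mul_comm] at hu
    · exact ih (Nat.mod_lt _ hr) (by simpa [h] using hi)

/-! ### Choices from a list -/

/-- Existential choice between the programs `f a`, `a ∈ l`, by guessing bits. -/
def choose {κ : Type} (f : κ → Prog α ι β) : List κ → Prog α ι β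
  | [] => halt false
  | a :: l => guess Quantifier.ex fun b => cond b (f a) (choose f l)

omit [DecidableEq ι] in
theorem sp_choose {κ : Type} (f : κ → Prog α ι β) (l : List κ) {k : Post ι β} {s : Store ι β}
    {t w p : ℕ} (hp : phaseQuantifier p = Quantifier.ex) (ψ : κ → Prop)
    (h : ∀ a ∈ l, (f a).Sp x k s t w p (ψ a)) :
    (choose f l).Sp x k s (t + l.length) (w + l.length) p (∃ a ∈ l, ψ a) := by
  induction l with
  | nil => simp [choose, Sp]
  | cons a l ih =>
    refine ⟨t + l.length, w + l.length, p, le_rfl, le_rfl, le_rfl, hp,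
      fun b => cond b (ψ a) (∃ a ∈ l, ψ a), fun _ => ?_, fun h => by simp at h, fun b => ?_⟩
    · simp [or_comm]
    · cases b with
      | true => exact (h a List.mem_cons_self).relax (by omega) (by omega) le_rfl
      | false => exact ih fun a ha => h a (List.mem_cons_of_mem _ ha)

end Prog
end AltTime

namespace AltTime

/-! ### Copying, guessing and selecting words -/

/-- Replace the contents of the `N` cells from cell `h` on by `f 0, …, f (N - 1)`. -/
def splice {β : Type} (d : ℕ → β) (h N : ℕ) (f : ℕ → β) : ℕ → β :=
  fun p => if h ≤ p ∧ p < h + N then f (p - h) else d p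

section Splice

variable {β : Type} (d : ℕ → β) (h N : ℕ) (f : ℕ → β)

@[simp] theorem splice_zero : splice d h 0 f = d := by
  funext p
  simp only [splice]
  rw [if_neg (by omega)]

theorem splice_succ : splice d h (N + 1) f = Function.update (splice d h N f) (h + N) (f N) := by
  funext p
  by_cases hp : p = h + N
  · subst hp
    simp [splice]
  · rw [Function.update_of_ne hp]
    simp only [splice]
    exact if_congr (by omega) rfl rfl

theorem splice_congr {g : ℕ → β} (hfg : ∀ a < N, f a = g a) : splice d h N f = splice d h N g := by
  funext p
  simp only [splice]
  split_ifs with hp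
  · exact hfg _ (by omega)
  · rfl

end Splice

/-- Replace the contents and the head position of tape `i`. -/
def Store.set {ι β : Type} [DecidableEq ι] (s : Store ι β) (i : ι) (d : ℕ → β) (h : ℕ) :
    Store ι β :=
  { s with data := Function.update s.data i d, head := Function.update s.head i h }

namespace Prog

variable {α ι β : Type} {x : List α} [DecidableEq ι]

theorem _root_.AltTime.Store.set_atRound (s : Store ι β) {i : ι} {l : List ι} (hi : i ∉ l)
    (d : ℕ → β) (h u : ℕ) : (s.set i d h).atRound l u = (s.atRound l u).set i d h := by
  simp only [Store.set, Store.atRound, Store.mk.injEq, true_and, and_true]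
  funext k
  by_cases hk : k = i
  · subst hk; simp [hi]
  · simp [hk]

theorem _root_.AltTime.Store.atRound_head_of_notMem (s : Store ι β) {i : ι} {l : List ι}
    (hi : i ∉ l) (u : ℕ) : (s.atRound l u).head i = s.head i := by
  simp [Store.atRound, hi]

/-- Write `a` on tape `i` and move its head to the right. -/
def putRight (i : ι) (a : β) : Prog α ι β :=
  act fun v => ⟨Function.update v.data i a, fun k => if k = i then Move.right else Move.stay,
    Move.stay⟩

theorem runs_putRight (i : ι) (a : β) (s : Store ι β) :
    (putRight i a).Runs x s 1
      (s.set i (Function.update (s.data i) (s.head i) a) (s.head i + 1)) := by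
  refine .act ?_
  simp only [Store.exec, Store.set, Store.view, Move.shiftInp, Store.mk.injEq, true_and, and_true]
  constructor
  · funext k
    by_cases hk : k = i
    · subst hk; simp
    · simp [hk]
  · funext k
    by_cases hk : k = i
    · subst hk; simp [Move.shift]
    · simp [hk, Move.shift]

/-- Copy a word from tape `i` to all tapes in `J`; the nested loop over `l` counts its length. -/
noncomputable def copyWord (l : List ι) (i : ι) (J : ι → Bool) : Prog α ι β :=
  nest l (act fun v => ⟨fun k => if J k then v.data i else v.data k,
    fun k => if J k || decide (k = i) then Move.right else Move.stay, Move.stay⟩)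

theorem runs_copyWord {l : List ι} (hl : l.Nodup) {i : ι} {J : ι → Bool} (hi : i ∉ l)
    (hJ : ∀ k, J k → k ∉ l ∧ k ≠ i) {s : Store ι β} (hs : ∀ k ∈ l, s.head k = 0) {N : ℕ}
    (hN : N = s.len ^ l.length) :
    (copyWord l i J).Runs x s (N * (1 + l.length * (l.length + 3)) + 2 * l.length)
      { s with
        data := fun k => if J k then
          splice (s.data k) (s.head k) N (fun p => s.data i (s.head i + p)) else s.data k
        head := fun k => if J k || decide (k = i) then s.head k + N else s.head k } := by
  have hil : ∀ k ∈ l, (J k || decide (k = i)) = false := by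
    intro k hk
    rw [Bool.or_eq_false_iff]
    refine ⟨?_, decide_eq_false fun h => hi (h ▸ hk)⟩
    by_contra h
    exact (hJ k (by simpa using h)).1 hk
  have key := Runs.nest (x := x) hl (B := act fun v => ⟨fun k => if J k then v.data i else v.data k,
    fun k => if J k || decide (k = i) then Move.right else Move.stay, Move.stay⟩)
    (fun u => { s with
        data := fun k => if J k then
          splice (s.data k) (s.head k) u (fun p => s.data i (s.head i + p)) else s.data k
        head := fun k => if J k || decide (k = i) then s.head k + u else s.head k })
    (n := 1) hN ?_ ?_
  · have h0 : s = { s with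
        data := fun k => if J k then
          splice (s.data k) (s.head k) 0 (fun p => s.data i (s.head i + p)) else s.data k
        head := fun k => if J k || decide (k = i) then s.head k + 0 else s.head k } := by
      simp
    rw [← h0] at key
    exact key
  · intro u
    refine ⟨rfl, fun k hk => ?_⟩
    simp only [hil k hk]
    simpa using hs k hk
  · intro u hu
    have hJi : J i = false := by
      by_contra h
      exact (hJ i (by simpa using h)).2 rfl
    refine .act ?_
    simp only [Store.exec, Store.atRound, Store.view, Move.shiftInp, Store.mk.injEq, true_and,
      and_true]
    constructor
    · funext k
      by_cases hk : J k
      · have hkl := (hJ k hk).1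
        simp [hk, hkl, hi, splice_succ, hJi]
      · simp [hk]
    · funext k
      by_cases hk : k ∈ l
      · simp [hk, hil k hk, Move.shift]
      · simp only [hk, if_false]
        by_cases hk' : (J k || decide (k = i)) = true
        · rw [if_pos hk', if_pos hk', if_pos hk']
          simp [Move.shift, Nat.add_assoc]
        · rw [if_neg hk', if_neg hk', if_neg hk']
          rfl

/-- Existentially guess a word over `A` on tape `i`. -/
theorem sp_guessWord {l : List ι} (hl : l.Nodup) {i : ι} (hi : i ∉ l) (A : List β)
    {s : Store ι β} (hs : ∀ k ∈ l, s.head k = 0) {N : ℕ} (hN : N = s.len ^ l.length)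
    {t w p : ℕ} (hp : phaseQuantifier p = Quantifier.ex) {Φ : (ℕ → β) → Prop}
    (hΦ : ∀ G G' : ℕ → β, (∀ a < N, G a = G' a) → Φ G → Φ G') {k : Post ι β}
    (hk : ∀ G : ℕ → β, (∀ a < N, G a ∈ A) →
      k (s.set i (splice (s.data i) (s.head i) N G) (s.head i + N)) t w p (Φ G)) :
    (nest l (choose (putRight i) A)).Sp x k s
      (t + (N * (A.length + 1 + l.length * (l.length + 3)) + 2 * l.length)) (w + N * A.length) p
      (∃ G : ℕ → β, (∀ a < N, G a ∈ A) ∧ Φ G) := by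
  subst hN
  set N := s.len ^ l.length with hN
  set c := l.length * (l.length + 3) with hc
  let K : ℕ → Post ι β := fun u s' t' w' p' φ' => u ≤ N ∧ ∃ G : ℕ → β, (∀ a < u, G a ∈ A) ∧
    s' = s.set i (splice (s.data i) (s.head i) u G) (s.head i + u) ∧
    t' = t + (N - u) * (A.length + 1 + c) ∧ w' = w + (N - u) * A.length ∧ p' = p ∧
    (φ' ↔ ∃ G', (∀ a < u, G' a = G a) ∧ (∀ a < N, G' a ∈ A) ∧ Φ G')
  have key := sp_nest (x := x) s.len l hl (choose (putRight i) A) K ?_ ?_ s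
    (t + N * (A.length + 1 + c)) (w + N * A.length) p (∃ G : ℕ → β, (∀ a < N, G a ∈ A) ∧ Φ G)
    ⟨by omega, s.data i, by simp, by simp [Store.set], by simp, by simp, rfl,
      by simp⟩
  · refine (key.mono ?_).relax (by omega) le_rfl le_rfl
    rintro s' t' w' p' φ' ⟨-, G, hG, rfl, rfl, rfl, rfl, hφ⟩
    have : φ' ↔ Φ G := by
      rw [hφ]
      exact ⟨fun ⟨G', h1, _, h3⟩ => hΦ _ _ h1 h3, fun h => ⟨G, fun _ _ => rfl, hG, h⟩⟩
    rw [propext this]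
    rw [← hN, Nat.sub_self, Nat.zero_mul, Nat.zero_mul]
    exact hk G hG
  · rintro u s' t' w' p' φ' ⟨-, G, hG, rfl, -⟩
    refine ⟨rfl, fun k hk => ?_⟩
    have : k ≠ i := fun h => hi (h ▸ hk)
    simpa [Store.set, this] using hs k hk
  · rintro u hu s' t' w' p' φ' ⟨-, G, hG, rfl, rfl, rfl, rfl, hφ⟩
    rw [← hN] at hu
    obtain ⟨m, hm⟩ : ∃ m, N - u = m + 1 := ⟨N - u - 1, by omega⟩
    have hm' : N - (u + 1) = m := by omega
    have h := sp_choose (x := x) (putRight i) A (k := fun s' t' w' p' φ' => ∃ s'' t'',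
        s' = s''.atRound l u ∧ t'' + c ≤ t' ∧ K (u + 1) s'' t'' w' p' φ')
      (s := (s.set i (splice (s.data i) (s.head i) u G) (s.head i + u)).atRound l u)
      (t := t + m * (A.length + 1 + c) + c + 1) (w := w + m * A.length) hp
      (fun a => ∃ G', (∀ b < u, G' b = G b) ∧ G' u = a ∧ (∀ b < N, G' b ∈ A) ∧ Φ G') ?_
    · have : φ' ↔ ∃ a ∈ A, ∃ G', (∀ b < u, G' b = G b) ∧ G' u = a ∧ (∀ b < N, G' b ∈ A) ∧
          Φ G' := by
        rw [hφ]
        exact ⟨fun ⟨G', h1, h2, h3⟩ => ⟨G' u, h2 u hu, G', h1, rfl, h2, h3⟩,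
          fun ⟨_, _, G', h1, _, h2, h3⟩ => ⟨G', h1, h2, h3⟩⟩
      rw [propext this, hm, Nat.succ_mul, Nat.succ_mul]
      exact h.relax (by omega) (by omega) le_rfl
    · intro a ha
      refine (runs_putRight i a _).sp (t := t + m * (A.length + 1 + c) + c) ?_ le_rfl
      have hG' : ∀ b < u, Function.update G u a b = G b := fun b hb =>
        Function.update_of_ne (by omega) _ _
      refine ⟨s.set i (splice (s.data i) (s.head i) (u + 1) (Function.update G u a))
        (s.head i + (u + 1)), _, ?_, le_rfl, by omega, Function.update G u a, ?_, rfl,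
        by rw [hm'], by rw [hm'], rfl, ?_⟩
      · rw [Store.set_atRound _ hi, Store.set_atRound _ hi, splice_succ,
          splice_congr _ _ _ _ hG']
        simp [Store.set, Nat.add_assoc]
      · intro b hb
        rcases Nat.lt_succ_iff_lt_or_eq.1 hb with hb | rfl
        · rw [hG' b hb]; exact hG b hb
        · simpa using ha
      · refine exists_congr fun G' => ?_
        constructor
        · rintro ⟨h1, h2, h3⟩
          refine ⟨fun b hb => ?_, h3⟩
          rcases Nat.lt_succ_iff_lt_or_eq.1 hb with hb | rfl
          · rw [hG' b hb]; exact h1 b hb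
          · simpa using h2
        · rintro ⟨h1, h3⟩
          exact ⟨fun b hb => (h1 b (by omega)).trans (hG' b hb),
            (h1 u (by omega)).trans (by simp), h3⟩

/-- Universally choose a number `v` of rounds of the nested loop over `l₀`, and move the head of
tape `i` to the right by `v` times the length of the nested loop over `l`. -/
noncomputable def selectBlock (l₀ l : List ι) (i : ι) : Prog α ι β :=
  nest l₀ (guess Quantifier.all fun b =>
    cond b (nest l (shiftHeads (fun k => decide (k = i)) Move.right))
      (shiftHeads (fun _ => false) Move.right))

/-- The universal choice is made by one bit in each of the `N₀` rounds; several sequences of bits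
select the same block. -/
theorem sp_selectBlock {l₀ l : List ι} (hl₀ : l₀.Nodup) (hl : l.Nodup) {i : ι} (hi₀ : i ∉ l₀)
    (hi : i ∉ l) (hll : ∀ k ∈ l, k ∉ l₀) {s : Store ι β} (hs₀ : ∀ k ∈ l₀, s.head k = 0)
    (hs : ∀ k ∈ l, s.head k = 0) (hsi : s.head i = 0) {N₀ N : ℕ} (hN₀ : N₀ = s.len ^ l₀.length)
    (hN : N = s.len ^ l.length) {t w p : ℕ} (hp : phaseQuantifier p = Quantifier.all)
    {Φ : ℕ → Prop} {k : Post ι β}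
    (hk : ∀ v ≤ N₀, k (s.set i (s.data i) (v * N)) t w p (Φ v)) :
    (selectBlock l₀ l i).Sp x k s
      (t + (N₀ * (N * (1 + l.length * (l.length + 3)) + 2 * l.length + 2 +
        l₀.length * (l₀.length + 3)) + 2 * l₀.length)) (w + N₀) p (∀ v ≤ N₀, Φ v) := by
  subst hN₀
  set N₀ := s.len ^ l₀.length with hN₀
  set c := l₀.length * (l₀.length + 3) with hc
  set n := N * (1 + l.length * (l.length + 3)) + 2 * l.length with hn
  let K : ℕ → Post ι β := fun u s' t' w' p' φ' => u ≤ N₀ ∧ ∃ v ≤ u,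
    s' = s.set i (s.data i) (v * N) ∧
    t' = t + (N₀ - u) * (n + 2 + c) ∧ w' = w + (N₀ - u) ∧ p' = p ∧
    (φ' ↔ ∀ v', v ≤ v' → v' ≤ v + (N₀ - u) → Φ v')
  -- Advancing the head by one block.
  have adv : ∀ u v, (nest l (shiftHeads (fun k => decide (k = i)) Move.right) : Prog α ι β).Runs x
      ((s.set i (s.data i) (v * N)).atRound l₀ u) n
      ((s.set i (s.data i) ((v + 1) * N)).atRound l₀ u) := by
    intro u v
    have := Runs.nest (x := x) hl (B := (shiftHeads (fun k => decide (k = i)) Move.right))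
      (fun a => (s.set i (s.data i) (v * N + a)).atRound l₀ u) (n := 1) hN ?_ ?_
    · simpa [Nat.succ_mul, hn] using this
    · intro a
      refine ⟨rfl, fun k hk => ?_⟩
      have hki : k ≠ i := fun h => hi (h ▸ hk)
      rw [Store.atRound_head_of_notMem _ (hll k hk)]
      simpa [Store.set, hki] using hs k hk
    · intro a _
      convert runs_shiftHeads (x := x) (fun k => decide (k = i)) Move.right _ using 1
      rw [Store.set_atRound _ hi₀, Store.set_atRound _ hi₀, Store.set_atRound _ hi,
        Store.set_atRound _ hi]
      simp only [Store.set, Store.mk.injEq, true_and, and_true]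
      funext k
      by_cases hk : k = i
      · subst hk; simp [Move.shift, Nat.add_assoc]
      · simp [hk]
  have key := sp_nest (x := x) s.len l₀ hl₀ (guess Quantifier.all fun b =>
    cond b (nest l (shiftHeads (fun k => decide (k = i)) Move.right))
      (shiftHeads (fun _ => false) Move.right)) K ?_ ?_ s
    (t + N₀ * (n + 2 + c)) (w + N₀) p (∀ v ≤ N₀, Φ v)
    ⟨by omega, 0, le_rfl, by rw [Nat.zero_mul, ← hsi]; simp [Store.set], by simp, by simp, rfl,
      by simp⟩
  · refine (key.mono ?_).relax (by omega) le_rfl le_rfl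
    rintro s' t' w' p' φ' ⟨-, v, hv, rfl, rfl, rfl, rfl, hφ⟩
    have : φ' ↔ Φ v := by
      rw [hφ]
      exact ⟨fun h => h v le_rfl (by omega), fun h v' h1 h2 => by
        obtain rfl : v' = v := by omega
        exact h⟩
    rw [propext this]
    rw [← hN₀, Nat.sub_self, Nat.zero_mul]
    exact hk v hv
  · rintro u s' t' w' p' φ' ⟨-, v, hv, rfl, -⟩
    refine ⟨rfl, fun k hk => ?_⟩
    have : k ≠ i := fun h => hi₀ (h ▸ hk)
    simpa [Store.set, this] using hs₀ k hk
  · rintro u hu s' t' w' p' φ' ⟨-, v, hv, rfl, rfl, rfl, rfl, hφ⟩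
    rw [← hN₀] at hu
    obtain ⟨m, hm⟩ : ∃ m, N₀ - u = m + 1 := ⟨N₀ - u - 1, by omega⟩
    have hm' : N₀ - (u + 1) = m := by omega
    rw [hm] at hφ ⊢
    refine ⟨t + m * (n + 2 + c) + c + n + 1, w + m, p', by rw [Nat.succ_mul]; omega, by omega,
      le_rfl, hp, fun b => cond b (∀ v', v + 1 ≤ v' → v' ≤ v + 1 + m → Φ v')
        (∀ v', v ≤ v' → v' ≤ v + m → Φ v'), by simp, fun _ => ?_, ?_⟩
    · rw [hφ]
      simp only [Bool.forall_bool, cond_true, cond_false]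
      constructor
      · exact fun h => ⟨fun v' h1 h2 => h v' h1 (by omega),
          fun v' h1 h2 => h v' (by omega) (by omega)⟩
      · rintro ⟨h1, h2⟩ v' h3 h4
        rcases Nat.lt_or_ge v v' with h | h
        · exact h2 v' h (by omega)
        · exact h1 v' h3 (by omega)
    · intro b
      cases b with
      | true =>
        refine (adv u v).sp (t := t + m * (n + 2 + c) + c) ?_ (by omega)
        exact ⟨_, _, rfl, le_rfl, hu, v + 1, by omega, rfl, by rw [hm'], by rw [hm'], rfl,
          by rw [hm']; rfl⟩
      | false =>
        refine (runs_shiftHeads _ _ _).sp (t := t + m * (n + 2 + c) + c) ?_ (by omega)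
        exact ⟨_, _, by simp, le_rfl, hu, v, by omega, rfl, by rw [hm'], by rw [hm'], rfl,
          by rw [hm']; rfl⟩

end Prog
end AltTime

namespace AltTime

/-! ### The recursion over time intervals -/

/-- The tapes: `dig i` for the digits of the simulated input head position, `rul i` and `row` as
counters of nested loops, `lev b` for the sequences of configurations guessed at the levels of the
recursion (consecutive levels alternate between the two), and `prev`, `cur`, `next`, `flag` for the
comparison of two configurations. -/
inductive Tape (q j : ℕ) : Type where
  | dig (i : Fin q) : Tape q j
  | rul (i : Fin j) : Tape q j
  | row : Tape q j
  | lev (b : Bool) : Tape q j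
  | prev : Tape q j
  | cur : Tape q j
  | next : Tape q j
  | flag : Tape q j
  deriving DecidableEq

namespace Tape

variable {q j : ℕ}

theorem finite : Finite (Tape q j) :=
  Finite.of_surjective
    (fun y : (Fin q ⊕ Fin j) ⊕ (Bool ⊕ Fin 5) => match y with
      | .inl (.inl i) => dig i
      | .inl (.inr i) => rul i
      | .inr (.inl b) => lev b
      | .inr (.inr 0) => row
      | .inr (.inr 1) => prev
      | .inr (.inr 2) => cur
      | .inr (.inr 3) => next
      | .inr (.inr 4) => flag)
    (fun y => match y with
      | dig i => ⟨.inl (.inl i), rfl⟩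
      | rul i => ⟨.inl (.inr i), rfl⟩
      | lev b => ⟨.inr (.inl b), rfl⟩
      | row => ⟨.inr (.inr 0), rfl⟩
      | prev => ⟨.inr (.inr 1), rfl⟩
      | cur => ⟨.inr (.inr 2), rfl⟩
      | next => ⟨.inr (.inr 3), rfl⟩
      | flag => ⟨.inr (.inr 4), rfl⟩)

/-- The counters for loops of length `len ^ j`. -/
def ruls (q j : ℕ) : List (Tape q j) := (List.finRange j).map rul

theorem nodup_ruls : (ruls q j).Nodup :=
  (List.nodup_finRange j).map fun _ _ h => by simpa using h

@[simp] theorem length_ruls : (ruls q j).length = j := by simp [ruls]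

@[simp] theorem row_notMem_ruls : row ∉ ruls q j := by simp [ruls]

@[simp] theorem lev_notMem_ruls (b : Bool) : lev b ∉ ruls q j := by simp [ruls]

end Tape

/-- The word of length `S` in the cells from cell `h` on, continued by blanks. -/
def window {Δ : Type} (S : ℕ) (d : ℕ → Option Δ) (h : ℕ) : ℕ → Option Δ :=
  fun p => if p < S then d (h + p) else none

/-- The concatenation of `W`, `r` words given by `G`, and `W'`, where all words have length `S`. -/
def catWords {Δ : Type} (S r : ℕ) (W G W' : ℕ → Option Δ) : ℕ → Option Δ :=
  splice (splice (splice (fun _ => none) 0 S W) S (r * S) G) (S + r * S) S W'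

/-- The relation on words that is decided by `K` levels of the recursion over the relation `R`:
there are words `W = W₀, W₁, …, W_{r+1} = W'` with entries from `A` such that consecutive words are
related by the relation of `K - 1` levels. -/
def LevelRel {Δ : Type} (A : List (Option Δ)) (S r : ℕ)
    (R : (ℕ → Option Δ) → (ℕ → Option Δ) → Prop) : ℕ → (ℕ → Option Δ) → (ℕ → Option Δ) → Prop
  | 0, W, W' => R W W'
  | K + 1, W, W' => ∃ G : ℕ → Option Δ, (∀ a < r * S, G a ∈ A) ∧ ∀ v ≤ r,
      LevelRel A S r R K (window S (catWords S r W G W') (v * S))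
        (window S (catWords S r W G W') ((v + 1) * S))

/-- The store during the recursion: the tape `lev b` has contents `d` and head position `h`, the
other level tape has contents `d'` and head position `h'`. -/
def levStore {q j : ℕ} {Δ : Type} (r : ℕ) (b : Bool) (d : ℕ → Option Δ) (h : ℕ)
    (d' : ℕ → Option Δ) (h' : ℕ) : Store (Tape q j) (Option Δ) where
  len := r
  data := fun
    | .lev b' => if b' = b then d else d'
    | _ => fun _ => none
  head := fun
    | .lev b' => if b' = b then h else h'
    | _ => 0
  inp := 0

namespace Prog

variable {α : Type} {x : List α} {q j : ℕ} {Δ : Type}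

open Tape

/-- One level: a sequence of words is guessed between the two words at the head of `lev b`, and two
consecutive words of it are selected. -/
noncomputable def level (A : List (Option Δ)) (b : Bool) : Prog α (Tape q j) (Option Δ) :=
  (rewind fun k => decide (k = lev (!b))).seq <|
  (copyWord (ruls q j) (lev b) fun k => decide (k = lev (!b))).seq <|
  (nest (row :: ruls q j) (choose (putRight (lev (!b))) A)).seq <|
  (copyWord (ruls q j) (lev b) fun k => decide (k = lev (!b))).seq <|
  (rewind fun k => decide (k = lev (!b))).seq <|
  selectBlock [row] (ruls q j) (lev (!b))

/-- `K` levels followed by a final program. -/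
noncomputable def levels (A : List (Option Δ)) (F : Bool → Prog α (Tape q j) (Option Δ)) :
    ℕ → Bool → Prog α (Tape q j) (Option Δ)
  | 0, b => F b
  | K + 1, b => (level A b).seq (levels A F K (!b))

/-- A bound for the number of steps of one level, given `S = len ^ j`, `r = len`, and the number `a`
of symbols. -/
def levelTime (j S r a : ℕ) : ℕ :=
  (2 * ((r + 2) * S) + 1) + (S * (1 + j * (j + 3)) + 2 * j) +
  (r * S * (a + 1 + (j + 1) * (j + 1 + 3)) + 2 * (j + 1)) + (S * (1 + j * (j + 3)) + 2 * j) +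
  (2 * ((r + 2) * S) + 1) + (r * (S * (1 + j * (j + 3)) + 2 * j + 2 + 4) + 2)

theorem runs_rewind_lev (b : Bool) (r : ℕ) (d d' : ℕ → Option Δ) (h h' n : ℕ) (hn : h' ≤ n) :
    (rewind fun k => decide (k = lev (!b)) : Prog α (Tape q j) (Option Δ)).Runs x
      (levStore r b d h d' h') (2 * n + 1) (levStore r b d h d' 0) := by
  convert runs_rewind (x := x) _ (levStore r b d h d' h') (h := n) ?_ using 1
  · simp only [levStore, Store.mk.injEq, true_and, and_true]
    funext k
    cases k with
    | lev b' => cases b <;> cases b' <;> simp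
    | _ => simp
  · intro i hi
    obtain rfl : i = lev (!b) := by simpa using hi
    simpa [levStore] using hn

theorem runs_copyWord_lev (b : Bool) (r : ℕ) (d d' : ℕ → Option Δ) (h h' : ℕ) :
    (copyWord (ruls q j) (lev b) fun k => decide (k = lev (!b)) :
      Prog α (Tape q j) (Option Δ)).Runs x
      (levStore r b d h d' h') (r ^ j * (1 + j * (j + 3)) + 2 * j)
      (levStore r b d (h + r ^ j) (splice d' h' (r ^ j) fun p => d (h + p)) (h' + r ^ j)) := by
  convert runs_copyWord (x := x) (nodup_ruls (q := q) (j := j)) (i := lev b)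
    (J := fun k => decide (k = lev (!b)))
    (s := levStore r b d h d' h') (N := r ^ j) (by simp) ?_ ?_ (by rw [length_ruls]; rfl) using 1
  · simp
  · simp only [levStore, Store.mk.injEq, true_and, and_true]
    constructor
    · funext k
      cases k with
      | lev b' => cases b <;> cases b' <;> simp
      | _ => simp
    · funext k
      cases k with
      | lev b' => cases b <;> cases b' <;> simp
      | _ => simp
  · intro k hk
    obtain rfl : k = lev (!b) := by simpa using hk
    simp
  · intro k hk
    obtain ⟨i, rfl⟩ : ∃ i, rul i = k := by simpa [ruls] using hk
    rfl

theorem levStore_set (b : Bool) (r : ℕ) (d d' : ℕ → Option Δ) (h h' : ℕ) (e : ℕ → Option Δ)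
    (n : ℕ) : (levStore r b d h d' h' : Store (Tape q j) (Option Δ)).set (lev (!b)) e n =
      levStore r b d h e n := by
  simp only [levStore, Store.set, Store.mk.injEq, true_and, and_true]
  constructor
  · funext k
    cases k with
    | lev b' => cases b <;> cases b' <;> simp
    | _ => simp
  · funext k
    cases k with
    | lev b' => cases b <;> cases b' <;> simp
    | _ => simp

/-- Interchanging the roles of the two level tapes. -/
theorem levStore_not (b : Bool) (r : ℕ) (d d' : ℕ → Option Δ) (h h' : ℕ) :
    (levStore r (!b) d h d' h' : Store (Tape q j) (Option Δ)) = levStore r b d' h' d h := by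
  simp only [levStore, Store.mk.injEq, true_and, and_true]
  constructor
  · funext k
    cases k with
    | lev b' => cases b <;> cases b' <;> simp
    | _ => simp
  · funext k
    cases k with
    | lev b' => cases b <;> cases b' <;> simp
    | _ => simp

/-- The contents written by `level` in terms of the words read. -/
theorem window_splice {S r v : ℕ} (hv : v ≤ r + 1) (d d' G : ℕ → Option Δ) (h : ℕ) :
    window S (splice (splice (splice d' 0 S fun p => d (h + p)) (0 + S) (r * S) G)
      (0 + S + r * S) S fun p => d (h + S + p)) (v * S) =
      window S (catWords S r (window S d h) G (window S d (h + S))) (v * S) := by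
  have hvS : v * S ≤ r * S + S := by
    calc v * S ≤ (r + 1) * S := Nat.mul_le_mul_right _ hv
      _ = r * S + S := by ring
  funext p
  simp only [window, catWords, splice]
  generalize v * S = a at *
  generalize r * S = c at *
  split_ifs <;> first | rfl | (exfalso; omega) | (congr 1; omega)

/-- One level consumes two phases: the existential guess of `r` words, and the universal selection
of two consecutive ones. -/
theorem sp_level (A : List (Option Δ)) (b : Bool) {r S : ℕ} (hS : S = r ^ j)
    {d d' : ℕ → Option Δ} {h h' : ℕ} (hh' : h' ≤ (r + 2) * S) {t w p : ℕ} (hp : p % 2 = 0)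
    {R : (ℕ → Option Δ) → (ℕ → Option Δ) → Prop} {k : Post (Tape q j) (Option Δ)}
    (hk : ∀ e v, v ≤ r → k (levStore r b d (h + S + S) e (v * S)) t w p
      (R (window S e (v * S)) (window S e ((v + 1) * S)))) :
    (level A b).Sp x k (levStore r b d h d' h') (t + levelTime j S r A.length)
      (w + (r * S * A.length + r)) (p + 2)
      (∃ G : ℕ → Option Δ, (∀ a < r * S, G a ∈ A) ∧ ∀ v ≤ r,
        R (window S (catWords S r (window S d h) G (window S d (h + S))) (v * S))
          (window S (catWords S r (window S d h) G (window S d (h + S))) ((v + 1) * S))) := by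
  subst hS
  set S := r ^ j with hS
  set n₁ := r ^ j * (1 + j * (j + 3)) + 2 * j with hn₁
  set n₂ := r * S * (A.length + 1 + (j + 1) * (j + 1 + 3)) + 2 * (j + 1) with hn₂
  set n₃ := r * (S * (1 + j * (j + 3)) + 2 * j + 2 + 4) + 2 with hn₃
  have hT : levelTime j S r A.length = (2 * ((r + 2) * S) + 1) + n₁ + n₂ + n₁ +
      (2 * ((r + 2) * S) + 1) + n₃ := rfl
  have hp0 : phaseQuantifier (p + 2) = Quantifier.ex := by
    simp [phaseQuantifier, hp]
  have hp1 : phaseQuantifier (p + 1) = Quantifier.all := by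
    rw [phaseQuantifier, if_neg (by omega)]
  rw [hT]
  refine (runs_rewind_lev b r d d' h h' _ hh').sp
    (t := t + n₁ + n₂ + n₁ + (2 * ((r + 2) * S) + 1) + n₃) ?_ (by omega)
  refine (runs_copyWord_lev b r d d' h 0).sp
    (t := t + n₂ + n₁ + (2 * ((r + 2) * S) + 1) + n₃) ?_ (by omega)
  have hrest : ∀ (d₁ d₂ : ℕ → Option Δ) (h₁ h₂ : ℕ), ∀ k ∈ (row :: ruls q j),
      (levStore r b d₁ h₁ d₂ h₂ : Store (Tape q j) (Option Δ)).head k = 0 := by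
    intro d₁ d₂ h₁ h₂ k hk
    rcases List.mem_cons.1 hk with rfl | hk
    · rfl
    · obtain ⟨i, rfl⟩ : ∃ i, rul i = k := by simpa [ruls] using hk
      rfl
  refine (sp_guessWord (List.nodup_cons.2 ⟨row_notMem_ruls, nodup_ruls⟩)
    (i := lev (!b)) (by simp) A (hrest _ _ _ _) (N := r * S) ?_
    (t := t + n₁ + (2 * ((r + 2) * S) + 1) + n₃) (w := w + r) hp0
    (Φ := fun G => ∀ v ≤ r,
        R (window S (catWords S r (window S d h) G (window S d (h + S))) (v * S))
          (window S (catWords S r (window S d h) G (window S d (h + S))) ((v + 1) * S)))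
    ?_ ?_).relax ?_ (by omega) le_rfl
  · rw [List.length_cons, length_ruls, pow_succ, mul_comm]; rfl
  · intro G G' hG hΦ
    have : catWords S r (window S d h) G' (window S d (h + S)) =
        catWords S r (window S d h) G (window S d (h + S)) := by
      rw [catWords, catWords, splice_congr _ _ _ _ hG]
    rwa [this]
  · intro G _
    rw [levStore_set]
    refine (runs_copyWord_lev b r d _ (h + S) _).sp
      (t := t + (2 * ((r + 2) * S) + 1) + n₃) ?_ (by omega)
    refine (runs_rewind_lev b r d _ _ _ ((r + 2) * S) ?_).sp (t := t + n₃) ?_ (by omega)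
    · have h1 : (levStore r b d (h + r ^ j) (splice d' 0 (r ^ j) fun p => d (h + p)) (0 + r ^ j) :
          Store (Tape q j) (Option Δ)).head (lev (!b)) = 0 + r ^ j := by cases b <;> rfl
      rw [h1, ← hS, Nat.add_mul]
      omega
    · refine (Sp.conseq (k := fun s t w p' φ => p' = p + 1 ∧ k s t w p φ) ?_
        (sp_selectBlock (l₀ := [row]) (l := ruls q j) (by simp) nodup_ruls (by simp)
        (by simp) (fun k hk hk' => ?_) (fun k hk => hrest _ _ _ _ k (by simp_all))
        (fun k hk => hrest _ _ _ _ k (List.mem_cons_of_mem _ hk)) (by cases b <;> rfl)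
        (N₀ := r) (N := S) (by rw [List.length_singleton, pow_one]; rfl)
        (by rw [length_ruls]; rfl) (t := t) (w := w) (p := p + 1) hp1 (fun v hv => ?_))).relax
        (by
          simp only [length_ruls, List.length_singleton, show 1 * (1 + 3) = 4 from rfl]
          omega) le_rfl (by omega)
      · rintro s t w p' φ ⟨rfl, h⟩
        exact ⟨t, w, p, le_rfl, le_rfl, by omega, h⟩
      · obtain rfl := List.mem_singleton.1 hk'
        exact row_notMem_ruls hk
      · refine ⟨rfl, ?_⟩
        rw [levStore_set, ← window_splice (by omega) d d', ← window_splice (by omega) d d']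
        convert hk _ v hv using 2 <;> cases b <;> rfl
  · simp only [List.length_cons, length_ruls]; omega

/-- Every level overwrites the tape from which the level before it has read, so the two tapes
`lev false` and `lev true` are enough. -/
theorem sp_levels (A : List (Option Δ)) (F : Bool → Prog α (Tape q j) (Option Δ)) {r S : ℕ}
    (hS : S = r ^ j) {R : (ℕ → Option Δ) → (ℕ → Option Δ) → Prop} {tF wF : ℕ}
    {k : Post (Tape q j) (Option Δ)}
    (hF : ∀ b d h d' h', (F b).Sp x k (levStore r b d h d' h') tF wF 0
      (R (window S d h) (window S d (h + S)))) (K : ℕ) :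
    ∀ b d h d' h', h ≤ r * S → h' ≤ (r + 2) * S →
    (levels A F K b).Sp x k (levStore r b d h d' h') (tF + K * levelTime j S r A.length)
      (wF + K * (r * S * A.length + r)) (2 * K)
      (LevelRel A S r R K (window S d h) (window S d (h + S))) := by
  induction K with
  | zero => exact fun b d h d' h' _ _ => (hF b d h d' h').relax (by simp) (by simp) (by simp)
  | succ K ih =>
    intro b d h d' h' hh hh'
    refine (sp_level A b hS hh' (t := tF + K * levelTime j S r A.length)
      (w := wF + K * (r * S * A.length + r)) (p := 2 * K) (by omega)
      (R := LevelRel A S r R K) ?_).relax ?_ ?_ ?_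
    · intro e v hv
      rw [← levStore_not]
      convert ih (!b) e (v * S) d (h + S + S) (Nat.mul_le_mul_right _ hv) ?_ using 2
      · rw [Nat.succ_mul]
      · rw [Nat.add_mul]; omega
    · rw [Nat.succ_mul]; omega
    · rw [Nat.succ_mul]; omega
    · omega

end Prog
end AltTime

namespace AltTime

/-! ### Comparing two consecutive configurations -/

/-- A rule by which a word may be rewritten into the next one: the input symbol required, the move
of the input head, and the condition on three consecutive entries of the old word and the entry of
the new word below the middle one. -/
structure LocalRule (α Δ : Type) : Type where
  inSym : InSym α
  inMove : Move
  loc : Option Δ → Option Δ → Option Δ → Option Δ → Bool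

/-- The entry to the left of cell `p`. -/
def prevCell {Δ : Type} (W : ℕ → Option Δ) (p : ℕ) : Option Δ := if p = 0 then none else W (p - 1)

namespace Tape

/-- The tapes for the digits of the simulated input head position. -/
def digs (q j : ℕ) : List (Tape q j) := (List.finRange q).map dig

variable {q j : ℕ}

theorem nodup_digs : (digs q j).Nodup :=
  (List.nodup_finRange q).map fun _ _ h => by simpa using h

@[simp] theorem length_digs : (digs q j).length = q := by simp [digs]

@[simp] theorem dig_mem_digs (i : Fin q) : dig i ∈ digs q j := by simp [digs]

@[simp] theorem rul_mem_ruls (i : Fin j) : rul i ∈ ruls q j := by simp [ruls]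

theorem mem_ruls {k : Tape q j} : k ∈ ruls q j ↔ ∃ i, rul i = k := by simp [ruls]

theorem mem_digs {k : Tape q j} : k ∈ digs q j ↔ ∃ i, dig i = k := by simp [digs]

end Tape

section Match

variable {Δ : Type} {q : ℕ} (j r : ℕ) (mark : Fin q → Option Δ → Bool) (W : ℕ → Option Δ)

/-- The word `W` has marks at all `q` digits of `u` in base `r`. -/
def Matches (u : ℕ) : Prop :=
  ∀ i : Fin q, mark i (W (digit r (Tape.digs q j) u (Tape.dig i))) = true

/-- The number encoded by `W` is `u`, the least number at whose digits `W` has marks. -/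
def FirstMatch (u : ℕ) : Prop :=
  u < r ^ q ∧ Matches j r mark W u ∧ ∀ v < u, ¬ Matches j r mark W v

end Match

/-- The relation between consecutive words: they are equal, or the second arises from the first by
one of the rules. -/
def StepRel {α Δ : Type} (x : List α) (j r S : ℕ) {q : ℕ} (mark : Fin q → Option Δ → Bool)
    (rules : List (LocalRule α Δ)) (W W' : ℕ → Option Δ) : Prop :=
  W = W' ∨ ∃ ρ ∈ rules, ∃ u, FirstMatch j r mark W u ∧
    inputSym x (min u (x.length + 1)) = ρ.inSym ∧
    (∀ p < S, ρ.loc (prevCell W p) (W p) (W (p + 1)) (W' p) = true) ∧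
    FirstMatch j r mark W' (ρ.inMove.shiftInp x.length (min u (x.length + 1)))

namespace Prog

section Test

variable {α ι β : Type} {x : List α} [DecidableEq ι]

/-- A nested loop whose rounds lead deterministically through the stores `f 0, f 1, …`, unless it
rejects because the condition `good u` fails. -/
theorem sp_nest_test {r : ℕ} {l : List ι} (hl : l.Nodup) {B : Prog α ι β} (f : ℕ → Store ι β)
    (good : ℕ → Prop) {n N : ℕ} (hN : N = r ^ l.length)
    (hrest : ∀ u, (f u).len = r ∧ ∀ i ∈ l, (f u).head i = 0)
    (hgood : ∀ u < N, good u → B.Runs x ((f u).atRound l u) n ((f (u + 1)).atRound l u))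
    (hbad : ∀ u < N, ¬ good u → ∀ (k : Post ι β) t w p,
      B.Sp x k ((f u).atRound l u) (t + n) w p False)
    {k : Post ι β} {t w p : ℕ} {φ : Prop} (hk : k (f N) t w p φ) :
    (nest l B).Sp x k (f 0) (t + (N * (n + l.length * (l.length + 3)) + 2 * l.length)) w p
      ((∀ u < N, good u) ∧ φ) := by
  subst hN
  set c := l.length * (l.length + 3)
  have := sp_nest (x := x) r l hl B (fun u s t' w' p' φ' => u ≤ r ^ l.length ∧
      s = f u ∧ t' = t + (r ^ l.length - u) * (n + c) ∧ w' = w ∧ p' = p ∧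
      (φ' ↔ (∀ v, u ≤ v → v < r ^ l.length → good v) ∧ φ)) ?_ ?_
    (f 0) (t + r ^ l.length * (n + c)) w p ((∀ u < r ^ l.length, good u) ∧ φ)
    ⟨by omega, rfl, by simp, rfl, rfl, by simp⟩
  · refine (this.mono ?_).relax (by omega) le_rfl le_rfl
    rintro s t' w' p' φ' ⟨_, rfl, rfl, rfl, rfl, hφ⟩
    have : φ' ↔ φ := by
      rw [hφ]
      exact ⟨fun h => h.2, fun h => ⟨fun v h1 h2 => by omega, h⟩⟩
    rw [propext this]
    simpa using hk
  · rintro u s t' w' p' φ' ⟨_, rfl, -⟩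
    exact hrest u
  · rintro u hu s t' w' p' φ' ⟨_, rfl, rfl, rfl, rfl, hφ⟩
    have he : r ^ l.length - u = r ^ l.length - (u + 1) + 1 := by omega
    by_cases hg : good u
    · refine (hgood u hu hg).sp (t := t + (r ^ l.length - (u + 1)) * (n + c) + c) ?_ ?_
      · refine ⟨_, _, rfl, le_rfl, by omega, rfl, rfl, rfl, rfl, hφ.trans (and_congr_left' ?_)⟩
        refine ⟨fun h v hv => h v (by omega), fun h v hv hv' => ?_⟩
        rcases hv.eq_or_lt with rfl | hv
        · exact hg
        · exact h v hv hv'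
      · rw [he, Nat.succ_mul]
        omega
    · have : φ' ↔ False := by
        rw [hφ, iff_false]
        exact fun h => hg (h.1 u le_rfl hu)
      rw [propext this, he, Nat.succ_mul]
      exact (hbad u hu hg _ (t + (r ^ l.length - (u + 1)) * (n + c) + c) _ _).relax
        (by omega) le_rfl le_rfl

end Test

variable {α : Type} {x : List α} {q j : ℕ} {Δ : Type}

open Tape

/-- The store during the comparison of the word `W` with the word at the head of `lev b`: the word
`V` is on the digit tapes, `c` is the position in the words, `g` the head position on the digit
tapes, `f` tells whether the flag is set, and `y` is the position of the input head. -/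
def _root_.AltTime.cmpStore (r : ℕ) (b : Bool) (d : ℕ → Option Δ) (h : ℕ)
    (d' : ℕ → Option Δ) (h' : ℕ) (W V : ℕ → Option Δ) (c g f y : ℕ) :
    Store (Tape q j) (Option Δ) where
  len := r
  data := fun
    | .lev b' => if b' = b then d else d'
    | .prev => prevCell W
    | .cur => W
    | .next => W
    | .dig _ => V
    | _ => fun _ => none
  head := fun
    | .lev b' => if b' = b then h else h'
    | .prev => c
    | .cur => c
    | .next => c + 1
    | .dig _ => g
    | .flag => f
    | _ => 0
  inp := y

/-- One round of `loadInput`. -/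
def loadStep (mark : Fin q → Option Δ → Bool) : Prog α (Tape q j) (Option Δ) :=
  ite (fun v => v.zero flag)
    (ite (fun v => decide (∀ i, mark i (v.data (dig i)) = true))
      (shiftHeads (fun k => decide (k = flag)) Move.right)
      (moveInp Move.right))
    (shiftHeads (fun _ => false) Move.right)

/-- Move the input head to the position encoded on the digit tapes, and set the flag when it is
reached. -/
noncomputable def loadInput (mark : Fin q → Option Δ → Bool) : Prog α (Tape q j) (Option Δ) :=
  nest (digs q j) (loadStep mark)

/-- Carry out the input move of a rule and clear the flag. -/
def moveInput (d : Move) : Prog α (Tape q j) (Option Δ) :=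
  act fun v => ⟨v.data, fun k => if k = flag then Move.left else Move.stay, d⟩

/-- One round of `checkLocal`. -/
def localStep (b : Bool) (ρ : LocalRule α Δ) : Prog α (Tape q j) (Option Δ) :=
  ite (fun v => ρ.loc (v.data prev) (v.data cur) (v.data next) (v.data (lev b)))
    (act fun v => ⟨fun | dig _ => v.data (lev b) | k => v.data k,
      fun
        | dig _ => Move.right
        | lev b' => if b' = b then Move.right else Move.stay
        | prev => Move.right
        | cur => Move.right
        | next => Move.right
        | _ => Move.stay, Move.stay⟩)
    (halt false)

/-- Check the local condition of a rule in all cells, and copy the new word to the digit tapes. -/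
noncomputable def checkLocal (b : Bool) (ρ : LocalRule α Δ) : Prog α (Tape q j) (Option Δ) :=
  nest (ruls q j) (localStep b ρ)

open Classical in
/-- One round of `unloadInput`. -/
noncomputable def unloadStep (mark : Fin q → Option Δ → Bool) : Prog α (Tape q j) (Option Δ) :=
  ite (fun v => v.zero flag)
    (ite (fun v => decide (v.inSym = InSym.left))
      (ite (fun v => decide (∀ i, mark i (v.data (dig i)) = true))
        (shiftHeads (fun k => decide (k = flag)) Move.right) (halt false))
      (ite (fun v => decide (∀ i, mark i (v.data (dig i)) = true)) (halt false)
        (moveInp Move.left)))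
    (shiftHeads (fun _ => false) Move.right)

/-- Move the input head back to the left end, and check that the number of moves is the number
encoded on the digit tapes. -/
noncomputable def unloadInput (mark : Fin q → Option Δ → Bool) : Prog α (Tape q j) (Option Δ) :=
  nest (digs q j) (unloadStep mark)

open Classical in
/-- One round of `checkEqual`. -/
noncomputable def equalStep (b : Bool) : Prog α (Tape q j) (Option Δ) :=
  ite (fun v => decide (v.data cur = v.data (lev b)))
    (shiftHeads (fun k => decide (k = cur ∨ k = lev b)) Move.right) (halt false)

/-- Check whether two words are equal. -/
noncomputable def checkEqual (b : Bool) : Prog α (Tape q j) (Option Δ) :=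
  (nest (ruls q j) (equalStep b)).seq (halt true)

open Classical in
/-- Check whether the second word arises from the first by a rule. -/
noncomputable def checkRule (mark : Fin q → Option Δ → Bool) (b : Bool) (ρ : LocalRule α Δ) :
    Prog α (Tape q j) (Option Δ) :=
  (loadInput mark).seq <|
  ite (fun v => v.zero flag) (halt false) <|
  ite (fun v => decide (v.inSym = ρ.inSym))
    ((moveInput ρ.inMove).seq <|
     (checkLocal b ρ).seq <|
     (rewind fun | dig _ => true | _ => false).seq <|
     (unloadInput mark).seq <|
     halt true)
    (halt false)

/-- Copy the word at the head of `lev b` to the tapes for the comparison. -/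
noncomputable def prepare (b : Bool) : Prog α (Tape q j) (Option Δ) :=
  (shiftHeads (fun k => decide (k = prev)) Move.right).seq <|
  (copyWord (ruls q j) (lev b) fun
    | dig _ => true | prev => true | cur => true | next => true | _ => false).seq <|
  (rewind fun
    | dig _ => true | prev => true | cur => true | next => true | _ => false).seq <|
  shiftHeads (fun k => decide (k = next)) Move.right

/-- Decide whether the two words at the head of `lev b` are related by `StepRel`. -/
noncomputable def checkStep (mark : Fin q → Option Δ → Bool) (rules : List (LocalRule α Δ))
    (b : Bool) : Prog α (Tape q j) (Option Δ) :=
  (prepare b).seq <|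
  choose (fun o => o.elim (checkEqual b) (checkRule mark b)) (none :: rules.map some)

theorem _root_.AltTime.inputSym_eq_left_iff {p : ℕ} : inputSym x p = InSym.left ↔ p = 0 := by
  cases p with
  | zero => simp [inputSym]
  | succ p =>
    simp only [inputSym]
    split <;> simp

theorem matches_view (mark : Fin q → Option Δ → Bool) (r : ℕ) (b : Bool) (d : ℕ → Option Δ)
    (h : ℕ) (d' : ℕ → Option Δ) (h' : ℕ) (W V : ℕ → Option Δ) (c g f y u : ℕ) :
    (∀ i, mark i ((((cmpStore r b d h d' h' W V c g f y : Store (Tape q j) (Option Δ)).atRound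
      (digs q j) u).view x).data (dig i)) = true) ↔ Matches j r mark V u := by
  simp only [Store.view, Store.atRound, dig_mem_digs, if_true, cmpStore, Matches]

/-- A step without effect, by which the branches of a conditional get the same form. -/
theorem runs_noop (s : Store (Tape q j) (Option Δ)) :
    (shiftHeads (fun _ => false) Move.right : Prog α (Tape q j) (Option Δ)).Runs x s 1 s := by
  simpa using runs_shiftHeads (x := x) (fun _ => false) Move.right s

theorem runs_setFlag (r : ℕ) (b : Bool) (d : ℕ → Option Δ) (h : ℕ) (d' : ℕ → Option Δ) (h' : ℕ)
    (W V : ℕ → Option Δ) (c g y u : ℕ) :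
    (shiftHeads (fun k => decide (k = flag)) Move.right : Prog α (Tape q j) (Option Δ)).Runs x
      ((cmpStore r b d h d' h' W V c g 0 y).atRound (digs q j) u) 1
      ((cmpStore r b d h d' h' W V c g 1 y).atRound (digs q j) u) := by
  convert runs_shiftHeads (x := x) _ _ _ using 1
  simp only [Store.atRound, cmpStore, Store.mk.injEq, true_and, and_true]
  funext k
  cases k <;> simp [digs, Move.shift]

theorem runs_moveInp_cmpStore (r : ℕ) (b : Bool) (d : ℕ → Option Δ) (h : ℕ) (d' : ℕ → Option Δ)
    (h' : ℕ) (W V : ℕ → Option Δ) (c g f y u : ℕ) (e : Move) :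
    (moveInp e : Prog α (Tape q j) (Option Δ)).Runs x
      ((cmpStore r b d h d' h' W V c g f y).atRound (digs q j) u) 1
      ((cmpStore r b d h d' h' W V c g f (e.shiftInp x.length y)).atRound (digs q j) u) :=
  runs_moveInp e _

theorem zero_flag (r : ℕ) (b : Bool) (d : ℕ → Option Δ) (h : ℕ) (d' : ℕ → Option Δ) (h' : ℕ)
    (W V : ℕ → Option Δ) (c g f y u : ℕ) :
    (((cmpStore r b d h d' h' W V c g f y : Store (Tape q j) (Option Δ)).atRound
      (digs q j) u).view x).zero flag = decide (f = 0) := by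
  simp [Store.view, Store.atRound, cmpStore, digs]

/-- Here `m` is the least match, or `r ^ q` if there is none. -/
theorem runs_loadInput (mark : Fin q → Option Δ → Bool) (r : ℕ) (b : Bool) (d : ℕ → Option Δ)
    (h : ℕ) (d' : ℕ → Option Δ) (h' : ℕ) (W V : ℕ → Option Δ) (c : ℕ) {m : ℕ}
    (hm : ∀ v < m, ¬ Matches j r mark V v) (hm' : m < r ^ q → Matches j r mark V m) :
    (loadInput mark : Prog α (Tape q j) (Option Δ)).Runs x
      (cmpStore r b d h d' h' W V c 0 0 0) (r ^ q * (3 + q * (q + 3)) + 2 * q)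
      (cmpStore r b d h d' h' W V c 0 (if m < r ^ q then 1 else 0)
        (min (min m (r ^ q)) (x.length + 1))) := by
  have key := Runs.nest (x := x) (nodup_digs (q := q) (j := j)) (r := r) (N := r ^ q)
    (B := loadStep mark) (n := 3) (fun u => (cmpStore r b d h d' h' W V c 0 (if m < u then 1 else 0)
        (min (min m u) (x.length + 1)) : Store (Tape q j) (Option Δ)))
    (by rw [length_digs]) (fun u => ⟨rfl, fun i hi => ?_⟩) (fun u hu => ?_)
  · rw [length_digs] at key
    simpa [loadInput] using key
  · obtain ⟨i, rfl⟩ := mem_digs.1 hi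
    rfl
  · rcases lt_trichotomy u m with hum | rfl | hum
    · rw [if_neg (by omega), if_neg (by omega)]
      refine (Runs.ite_true (zero_flag ..) (Runs.ite_false (decide_eq_false ?_) ?_)).le (n := 3)
        le_rfl
      · rw [matches_view]
        exact hm u hum
      · convert runs_moveInp_cmpStore (x := x) (q := q) (j := j) r b d h d' h' W V c 0 0 _ u
          Move.right using 2
        congr 1
        simp only [Move.shiftInp]
        omega
    · rw [if_neg (by omega), if_pos (by omega)]
      refine (Runs.ite_true (zero_flag ..) (Runs.ite_true (decide_eq_true ?_) ?_)).le (n := 3)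
        le_rfl
      · rw [matches_view]
        exact hm' hu
      · convert runs_setFlag (x := x) (q := q) (j := j) r b d h d' h' W V c 0 _ u using 3
        omega
    · rw [if_pos hum, if_pos (by omega)]
      refine (Runs.ite_false (zero_flag ..) ?_).le (n := 2) (by omega)
      convert runs_noop (x := x) _ using 3
      omega

theorem runs_moveInput (r : ℕ) (b : Bool) (d : ℕ → Option Δ) (h : ℕ) (d' : ℕ → Option Δ) (h' : ℕ)
    (W V : ℕ → Option Δ) (c g f y : ℕ) (e : Move) :
    (moveInput e : Prog α (Tape q j) (Option Δ)).Runs x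
      (cmpStore r b d h d' h' W V c g f y) 1
      (cmpStore r b d h d' h' W V c g (f - 1) (e.shiftInp x.length y)) := by
  refine .act ?_
  simp only [Store.exec, Store.view, cmpStore, Store.mk.injEq, true_and, and_true,
    Function.update_eq_self]
  funext k
  cases k <;> simp [Move.shift]

/-- After this check the digit tapes hold the new word, so that its marks can be inspected. -/
theorem sp_checkLocal (r S : ℕ) (hS : S = r ^ j) (b : Bool) (ρ : LocalRule α Δ) (d : ℕ → Option Δ)
    (h : ℕ) (d' : ℕ → Option Δ) (h' : ℕ) (y : ℕ) (W : ℕ → Option Δ) (hW : ∀ p, S ≤ p → W p = none)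
    {k : Post (Tape q j) (Option Δ)} {t w p : ℕ} {φ : Prop}
    (hk : k (cmpStore r b d (h + S) d' h' W (window S d h) S S 0 y) t w p φ) :
    (checkLocal b ρ).Sp x k (cmpStore r b d h d' h' W W 0 0 0 y)
      (t + (S * (2 + j * (j + 3)) + 2 * j)) w p
      ((∀ u < S, ρ.loc (prevCell W u) (W u) (W (u + 1)) (window S d h u) = true) ∧ φ) := by
  have key := sp_nest_test (x := x) (nodup_ruls (q := q) (j := j)) (r := r) (N := S)
    (B := localStep b ρ) (n := 2) (fun u => (cmpStore r b d (h + u) d' h' W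
      (splice W 0 u fun p => d (h + p)) u u 0 y : Store (Tape q j) (Option Δ)))
    (fun u => ρ.loc (prevCell W u) (W u) (W (u + 1)) (d (h + u)) = true)
    (by rw [length_ruls, hS]) (fun u => ⟨rfl, fun i hi => ?_⟩) (fun u hu hg => ?_)
    (fun u hu hg k t w p => ?_) (k := k) (t := t) (w := w) (p := p) (φ := φ) ?_
  · rw [length_ruls] at key
    have h1 : ((∀ u < S, ρ.loc (prevCell W u) (W u) (W (u + 1)) (window S d h u) = true) ∧ φ) ↔
        ((∀ u < S, ρ.loc (prevCell W u) (W u) (W (u + 1)) (d (h + u)) = true) ∧ φ) := by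
      refine and_congr_left' (forall₂_congr fun u hu => ?_)
      rw [window, if_pos hu]
    rw [propext h1]
    simpa [checkLocal] using key
  · obtain ⟨i, rfl⟩ := mem_ruls.1 hi
    rfl
  · refine Runs.ite_true ?_ (.act ?_)
    · simpa [Store.view, Store.atRound, cmpStore, ruls] using hg
    · simp only [Store.exec, Store.view, Store.atRound, cmpStore, Store.mk.injEq, true_and,
        and_true, Move.shiftInp]
      constructor
      · funext k
        cases k <;> simp [ruls, splice_succ]
      · funext k
        cases k with
        | lev b' => by_cases hb : b' = b <;> simp [ruls, Move.shift, hb, Nat.add_assoc]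
        | _ => simp [ruls, Move.shift]
  · refine Sp.ite_false (t := t + 1) ?_ (by simp [Sp])
    simpa [Store.view, Store.atRound, cmpStore, ruls] using hg
  · convert hk using 2
    funext p
    simp only [splice, window]
    by_cases hp : p < S
    · rw [if_pos (by omega), if_pos hp]; rfl
    · rw [if_neg (by omega), if_neg hp, hW p (by omega)]

/-- The input head reaches the left end in round `y`; the first match has to occur in that round. -/
theorem sp_unloadInput (mark : Fin q → Option Δ → Bool) (r : ℕ) (b : Bool) (d : ℕ → Option Δ)
    (h : ℕ) (d' : ℕ → Option Δ) (h' : ℕ) (W V : ℕ → Option Δ) (c y : ℕ) (hy : y < r ^ q)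
    {k : Post (Tape q j) (Option Δ)} {t w p : ℕ} {φ : Prop}
    (hk : ∀ s, k s t w p φ) :
    (unloadInput mark).Sp x k (cmpStore r b d h d' h' W V c 0 0 y)
      (t + (r ^ q * (4 + q * (q + 3)) + 2 * q)) w p (FirstMatch j r mark V y ∧ φ) := by
  classical
  have key := sp_nest_test (x := x) (nodup_digs (q := q) (j := j)) (r := r) (N := r ^ q)
    (B := unloadStep mark) (n := 4) (fun u => (cmpStore r b d h d' h' W V c 0
      (if y < u then 1 else 0) (y - u) : Store (Tape q j) (Option Δ)))
    (fun u => (u < y → ¬ Matches j r mark V u) ∧ (u = y → Matches j r mark V u))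
    (by rw [length_digs]) (fun u => ⟨rfl, fun i hi => ?_⟩) (fun u hu hg => ?_)
    (fun u hu hg k t w p => ?_) (k := k) (t := t) (w := w) (p := p) (φ := φ) (hk _)
  · rw [length_digs] at key
    have h1 : (FirstMatch j r mark V y ∧ φ) ↔ ((∀ u < r ^ q, (u < y → ¬ Matches j r mark V u) ∧
        (u = y → Matches j r mark V u)) ∧ φ) := by
      refine and_congr_left' ⟨fun ⟨_, h2, h3⟩ u hu => ⟨h3 u, fun h => h ▸ h2⟩, fun h2 =>
        ⟨hy, (h2 y hy).2 rfl, fun v hv => (h2 v (by omega)).1 hv⟩⟩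
    rw [propext h1]
    simpa [unloadInput] using key
  · obtain ⟨i, rfl⟩ := mem_digs.1 hi
    rfl
  · rcases lt_trichotomy u y with huy | rfl | huy
    · rw [if_neg (by omega), if_neg (by omega)]
      refine (Runs.ite_true (zero_flag ..) (Runs.ite_false (decide_eq_false ?_)
        (Runs.ite_false (decide_eq_false ?_) ?_))).le (n := 4) le_rfl
      · simp only [Store.view, Store.atRound, cmpStore, inputSym_eq_left_iff]
        omega
      · rw [matches_view]
        exact hg.1 huy
      · exact runs_moveInp_cmpStore r b d h d' h' W V c 0 0 (y - u) u Move.left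
    · rw [if_neg (by omega), if_pos (by omega)]
      refine (Runs.ite_true (zero_flag ..) (Runs.ite_true (decide_eq_true ?_)
        (Runs.ite_true (decide_eq_true ?_) ?_))).le (n := 4) le_rfl
      · simp only [Store.view, Store.atRound, cmpStore, inputSym_eq_left_iff]
        omega
      · rw [matches_view]
        exact hg.2 rfl
      · have h0 : u - (u + 1) = u - u := by omega
        rw [h0]
        exact runs_setFlag r b d h d' h' W V c 0 _ u
    · rw [if_pos huy, if_pos (by omega)]
      refine (Runs.ite_false (zero_flag ..) ?_).le (n := 2) (by omega)
      have h0 : y - (u + 1) = y - u := by omega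
      rw [h0]
      exact runs_noop _
  · rcases lt_trichotomy u y with huy | rfl | huy
    · rw [if_neg (by omega)]
      refine Sp.ite_true (t := t + 3) (zero_flag ..) (Sp.ite_false (t := t + 2) (decide_eq_false ?_)
        (Sp.ite_true (t := t + 1) (decide_eq_true ?_) (by simp [Sp])))
      · simp only [Store.view, Store.atRound, cmpStore, inputSym_eq_left_iff]
        omega
      · rw [matches_view]
        by_contra hne
        exact hg ⟨fun _ => hne, fun h => by omega⟩
    · rw [if_neg (by omega)]
      refine Sp.ite_true (t := t + 3) (zero_flag ..) (Sp.ite_true (t := t + 2) (decide_eq_true ?_)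
        (Sp.ite_false (t := t + 1) (decide_eq_false ?_) (by simp [Sp])))
      · simp only [Store.view, Store.atRound, cmpStore, inputSym_eq_left_iff]
        omega
      · rw [matches_view]
        exact fun h => hg ⟨fun h => by omega, fun _ => h⟩
    · exact absurd ⟨fun h => by omega, fun h => by omega⟩ hg

theorem sp_checkEqual (r S : ℕ) (hS : S = r ^ j) (b : Bool) (d : ℕ → Option Δ)
    (h : ℕ) (d' : ℕ → Option Δ) (h' : ℕ) (y : ℕ) (W : ℕ → Option Δ) (hW : ∀ p, S ≤ p → W p = none)
    {k : Post (Tape q j) (Option Δ)} {t w p : ℕ} :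
    (checkEqual b).Sp x k (cmpStore r b d h d' h' W W 0 0 0 y)
      (t + (S * (2 + j * (j + 3)) + 2 * j)) w p (W = window S d h) := by
  classical
  have key := sp_nest_test (x := x) (nodup_ruls (q := q) (j := j)) (r := r) (N := S)
    (B := equalStep b) (n := 2) (fun u => ({ cmpStore r b d (h + u) d' h' W W 0 0 0 y with
      head := fun k => if k = cur then u else
        (cmpStore r b d (h + u) d' h' W W 0 0 0 y : Store (Tape q j) (Option Δ)).head k } :
      Store (Tape q j) (Option Δ)))
    (fun u => W u = d (h + u))
    (by rw [length_ruls, hS]) (fun u => ⟨rfl, fun i hi => ?_⟩) (fun u hu hg => ?_)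
    (fun u hu hg k t w p => ?_) (k := (halt true).Sp x k) (t := t) (w := w) (p := p) (φ := True)
    (by simp [Sp])
  · rw [length_ruls] at key
    have h1 : W = window S d h ↔ (∀ u < S, W u = d (h + u)) ∧ True := by
      simp only [and_true]
      constructor
      · rintro h u hu
        rw [h, window, if_pos hu]
      · intro h
        funext u
        rw [window]
        split_ifs with hu
        · exact h u hu
        · exact hW u (by omega)
    rw [propext h1]
    have h0 : ({ cmpStore r b d (h + 0) d' h' W W 0 0 0 y with
      head := fun k => if k = cur then 0 else
        (cmpStore r b d (h + 0) d' h' W W 0 0 0 y : Store (Tape q j) (Option Δ)).head k } :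
        Store (Tape q j) (Option Δ)) = cmpStore r b d h d' h' W W 0 0 0 y := by
      simp only [cmpStore, Store.mk.injEq, true_and, and_true, Nat.add_zero]
      funext k
      cases k <;> simp
    rw [h0] at key
    exact key
  · obtain ⟨i, rfl⟩ := mem_ruls.1 hi
    rfl
  · refine Runs.ite_true (decide_eq_true ?_) ?_
    · simpa [Store.view, Store.atRound, cmpStore, ruls] using hg
    · convert runs_shiftHeads (x := x) _ _ _ using 1
      simp only [Store.atRound, cmpStore, Store.mk.injEq, true_and, and_true]
      funext k
      cases k with
      | lev b' => by_cases hb : b' = b <;> simp [ruls, Move.shift, hb, Nat.add_assoc]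
      | _ => simp [ruls, Move.shift]
  · refine Sp.ite_false (t := t + 1) (decide_eq_false ?_) (by simp [Sp])
    simpa [Store.view, Store.atRound, cmpStore, ruls] using hg

/-- A bound for the number of steps of `checkStep`. -/
def checkTime (q j S N a : ℕ) : ℕ :=
  1 + (S * (1 + j * (j + 3)) + 2 * j) + (2 * (S + 1) + 1) + 1 +
  (N * (3 + q * (q + 3)) + 2 * q) + 3 + (S * (2 + j * (j + 3)) + 2 * j) + (2 * S + 1) +
  (N * (4 + q * (q + 3)) + 2 * q) + (a + 1)

theorem sp_checkRule (mark : Fin q → Option Δ → Bool) (r S : ℕ) (hS : S = r ^ j)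
    (hr : x.length + 1 < r ^ q) (b : Bool) (ρ : LocalRule α Δ) (d : ℕ → Option Δ)
    (h : ℕ) (d' : ℕ → Option Δ) (h' : ℕ) (W : ℕ → Option Δ) (hW : ∀ p, S ≤ p → W p = none)
    {k : Post (Tape q j) (Option Δ)} {t w p : ℕ} :
    (checkRule mark b ρ).Sp x k (cmpStore r b d h d' h' W W 0 0 0 0)
      (t + ((r ^ q * (3 + q * (q + 3)) + 2 * q) + 3 + (S * (2 + j * (j + 3)) + 2 * j) +
        (2 * S + 1) + (r ^ q * (4 + q * (q + 3)) + 2 * q))) w p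
      (∃ u, FirstMatch j r mark W u ∧ inputSym x (min u (x.length + 1)) = ρ.inSym ∧
        (∀ p < S, ρ.loc (prevCell W p) (W p) (W (p + 1)) (window S d h p) = true) ∧
        FirstMatch j r mark (window S d h)
          (ρ.inMove.shiftInp x.length (min u (x.length + 1)))) := by
  classical
  set n₁ := r ^ q * (3 + q * (q + 3)) + 2 * q
  set n₂ := S * (2 + j * (j + 3)) + 2 * j
  set n₃ := r ^ q * (4 + q * (q + 3)) + 2 * q
  set n := x.length
  by_cases hex : ∃ m < r ^ q, Matches j r mark W m
  · -- The least match is the encoded position.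
    obtain ⟨hm1, hm2⟩ := Nat.find_spec hex
    have hm3 : ∀ v < Nat.find hex, ¬ Matches j r mark W v := fun v hv hv' =>
      Nat.find_min hex hv ⟨by omega, hv'⟩
    set m := Nat.find hex
    have hfm : ∀ u, FirstMatch j r mark W u ↔ u = m := by
      intro u
      constructor
      · rintro ⟨h1, h2, h3⟩
        rcases lt_trichotomy u m with h | h | h
        · exact absurd h2 (hm3 u h)
        · exact h
        · exact absurd hm2 (h3 m h)
      · rintro rfl
        exact ⟨hm1, hm2, hm3⟩
    simp only [hfm, exists_eq_left]
    refine (runs_loadInput mark r b d h d' h' W W 0 hm3 fun _ => hm2).sp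
      (t := t + (3 + n₂ + (2 * S + 1) + n₃)) ?_ (by omega)
    rw [if_pos hm1, min_eq_left hm1.le]
    refine Sp.relax (t := t + (1 + n₂ + (2 * S + 1) + n₃) + 1 + 1)
      (Sp.ite_false ?_ ?_) (by omega) le_rfl le_rfl
    · simp [Store.view, cmpStore]
    by_cases hin : inputSym x (min m (n + 1)) = ρ.inSym
    · refine Sp.ite_true (decide_eq_true hin) ?_
      refine (runs_moveInput r b d h d' h' W W 0 0 1 (min m (n + 1)) ρ.inMove).sp
        (t := t + (n₂ + (2 * S + 1) + n₃)) ?_ (by omega)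
      have hy : ρ.inMove.shiftInp n (min m (n + 1)) < r ^ q := by
        have : ρ.inMove.shiftInp n (min m (n + 1)) ≤ n + 1 := by
          cases ρ.inMove <;> simp only [Move.shiftInp] <;> omega
        omega
      rw [iff_true_intro hin, true_and]
      refine (sp_checkLocal (t := t + ((2 * S + 1) + n₃)) r S hS b ρ d h d' h' _ W hW ?_).relax
        (by omega) le_rfl le_rfl
      refine (runs_rewind _ _ (h := S) ?_).sp (t := t + n₃) ?_ (by omega)
      · intro i hi
        cases i <;> simp_all [cmpStore]
      · have key := sp_unloadInput (x := x) (q := q) (j := j) mark r b d (h + S) d' h' W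
          (window S d h) S _ hy (k := (halt true).Sp x k) (t := t) (w := w) (p := p) (φ := True)
          (fun s => by simp [Sp])
        rw [and_true] at key
        have h0 : (cmpStore r b d (h + S) d' h' W (window S d h) S 0 0
            (ρ.inMove.shiftInp n (min m (n + 1))) : Store (Tape q j) (Option Δ)) =
            { cmpStore r b d (h + S) d' h' W (window S d h) S S 0
                (ρ.inMove.shiftInp n (min m (n + 1))) with
              head := fun k => if (match k with | dig _ => true | _ => false : Bool) = true then 0
                else (cmpStore r b d (h + S) d' h' W (window S d h) S S 0
                  (ρ.inMove.shiftInp n (min m (n + 1))) :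
                    Store (Tape q j) (Option Δ)).head k } := by
          simp only [cmpStore, Store.mk.injEq, true_and, and_true]
          funext k
          cases k <;> simp
        rw [h0] at key
        exact key
    · refine Sp.ite_false (decide_eq_false hin) ?_
      simp [Sp, hin]
  · have hno : ∀ u, ¬ FirstMatch j r mark W u := fun u hu => hex ⟨u, hu.1, hu.2.1⟩
    simp only [hno, false_and, exists_false]
    push Not at hex
    refine (runs_loadInput mark r b d h d' h' W W 0 (m := r ^ q) hex fun h => absurd h
      (lt_irrefl _)).sp (t := t + 1) ?_ (by omega)
    rw [if_neg (lt_irrefl _)]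
    refine Sp.ite_true ?_ (by simp [Sp])
    simp [Store.view, cmpStore]

theorem runs_prepare (r S : ℕ) (hS : S = r ^ j) (b : Bool) (d : ℕ → Option Δ) (h : ℕ)
    (d' : ℕ → Option Δ) (h' : ℕ) :
    (prepare b : Prog α (Tape q j) (Option Δ)).Runs x (levStore r b d h d' h')
      (1 + (S * (1 + j * (j + 3)) + 2 * j) + (2 * (S + 1) + 1) + 1)
      (cmpStore r b d (h + S) d' h' (window S d h) (window S d h) 0 0 0 0) := by
  set J : Tape q j → Bool := fun
    | dig _ => true | prev => true | cur => true | next => true | _ => false with hJ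
  have key := (runs_shiftHeads (x := x) (fun k => decide (k = prev)) Move.right
    (levStore r b d h d' h' : Store (Tape q j) (Option Δ))).seq <|
    (runs_copyWord (x := x) (nodup_ruls (q := q) (j := j)) (i := lev b) (J := J)
      (N := S) (by simp) (fun k hk => ?_) (fun k hk => ?_) (by rw [length_ruls, hS]; rfl)).seq <|
    (runs_rewind (x := x) J _ (h := S + 1) (fun k hk => ?_)).seq <|
    (runs_shiftHeads (x := x) (fun k => decide (k = next)) Move.right _)
  · rw [length_ruls] at key
    have hs : ∀ (s s' : Store (Tape q j) (Option Δ)), s.len = s'.len → (∀ k, s.data k = s'.data k) →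
        (∀ k, s.head k = s'.head k) → s.inp = s'.inp → s = s' := by
      rintro ⟨l, d, h, y⟩ ⟨l', d', h', y'⟩ h1 h2 h3 h4
      obtain rfl := funext h2
      obtain rfl := funext h3
      obtain rfl : l = l' := h1
      obtain rfl : y = y' := h4
      rfl
    convert key.le (n' := _) (by rw [← Nat.add_assoc, ← Nat.add_assoc]) using 1
    · rfl
    refine hs _ _ rfl (fun k => ?_) (fun k => ?_) rfl
    · cases k with
      | dig i => funext p; simp [cmpStore, levStore, J, splice, window]
      | cur => funext p; simp [cmpStore, levStore, J, splice, window]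
      | next => funext p; simp [cmpStore, levStore, J, splice, window]
      | prev =>
        funext p
        cases p with
        | zero => simp [cmpStore, levStore, J, splice, Move.shift, prevCell]
        | succ p =>
          simp only [cmpStore, levStore, J, window, Move.shift, prevCell]
          clear key
          by_cases hp : p < S
          · simp [splice, hp, show p + 1 < 1 + S by omega]
          · simp [splice, hp, show ¬ p + 1 < 1 + S by omega]
      | _ => simp [cmpStore, levStore, J]
    · cases k with
      | lev b' => by_cases hb : b' = b <;> simp [cmpStore, levStore, J, hb]
      | _ => simp [cmpStore, levStore, J, Move.shift]
  · cases k <;> simp_all [ruls]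
  · obtain ⟨i, rfl⟩ := mem_ruls.1 hk
    rfl
  · cases k <;> simp_all [levStore, Move.shift]
    omega

/-- The rule is chosen existentially, in the last phase. -/
theorem sp_checkStep (mark : Fin q → Option Δ → Bool) (rules : List (LocalRule α Δ)) (r S : ℕ)
    (hS : S = r ^ j) (hr : x.length + 1 < r ^ q) (b : Bool) (d : ℕ → Option Δ)
    (h : ℕ) (d' : ℕ → Option Δ) (h' : ℕ) (k : Post (Tape q j) (Option Δ)) :
    (checkStep mark rules b).Sp x k (levStore r b d h d' h')
      (checkTime q j S (r ^ q) rules.length) (rules.length + 1) 0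
      (StepRel x j r S mark rules (window S d h) (window S d (h + S))) := by
  classical
  have hW : ∀ p, S ≤ p → window S d h p = none := fun p hp => by
    rw [window, if_neg (by omega)]
  set n₂ := (r ^ q * (3 + q * (q + 3)) + 2 * q) + 3 + (S * (2 + j * (j + 3)) + 2 * j) +
        (2 * S + 1) + (r ^ q * (4 + q * (q + 3)) + 2 * q) with hn₂
  have hT : checkTime q j S (r ^ q) rules.length =
    n₂ + (rules.length + 1) + (1 + (S * (1 + j * (j + 3)) + 2 * j) + (2 * (S + 1) + 1) + 1) := by
    rw [checkTime]; omega
  rw [hT]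
  refine (runs_prepare r S hS b d h d' h').sp ?_ le_rfl
  have key := sp_choose (x := x) (fun o => o.elim (checkEqual b) (checkRule mark b))
    (none :: rules.map some) (k := k)
    (s := (cmpStore r b d (h + S) d' h' (window S d h) (window S d h) 0 0 0 0 :
      Store (Tape q j) (Option Δ))) (t := n₂) (w := 0) (p := 0) rfl
    (fun o => o.elim (window S d h = window S d (h + S)) fun ρ => ∃ u,
      FirstMatch j r mark (window S d h) u ∧ inputSym x (min u (x.length + 1)) = ρ.inSym ∧
        (∀ p < S, ρ.loc (prevCell (window S d h) p) (window S d h p) (window S d h (p + 1))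
          (window S d (h + S) p) = true) ∧
        FirstMatch j r mark (window S d (h + S))
          (ρ.inMove.shiftInp x.length (min u (x.length + 1)))) ?_
  · simp only [List.length_cons, List.length_map, Nat.zero_add, List.mem_cons, List.mem_map,
      exists_eq_or_imp, Option.elim_none, exists_exists_and_eq_and, Option.elim_some] at key
    exact key
  · intro o _
    cases o with
    | none =>
      exact (sp_checkEqual r S hS b d (h + S) d' h' 0 _ hW (t := 0)).relax (by omega) le_rfl
        le_rfl
    | some ρ =>
      exact (sp_checkRule mark r S hS hr b ρ d (h + S) d' h' _ hW (t := 0)).relax (by omega)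
        le_rfl le_rfl

end Prog
end AltTime

namespace AltTime

/-! ### The simulating program -/

/-- The sum `1 ^ e + 2 ^ e + ⋯ + r ^ e`. -/
def powSum (e r : ℕ) : ℕ := ∑ i ∈ Finset.range r, (i + 1) ^ e

theorem powSum_succ (e r : ℕ) : powSum e (r + 1) = powSum e r + (r + 1) ^ e :=
  Finset.sum_range_succ _ _

theorem le_powSum (e r : ℕ) : r ≤ powSum e r := by
  induction r with
  | zero => simp
  | succ r ih =>
    rw [powSum_succ]
    have : 0 < (r + 1) ^ e := pow_pos (Nat.succ_pos r) e
    omega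

/-- The length of the rulers built for an input of length `n`; it is about `n ^ (1 / (e + 1))`. -/
def rulerLength (e n : ℕ) : ℕ := Nat.find (⟨n + 1, le_powSum e (n + 1)⟩ : ∃ r, n + 1 ≤ powSum e r)

theorem lt_powSum_rulerLength (e n : ℕ) : n + 1 ≤ powSum e (rulerLength e n) :=
  Nat.find_spec (⟨n + 1, le_powSum e (n + 1)⟩ : ∃ r, n + 1 ≤ powSum e r)

theorem powSum_le_of_lt_rulerLength {e n r : ℕ} (h : r < rulerLength e n) : powSum e r ≤ n := by
  have := Nat.find_min (⟨n + 1, le_powSum e (n + 1)⟩ : ∃ r, n + 1 ≤ powSum e r) h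
  omega

theorem inputSym_eq_right_iff {α : Type} {x : List α} {p : ℕ} :
    inputSym x p = InSym.right ↔ x.length < p := by
  cases p with
  | zero => simp [inputSym]
  | succ p =>
    simp only [inputSym]
    split
    · rename_i a h
      have := (List.getElem?_eq_some_iff.1 h).1
      simp
      omega
    · rename_i h
      have := List.getElem?_eq_none_iff.1 h
      simp
      omega

namespace Prog

section Input

variable {α ι β : Type} {x : List α}

open Classical in
/-- Move the input head to the left end. -/
noncomputable def rewindInput : Prog α ι β :=
  loop (fun v => decide (v.inSym ≠ InSym.left)) (moveInp Move.left)

theorem runs_rewindInput (s : Store ι β) :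
    (rewindInput).Runs x s (2 * s.inp + 1) { s with inp := 0 } := by
  classical
  have key := Runs.loop_iterate (x := x) (P := moveInp Move.left)
    (c := fun v => decide (v.inSym ≠ InSym.left)) (fun u => { s with inp := s.inp - u })
    s.inp (fun _ => 1) (fun u hu => ?_) ?_ (fun u _ => ?_)
  · simp only [Finset.sum_const, Finset.card_range, smul_eq_mul, Nat.sub_self, Nat.sub_zero] at key
    exact key.le (by omega)
  · simp only [Store.view, ne_eq, inputSym_eq_left_iff, decide_eq_true_eq]
    omega
  · simp only [Store.view, ne_eq, inputSym_eq_left_iff, decide_eq_false_iff_not]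
    omega
  · exact runs_moveInp Move.left { s with inp := s.inp - u }

/-- Decide inputs of length less than `n` by a table, and execute `P` on longer inputs. -/
def lookup (P : Prog α ι β) : ℕ → (List α → Bool) → Prog α ι β
  | 0, _ => P
  | n + 1, f => (moveInp Move.right).seq <| caseIn fun
    | InSym.left => halt false
    | InSym.right => halt (f [])
    | InSym.sym a => lookup P n fun l => f (a :: l)

/-- The letters read so far are `pre`, and `f` expects the remaining letters. -/
theorem sp_lookup (P : Prog α ι β) {k : Post ι β} {t w p : ℕ} {φ : Prop} (n : ℕ)
    (f : List α → Bool) (pre rest : List α) (hx : x = pre ++ rest) (s : Store ι β)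
    (hs : s.inp = pre.length) (h₁ : rest.length < n → (φ ↔ f rest = true))
    (h₂ : n ≤ rest.length → P.Sp x k { s with inp := s.inp + n } t w p φ) :
    (lookup P n f).Sp x k s (t + 2 * n) w p φ := by
  induction n generalizing f pre rest s with
  | zero => simpa [lookup] using h₂ (Nat.zero_le _)
  | succ n ih =>
    refine (runs_moveInp Move.right s).sp (t := t + 2 * n + 1) ?_ (by omega)
    refine ⟨t + 2 * n, w, p, le_rfl, le_rfl, le_rfl, ?_⟩
    have hlen : x.length = pre.length + rest.length := by rw [hx, List.length_append]
    have hinp : Move.right.shiftInp x.length s.inp = s.inp + 1 := by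
      simp only [Move.shiftInp]; omega
    simp only [hinp]
    cases rest with
    | nil =>
      have : inputSym x (s.inp + 1) = InSym.right := by
        rw [inputSym_eq_right_iff, hlen, hs]
        simp
      simp only [this]
      exact h₁ (by simp)
    | cons a rest =>
      have : inputSym x (s.inp + 1) = InSym.sym a := by
        simp [inputSym, hs, hx]
      simp only [this]
      refine ih _ (pre ++ [a]) rest (by simp [hx]) _ (by simp [hs]) (fun h => h₁ (by simpa using h))
        fun h => ?_
      rw [Nat.add_assoc, Nat.add_comm 1 n]
      exact h₂ (by simpa using h)

end Input

/-- The store with blank tapes, rulers of length `r`, all heads in cell `h`, and the input head in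
cell `y`. -/
def _root_.AltTime.blankStore {ι Δ : Type} (r h y : ℕ) : Store ι (Option Δ) where
  len := r
  data := fun _ _ => none
  head := fun _ => h
  inp := y

variable {α : Type} {x : List α} {q j : ℕ} {Δ : Type}

open Tape

/-- Enlarge all rulers by one cell, and then move the input head to the right by the length of a
nested loop over `l`. -/
noncomputable def growStep (l : List (Tape q j)) : Prog α (Tape q j) (Option Δ) :=
  (loop (fun v => v.inside row) (shiftHeads (fun _ => true) Move.right)).seq <|
  grow.seq <|
  (rewind fun _ => true).seq <|
  nest l (moveInp Move.right)

open Classical in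
/-- Build rulers whose length is determined by the length of the input. -/
noncomputable def buildRulers (l : List (Tape q j)) : Prog α (Tape q j) (Option Δ) :=
  loop (fun v => decide (v.inSym ≠ InSym.right)) (growStep l)

/-- A bound for the number of steps of `growStep`. -/
def growTime (e u : ℕ) : ℕ :=
  (2 * u + 1) + (1 + ((2 * (u + 1) + 1) + ((u + 1) ^ e * (1 + e * (e + 3)) + 2 * e)))

theorem runs_growStep {l : List (Tape q j)} (hl : l.Nodup) (u y : ℕ) (hy : y ≤ x.length + 1) :
    (growStep l : Prog α (Tape q j) (Option Δ)).Runs x (blankStore u 0 y) (growTime l.length u)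
      (blankStore (u + 1) 0 (min (y + (u + 1) ^ l.length) (x.length + 1))) := by
  have h0 : ∀ v, (shiftHeads (fun _ => true) Move.right : Prog α (Tape q j) (Option Δ)).Runs x
      (blankStore u v y) 1 (blankStore u (v + 1) y) := fun v =>
    runs_shiftHeads (fun _ => true) Move.right _
  have h1 := Runs.loop_iterate (x := x)
    (P := (shiftHeads (fun _ => true) Move.right : Prog α (Tape q j) (Option Δ)))
    (c := fun v => v.inside row) (fun v => blankStore u v y)
    u (fun _ => 1) (fun v hv => decide_eq_true hv) (by simp [Store.view, blankStore])
    (fun v _ => h0 v)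
  simp only [Finset.sum_const, Finset.card_range, smul_eq_mul] at h1
  have h2 : (grow : Prog α (Tape q j) (Option Δ)).Runs x (blankStore u u y) 1
      (blankStore (u + 1) u y) := Runs.grow fun _ => rfl
  have h3 := runs_rewind (x := x) (fun _ => true)
    (blankStore (u + 1) u y : Store (Tape q j) (Option Δ)) (h := u) (fun _ _ => le_rfl)
  simp only [if_true] at h3
  have h4 := Runs.nest (x := x) hl (B := (moveInp Move.right : Prog α (Tape q j) (Option Δ)))
    (r := u + 1) (n := 1) (N := (u + 1) ^ l.length)
    (fun v => blankStore (u + 1) 0 (min (y + v) (x.length + 1))) rfl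
    (fun v => ⟨rfl, fun _ _ => rfl⟩) (fun v _ => ?_)
  · simp only [Nat.add_zero, min_eq_left hy] at h4
    exact (h1.le (by omega)).seq (h2.seq ((h3.le (by omega)).seq h4))
  · convert runs_moveInp (x := x) Move.right _ using 1
    simp only [Store.atRound, blankStore, Move.shiftInp, Store.mk.injEq, true_and]
    omega

/-- A bound for the number of steps of `buildRulers`. -/
def buildTime (e r : ℕ) : ℕ := ∑ u ∈ Finset.range r, (growTime e u + 1) + 1

theorem runs_buildRulers {l : List (Tape q j)} (hl : l.Nodup) :
    (buildRulers l : Prog α (Tape q j) (Option Δ)).Runs x (blankStore 0 0 0)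
      (buildTime l.length (rulerLength l.length x.length))
      (blankStore (rulerLength l.length x.length) 0 (x.length + 1)) := by
  classical
  have key := Runs.loop_iterate (x := x)
    (P := (growStep l : Prog α (Tape q j) (Option Δ)))
    (c := fun v => decide (v.inSym ≠ InSym.right))
    (fun u => blankStore u 0 (min (powSum l.length u) (x.length + 1)))
    (rulerLength l.length x.length) (growTime l.length)
    (fun u hu => ?_) ?_ (fun u _ => ?_)
  · rw [min_eq_right (lt_powSum_rulerLength _ _)] at key
    exact key
  · have := powSum_le_of_lt_rulerLength hu
    simp only [Store.view, blankStore, ne_eq, inputSym_eq_right_iff, decide_eq_true_eq]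
    omega
  · simp only [Store.view, blankStore, ne_eq, inputSym_eq_right_iff, decide_eq_false_iff_not]
    have := lt_powSum_rulerLength l.length x.length
    omega
  · convert runs_growStep (x := x) (Δ := Δ) hl u _ (min_le_right (powSum l.length u) _) using 2
    rw [powSum_succ]
    omega

/-- The word `a₀ a₁ a₁ …` of length `S`. -/
def _root_.AltTime.initWord (S : ℕ) (a₀ a₁ : Δ) : ℕ → Option Δ :=
  fun p => if p < S then some (if p = 0 then a₀ else a₁) else none

/-- Write the word `a₀ a₁ a₁ …`. -/
noncomputable def writeStart (a₀ a₁ : Δ) : Prog α (Tape q j) (Option Δ) :=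
  nest (ruls q j) <| act fun v =>
    ⟨Function.update v.data (lev false) (some (if v.zero (lev false) then a₀ else a₁)),
      fun k => if k = lev false then Move.right else Move.stay, Move.stay⟩

theorem runs_writeStart (a₀ a₁ : Δ) (r S : ℕ) (hS : S = r ^ j) :
    (writeStart a₀ a₁ : Prog α (Tape q j) (Option Δ)).Runs x
      (levStore r true (fun _ => none) 0 (fun _ => none) 0) (S * (1 + j * (j + 3)) + 2 * j)
      (levStore r true (fun _ => none) 0 (initWord S a₀ a₁) S) := by
  have key := Runs.nest (x := x) (nodup_ruls (q := q) (j := j)) (r := r) (N := S)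
    (B := act fun v =>
      ⟨Function.update v.data (lev false) (some (if v.zero (lev false) then a₀ else a₁)),
        fun k => if k = lev false then Move.right else Move.stay, Move.stay⟩)
    (fun u => (levStore r true (fun _ => none) 0 (initWord u a₀ a₁) u :
      Store (Tape q j) (Option Δ))) (n := 1) (by rw [length_ruls, hS])
    (fun u => ⟨rfl, fun i hi => ?_⟩) (fun u _ => .act ?_)
  · rw [length_ruls] at key
    exact key
  · obtain ⟨i, rfl⟩ := mem_ruls.1 hi
    rfl
  · simp only [Store.exec, Store.view, Store.atRound, levStore, Store.mk.injEq, true_and,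
        and_true, Move.shiftInp]
    constructor
    · funext k
      cases k with
      | lev b =>
        cases b with
        | true => simp
        | false =>
          funext p
          by_cases hp : p = u
          · subst hp; simp [initWord]
          · have : p < u + 1 ↔ p < u := by omega
            simp [hp, initWord, this]
      | _ => simp
    · funext k
      cases k with
      | lev b => cases b <;> simp [Move.shift]
      | _ => simp [Move.shift]

/-- Simulate a machine on inputs of length at least `n₀`: the rulers are built, the initial word is
written, a word over `E` is guessed, and it is decided whether that word can be reached from the
initial word. Shorter inputs are decided by the table `f`. -/
noncomputable def simulate (n₀ : ℕ) (f : List α → Bool) (mark : Fin q → Option Δ → Bool)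
    (rules : List (LocalRule α Δ)) (A E : List (Option Δ)) (a₀ a₁ : Δ) (K : ℕ) :
    Prog α (Tape q j) (Option Δ) :=
  lookup (rewindInput.seq <| (buildRulers (digs q j).tail).seq <| rewindInput.seq <|
    (writeStart a₀ a₁).seq <| (nest (ruls q j) (choose (putRight (lev false)) E)).seq <|
    (rewind fun k => decide (k = lev false)).seq <|
    levels A (checkStep mark rules) K false) n₀ f

/-- A bound for the number of steps of `simulate` on an input of length `n`, where `a`, `e`, `c` are
the numbers of symbols, of final symbols, and of rules, and `n₀` is the size of the table. -/
def simulateTime (q j K n₀ a e c r n : ℕ) : ℕ :=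
  checkTime q j (r ^ j) (r ^ q) c + K * levelTime j (r ^ j) r a + (2 * (2 * r ^ j) + 1) +
  (r ^ j * (e + 1 + j * (j + 3)) + 2 * j) + (r ^ j * (1 + j * (j + 3)) + 2 * j) +
  (2 * (n + 1) + 1) + buildTime (q - 1) r + (2 * n₀ + 1) + 2 * n₀

/-- The number of bits guessed by `simulate`. -/
def simulateWitness (j K a e c r : ℕ) : ℕ :=
  c + 1 + K * (r * r ^ j * a + r) + r ^ j * e

section Simulate

variable (n₀ : ℕ) (f : List α → Bool) (mark : Fin q → Option Δ → Bool)
  (rules : List (LocalRule α Δ)) (A E : List (Option Δ)) (a₀ a₁ : Δ) (K : ℕ)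
  {k : Post (Tape q j) (Option Δ)}

theorem sp_simulate_of_lt (hn : x.length < n₀) :
    (simulate (j := j) n₀ f mark rules A E a₀ a₁ K).Sp x k (Store.init none) (2 * n₀) 0 0
      (f x = true) := by
  have := sp_lookup (x := x) (k := k) (t := 0) (w := 0) (p := 0) (φ := f x = true)
    (rewindInput.seq <| (buildRulers (digs q j).tail).seq <| rewindInput.seq <|
    (writeStart a₀ a₁).seq <| (nest (ruls q j) (choose (putRight (lev false)) E)).seq <|
    (rewind fun k => decide (k = lev false)).seq <|
    levels A (checkStep mark rules) K false) n₀ f [] x rfl (Store.init none) rfl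
    (fun _ => Iff.rfl) (fun h => by omega)
  rwa [Nat.zero_add] at this

/-- On long inputs the program decides whether a final word is reachable from the initial word. -/
theorem sp_simulate {r : ℕ} (hr : r = rulerLength (q - 1) x.length) (hrq : x.length + 1 < r ^ q)
    (hn : n₀ ≤ x.length) :
    (simulate (j := j) n₀ f mark rules A E a₀ a₁ K).Sp x k (Store.init none)
      (simulateTime q j K n₀ A.length E.length rules.length r x.length)
      (simulateWitness j K A.length E.length rules.length r) (2 * K)
      (∃ G : ℕ → Option Δ, (∀ p < r ^ j, G p ∈ E) ∧ LevelRel A (r ^ j) r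
        (StepRel x j r (r ^ j) mark rules) K (initWord (r ^ j) a₀ a₁) (window (r ^ j) G 0)) := by
  set S := r ^ j with hS
  have hl : (digs q j).tail.length = q - 1 := by simp
  refine sp_lookup (x := x) _ n₀ f [] x rfl (Store.init none) rfl (fun h => by omega) fun _ => ?_
  refine (runs_rewindInput _).sp (t := checkTime q j S (r ^ q) rules.length +
    K * levelTime j S r A.length + (2 * (2 * S) + 1) +
    (S * (E.length + 1 + j * (j + 3)) + 2 * j) + (S * (1 + j * (j + 3)) + 2 * j) +
    (2 * (x.length + 1) + 1) + buildTime (q - 1) r) ?_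
    (by simp only [Store.init, ← hS]; omega)
  have hb := runs_buildRulers (x := x) (Δ := Δ) (nodup_digs (q := q) (j := j)).tail
  rw [hl, ← hr] at hb
  refine hb.sp (t := checkTime q j S (r ^ q) rules.length +
    K * levelTime j S r A.length + (2 * (2 * S) + 1) +
    (S * (E.length + 1 + j * (j + 3)) + 2 * j) + (S * (1 + j * (j + 3)) + 2 * j) +
    (2 * (x.length + 1) + 1)) ?_ le_rfl
  refine (runs_rewindInput _).sp (t := checkTime q j S (r ^ q) rules.length +
    K * levelTime j S r A.length + (2 * (2 * S) + 1) +
    (S * (E.length + 1 + j * (j + 3)) + 2 * j) + (S * (1 + j * (j + 3)) + 2 * j)) ?_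
    le_rfl
  have h0 : ({ blankStore r 0 (x.length + 1) with inp := 0 } : Store (Tape q j) (Option Δ)) =
      levStore r true (fun _ => none) 0 (fun _ => none) 0 := by
    simp only [blankStore, levStore, Store.mk.injEq, true_and, and_true]
    constructor <;> (funext k; cases k <;> simp)
  rw [h0]
  refine (runs_writeStart a₀ a₁ r S hS).sp (t := checkTime q j S (r ^ q) rules.length +
    K * levelTime j S r A.length + (2 * (2 * S) + 1) +
    (S * (E.length + 1 + j * (j + 3)) + 2 * j)) ?_ le_rfl
  refine (sp_guessWord (x := x) (nodup_ruls (q := q) (j := j)) (i := lev false) (by simp) E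
    (N := S) ?_ (by rw [length_ruls]; exact hS) (t := checkTime q j S (r ^ q) rules.length +
      K * levelTime j S r A.length + (2 * (2 * S) + 1))
    (w := rules.length + 1 + K * (r * S * A.length + r)) (p := 2 * K) (by simp [phaseQuantifier])
    (Φ := fun G => LevelRel A S r (StepRel x j r S mark rules) K (initWord S a₀ a₁)
      (window S G 0)) ?_ ?_).relax (by rw [length_ruls]) le_rfl le_rfl
  · intro k hk
    obtain ⟨i, rfl⟩ := mem_ruls.1 hk
    rfl
  · intro G G' hG h
    have : window S G' 0 = window S G 0 := by
      funext p
      simp only [window, Nat.zero_add]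
      split_ifs with hp
      · exact (hG p hp).symm
      · rfl
    rwa [this]
  · intro G _
    rw [show (lev false : Tape q j) = lev (!true) from rfl, levStore_set]
    refine (runs_rewind_lev true r _ _ 0 _ (2 * S) ?_).sp
      (t := checkTime q j S (r ^ q) rules.length + K * levelTime j S r A.length) ?_ le_rfl
    · simp [levStore]; omega
    · rw [← levStore_not]
      have hlev := sp_levels (x := x) (q := q) (j := j) A (checkStep mark rules) hS (k := k)
        (fun b d h d' h' => sp_checkStep mark rules r S hS hrq b d h d' h' k) K false
        (splice (initWord S a₀ a₁) S S G) 0 (fun _ => none) 0 (Nat.zero_le _) (Nat.zero_le _)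
      have h1 : window S (splice (initWord S a₀ a₁) S S G) 0 = initWord S a₀ a₁ := by
        funext p
        simp only [window, splice, initWord]
        split_ifs <;> first | rfl | omega
      have h2 : window S (splice (initWord S a₀ a₁) S S G) (0 + S) = window S G 0 := by
        funext p
        simp only [window, splice]
        split_ifs <;> first | rfl | (congr 1; omega)
      rw [h1, h2] at hlev
      exact hlev

end Simulate

end Prog
end AltTime

namespace AltTime

/-! ### Paths of configurations as words -/

section LevelRel

variable {Δ : Type} {A : List (Option Δ)} {S r : ℕ} {R : (ℕ → Option Δ) → (ℕ → Option Δ) → Prop}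

theorem window_catWords_zero {W W' G : ℕ → Option Δ} (hW : ∀ p, S ≤ p → W p = none) :
    window S (catWords S r W G W') (0 * S) = W := by
  funext p
  simp only [window, catWords, splice, Nat.zero_mul, Nat.zero_add]
  split_ifs with h1 h2 h3 h4
  · omega
  · omega
  · rfl
  · omega
  · exact (hW p (by omega)).symm

theorem window_catWords_last {W W' G : ℕ → Option Δ} (hW' : ∀ p, S ≤ p → W' p = none) :
    window S (catWords S r W G W') ((r + 1) * S) = W' := by
  funext p
  have : (r + 1) * S = S + r * S := by ring
  simp only [window, catWords, splice, this]
  generalize r * S = c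
  split_ifs with h1 h2
  · congr 1; omega
  · omega
  · omega
  · omega
  · exact (hW' p (by omega)).symm

theorem window_catWords_succ {W W' G : ℕ → Option Δ} {v : ℕ} (hv : v < r) :
    window S (catWords S r W G W') ((v + 1) * S) = window S G (v * S) := by
  funext p
  have h1 : (v + 1) * S = v * S + S := by ring
  have h2 : v * S + S ≤ r * S := by
    rw [← h1]; exact Nat.mul_le_mul_right _ hv
  simp only [window, catWords, splice, h1]
  generalize r * S = c at *
  generalize v * S = b at *
  split_ifs with h3 h4 h5
  · omega
  · congr 1; omega
  · omega
  · omega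
  · rfl

/-- Soundness of the recursion. The words on the path remain blank from cell `S` on. -/
theorem LevelRel.reflTransGen {K : ℕ} : ∀ {W W' : ℕ → Option Δ}, LevelRel A S r R K W W' →
    (∀ p, S ≤ p → W p = none) → (∀ p, S ≤ p → W' p = none) →
    Relation.ReflTransGen (fun W W' => R W W' ∧ ∀ p, S ≤ p → W' p = none) W W' := by
  induction K with
  | zero => exact fun h _ hW' => .single ⟨h, hW'⟩
  | succ K ih =>
    rintro W W' ⟨G, -, hG⟩ hW hW'
    have key : ∀ v ≤ r + 1,
        Relation.ReflTransGen (fun W W' => R W W' ∧ ∀ p, S ≤ p → W' p = none) W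
          (window S (catWords S r W G W') (v * S)) := by
      intro v
      induction v with
      | zero => intro _; rw [window_catWords_zero hW]
      | succ v ihv =>
        intro hv
        exact (ihv (by omega)).trans (ih (hG v (by omega))
          (fun p hp => by rw [window, if_neg (by omega)])
          (fun p hp => by rw [window, if_neg (by omega)]))
    have := key (r + 1) le_rfl
    rwa [window_catWords_last hW'] at this

/-- Completeness of the recursion. The path has length exactly `(r + 1) ^ K`, which is no
restriction for a reflexive relation. -/
theorem LevelRel.of_path {K : ℕ} : ∀ {f : ℕ → ℕ → Option Δ}, (∀ i, ∀ p < S, f i p ∈ A) →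
    (∀ i p, S ≤ p → f i p = none) → (∀ i, R (f i) (f (i + 1))) →
    LevelRel A S r R K (f 0) (f ((r + 1) ^ K)) := by
  induction K with
  | zero => exact fun {f} _ _ hR => hR 0
  | succ K ih =>
    intro f hA hS hR
    set N := (r + 1) ^ K
    have hlast : (r + 1) ^ (K + 1) = (r + 1) * N := by rw [pow_succ, mul_comm]
    let G : ℕ → Option Δ := fun a => f ((a / S + 1) * N) (a % S)
    have hG : ∀ v ≤ r + 1,
        window S (catWords S r (f 0) G (f ((r + 1) ^ (K + 1)))) (v * S) = f (v * N) := by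
      intro v hv
      rcases Nat.eq_zero_or_pos v with rfl | hv0
      · rw [window_catWords_zero (hS 0), Nat.zero_mul]
      rcases hv.eq_or_lt with rfl | hv
      · rw [window_catWords_last (hS _), hlast]
      obtain ⟨v, rfl⟩ : ∃ v', v = v' + 1 := ⟨v - 1, by omega⟩
      rw [window_catWords_succ (by omega)]
      funext p
      rw [window]
      split_ifs with hp
      · simp only [G]
        rw [Nat.mul_comm v S, Nat.mul_add_mod, Nat.mod_eq_of_lt hp,
          Nat.mul_add_div (by omega), Nat.div_eq_of_lt hp, Nat.add_zero]
      · exact (hS _ p (by omega)).symm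
    refine ⟨G, fun a ha => ?_, fun v hv => ?_⟩
    · have hS0 : 0 < S := by
        rcases Nat.eq_zero_or_pos S with h | h
        · simp [h] at ha
        · exact h
      exact hA _ _ (Nat.mod_lt _ hS0)
    · rw [hG v (by omega), hG (v + 1) (by omega), Nat.succ_mul, Nat.add_comm (v * N)]
      have := ih (f := fun i => f (i + v * N)) (fun i => hA _) (fun i => hS _) (fun i => by
        have := hR (i + v * N)
        rwa [Nat.add_right_comm] at this)
      simpa using this

end LevelRel

/-- The entries of the words that represent configurations of `M`: the contents of a cell on every
tape, the marks for the head positions, a mark for each digit of the input head position, and the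
state. -/
structure Column {α : Type} (M : NTM α) (q : ℕ) : Type where
  tp : Fin M.tapes → M.Sym
  hd : Fin M.tapes → Bool
  ctr : Fin q → Bool
  st : M.State

namespace Column

variable {α : Type} {M : NTM α} {q : ℕ}

theorem finite (M : NTM α) (q : ℕ) : Finite (Column M q) := by
  have := M.finite_state
  have := M.finite_sym
  exact Finite.of_injective
    (fun δ : Column M q => (δ.tp, δ.hd, δ.ctr, δ.st))
    (fun δ δ' h => by
      cases δ; cases δ'
      simp only [Prod.mk.injEq] at h
      obtain ⟨rfl, rfl, rfl, rfl⟩ := h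
      rfl)

/-- The marks for the digits of the input head position. -/
def mark (i : Fin q) (o : Option (Column M q)) : Bool := o.elim false fun δ => δ.ctr i

/-- There is a head of tape `i`. -/
def HasHead (o : Option (Column M q)) (i : Fin M.tapes) : Prop := ∃ δ, o = some δ ∧ δ.hd i = true

/-- The local condition for a step of `M` from state `s` with scanned symbols `σ` by the
instruction `a`. -/
def LocalStep (s : M.State) (σ : Fin M.tapes → M.Sym) (a : Instr M.State M.Sym M.tapes)
    (u v w v' : Option (Column M q)) : Prop :=
  ∃ δ δ', v = some δ ∧ v' = some δ' ∧ δ.st = s ∧ δ'.st = a.state ∧ ∀ i,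
    (δ.hd i = true → δ.tp i = σ i) ∧ δ'.tp i = (if δ.hd i then a.write i else δ.tp i) ∧
    (δ'.hd i = true ↔ match a.move i with
      | Move.left => HasHead w i ∨ (u = none ∧ δ.hd i = true)
      | Move.stay => δ.hd i = true
      | Move.right => HasHead u i)

end Column

open Column

section Simulation

variable {α : Type} (M : NTM α) (q j r S : ℕ)

open Classical in
/-- The rule for an instruction. -/
noncomputable def stepRule (s : M.State) (y : InSym α) (σ : Fin M.tapes → M.Sym)
    (a : Instr M.State M.Sym M.tapes) : LocalRule α (Column M q) where
  inSym := y
  inMove := a.inMove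
  loc := fun u v w v' => decide (LocalStep s σ a u v w v')

theorem finite_instr : Finite (Instr M.State M.Sym M.tapes) := by
  have := M.finite_state
  have := M.finite_sym
  have : Finite Move := Finite.of_surjective
    (fun i : Fin 3 => match i with | 0 => Move.left | 1 => Move.stay | 2 => Move.right)
    (fun d => match d with
      | .left => ⟨0, rfl⟩
      | .stay => ⟨1, rfl⟩
      | .right => ⟨2, rfl⟩)
  exact Finite.of_injective
    (fun a : Instr M.State M.Sym M.tapes => (a.state, a.inMove, a.write, a.move))
    (fun a a' h => by
      cases a; cases a'
      simp only [Prod.mk.injEq] at h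
      obtain ⟨rfl, rfl, rfl, rfl⟩ := h
      rfl)

/-- There is a list of the rules for all instructions of `M`. -/
theorem exists_rules [Finite α] : ∃ rules : List (LocalRule α (Column M q)), ∀ ρ, ρ ∈ rules ↔
    ∃ s y σ, ∃ a ∈ M.trans s y σ, ρ = stepRule M q s y σ a := by
  have := M.finite_state
  have := M.finite_sym
  have := finite_instr M
  have := InSym.finite (α := α)
  have hfin : (Set.range fun z : M.State × InSym α × (Fin M.tapes → M.Sym) ×
      Instr M.State M.Sym M.tapes => stepRule M q z.1 z.2.1 z.2.2.1 z.2.2.2).Finite :=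
    Set.finite_range _
  have hfin' : {ρ | ∃ s y σ, ∃ a ∈ M.trans s y σ, ρ = stepRule M q s y σ a}.Finite := hfin.subset
    (by rintro ρ ⟨s, y, σ, a, -, rfl⟩; exact ⟨(s, y, σ, a), rfl⟩)
  exact ⟨hfin'.toFinset.toList, fun ρ => by simp⟩

/-- The word `W` of length `S` represents the configuration `c`. -/
structure Represents (W : ℕ → Option (Column M q)) (c : Cfg M.State M.Sym M.tapes) : Prop where
  cell : ∀ p < S, ∃ δ, W p = some δ ∧ (∀ i, δ.tp i = c.tape i p) ∧
    (∀ i, δ.hd i = true ↔ c.head i = p) ∧ δ.st = c.state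
  blank : ∀ p, S ≤ p → W p = none
  inp : FirstMatch j r mark W c.inHead

/-- The canonical word representing a configuration. -/
def encode (c : Cfg M.State M.Sym M.tapes) : ℕ → Option (Column M q) := fun p =>
  if p < S then some
    { tp := fun i => c.tape i p
      hd := fun i => decide (c.head i = p)
      ctr := fun i => decide (digit r (Tape.digs q j) c.inHead (Tape.dig i) = p)
      st := c.state }
  else none

variable {M q j r S}

theorem FirstMatch.unique {Δ : Type} {mark : Fin q → Option Δ → Bool} {W : ℕ → Option Δ} {u v : ℕ}
    (hu : FirstMatch j r mark W u) (hv : FirstMatch j r mark W v) : u = v := by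
  rcases lt_trichotomy u v with h | h | h
  · exact absurd hu.2.1 (hv.2.2 u h)
  · exact h
  · exact absurd hv.2.1 (hu.2.2 v h)

/-- In the canonical word only the tuple of the digits of the input head position has all marks,
since the digits are smaller than `r ≤ S`. -/
theorem represents_encode (hrS : r ≤ S) {c : Cfg M.State M.Sym M.tapes} (hc : c.inHead < r ^ q) :
    Represents M q j r S (encode M q j r S c) c where
  cell := fun p hp => ⟨_, if_pos hp, fun _ => rfl, fun _ => by simp, rfl⟩
  blank := fun p hp => if_neg (by omega)
  inp := by
    have hlen : (Tape.digs q j).length = q := Tape.length_digs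
    have key : ∀ v < r ^ q, Matches j r mark (encode M q j r S c) v ↔ v = c.inHead := by
      intro v hv
      constructor
      · intro h
        refine digit_injective Tape.nodup_digs (by rwa [hlen]) (by rwa [hlen]) fun k hk => ?_
        obtain ⟨i, rfl⟩ := Tape.mem_digs.1 hk
        have hi := h i
        have hd : digit r (Tape.digs q j) v (Tape.dig i) < S :=
          (digit_lt (by rwa [hlen]) hk).trans_le hrS
        rw [encode, if_pos hd] at hi
        simpa [mark, eq_comm] using hi
      · rintro rfl i
        have hd : digit r (Tape.digs q j) c.inHead (Tape.dig i) < S :=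
          (digit_lt (by rwa [hlen]) (Tape.dig_mem_digs i)).trans_le hrS
        rw [encode, if_pos hd]
        simp [mark]
    exact ⟨hc, (key _ hc).2 rfl, fun v hv h => hv.ne ((key v (hv.trans hc)).1 h)⟩

/-- The initial word has all marks in cell `0`, which encodes position `0` of the input head. -/
theorem represents_initWord (hr : 0 < r) (hS : 0 < S) :
    Represents M q j r S (initWord S ⟨fun _ => M.blank, fun _ => true, fun _ => true, M.start⟩
      ⟨fun _ => M.blank, fun _ => false, fun _ => false, M.start⟩)
      (Cfg.start M.start M.blank) where
  cell := fun p hp => by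
    refine ⟨_, if_pos hp, ?_⟩
    by_cases h0 : p = 0
    · simp [h0, Cfg.start]
    · simp [h0, Cfg.start, eq_comm]
  blank := fun p hp => if_neg (by omega)
  inp := by
    have hdig : ∀ (l : List (Tape q j)) k, digit r l 0 k = 0 := by
      intro l k
      induction l with
      | nil => rfl
      | cons i l ih => simp [digit, ih]
    refine ⟨pow_pos hr q, fun i => ?_, fun v hv => absurd hv (Nat.not_lt_zero v)⟩
    simp [Cfg.start, hdig, initWord, hS, mark]

/-- A step by an instruction satisfies the local condition everywhere, and the local condition
determines the next configuration. -/
theorem localStep_iff {W W' : ℕ → Option (Column M q)} {c : Cfg M.State M.Sym M.tapes}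
    (hW : Represents M q j r S W c) (hh : ∀ i, c.head i < S) (n : ℕ) {s : M.State}
    {σ : Fin M.tapes → M.Sym} {a : Instr M.State M.Sym M.tapes} (hS : 0 < S) :
    (∀ p < S, LocalStep s σ a (prevCell W p) (W p) (W (p + 1)) (W' p)) ↔
      s = c.state ∧ σ = c.scanned ∧
      ∀ p < S, ∃ δ, W' p = some δ ∧ (∀ i, δ.tp i = (c.exec n a).tape i p) ∧
        (∀ i, δ.hd i = true ↔ (c.exec n a).head i = p) ∧ δ.st = a.state := by
  have hmove : ∀ p < S, ∀ δ, W p = some δ → (∀ i, δ.hd i = true ↔ c.head i = p) → ∀ i,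
      ((match a.move i with
        | Move.left => HasHead (W (p + 1)) i ∨ (prevCell W p = none ∧ δ.hd i = true)
        | Move.stay => δ.hd i = true
        | Move.right => HasHead (prevCell W p) i) ↔ (c.exec n a).head i = p) := by
    intro p hp δ hδ hhd i
    have hhas : ∀ p' < S, (HasHead (W p') i ↔ c.head i = p') := by
      intro p' hp'
      obtain ⟨δ', h1, -, h2, -⟩ := hW.cell p' hp'
      rw [h1]
      constructor
      · rintro ⟨δ'', h, h'⟩
        cases h
        exact (h2 i).1 h'
      · exact fun h => ⟨δ', rfl, (h2 i).2 h⟩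
    have hnone : HasHead (none : Option (Column M q)) i ↔ False := by
      simp [HasHead]
    have hi := hh i
    simp only [Cfg.exec]
    cases a.move i with
    | stay => simpa [Move.shift] using hhd i
    | right =>
      simp only [Move.shift, prevCell]
      split_ifs with h0
      · rw [hnone, false_iff]; omega
      · rw [hhas _ (by omega)]; omega
    | left =>
      simp only [Move.shift, hhd i]
      have h1 : HasHead (W (p + 1)) i ↔ c.head i = p + 1 := by
        by_cases hp1 : p + 1 < S
        · exact hhas _ hp1
        · rw [hW.blank _ (by omega), hnone, false_iff]; omega
      have h2 : prevCell W p = none ↔ p = 0 := by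
        rw [prevCell]
        split_ifs with h0
        · simp [h0]
        · obtain ⟨δ', h, -⟩ := hW.cell (p - 1) (by omega)
          simp [h, h0]
      rw [h1, h2]
      omega
  have htape : ∀ p δ, (∀ i, δ.tp i = c.tape i p) → (∀ i, δ.hd i = true ↔ c.head i = p) → ∀ i,
      (if (δ : Column M q).hd i = true then a.write i else δ.tp i) = (c.exec n a).tape i p := by
    intro p δ h1 h2 i
    simp only [Cfg.exec]
    by_cases h : c.head i = p
    · rw [if_pos ((h2 i).2 h), ← h, Function.update_self]
    · rw [if_neg (fun h' => h ((h2 i).1 h')), Function.update_of_ne (fun h' => h h'.symm), h1]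
  constructor
  · intro h
    refine ⟨?_, ?_, fun p hp => ?_⟩
    · obtain ⟨δ, δ', h1, -, h2, -⟩ := h 0 hS
      obtain ⟨δ₁, h3, -, -, h4⟩ := hW.cell 0 hS
      rw [h1] at h3
      cases h3
      rw [← h2, h4]
    · funext i
      obtain ⟨δ, δ', h1, -, -, -, h2⟩ := h _ (hh i)
      obtain ⟨δ₁, h3, h4, h5, -⟩ := hW.cell _ (hh i)
      rw [h1] at h3
      cases h3
      rw [← (h2 i).1 ((h5 i).2 rfl), h4, Cfg.scanned]
    · obtain ⟨δ, δ', h1, h2, -, h3, h4⟩ := h p hp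
      obtain ⟨δ₁, h5, h6, h7, -⟩ := hW.cell p hp
      rw [h1] at h5
      cases h5
      refine ⟨δ', h2, fun i => ?_, fun i => ?_, h3⟩
      · rw [(h4 i).2.1, htape p δ h6 h7]
      · rw [(h4 i).2.2, hmove p hp δ h1 h7]
  · rintro ⟨rfl, rfl, h⟩ p hp
    obtain ⟨δ', h1, h2, h3, h4⟩ := h p hp
    obtain ⟨δ, h5, h6, h7, h8⟩ := hW.cell p hp
    refine ⟨δ, δ', h5, h1, h8, h4, fun i => ⟨fun hi => ?_, ?_, ?_⟩⟩
    · rw [h6, Cfg.scanned, (h7 i).1 hi]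
    · rw [h2, htape p δ h6 h7]
    · rw [h3, hmove p hp δ h5 h7]

variable {x : List α} {rules : List (LocalRule α (Column M q))}

theorem exec_inHead {c : Cfg M.State M.Sym M.tapes} (hc : c.inHead ≤ x.length + 1)
    (a : Instr M.State M.Sym M.tapes) : (c.exec x.length a).inHead =
      a.inMove.shiftInp x.length (min c.inHead (x.length + 1)) := by
  rw [min_eq_left hc, ← shift_min_eq a.inMove hc]
  rfl

theorem NTM.Reach.inHead_le {t : ℕ} {c : Cfg M.State M.Sym M.tapes} (h : M.Reach x t c) :
    c.inHead ≤ x.length + 1 := by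
  cases h with
  | start => exact Nat.zero_le _
  | step => exact min_le_right _ _

/-- A word related to a word that represents a reachable configuration represents a reachable
one. -/
theorem StepRel.sound (hrules : ∀ ρ, ρ ∈ rules ↔ ∃ s y σ, ∃ a ∈ M.trans s y σ,
      ρ = stepRule M q s y σ a) (hS : 0 < S) {W W' : ℕ → Option (Column M q)} {t : ℕ}
    {c : Cfg M.State M.Sym M.tapes} (hc : M.Reach x t c) (hW : Represents M q j r S W c)
    (hh : ∀ i, c.head i < S) (hW' : ∀ p, S ≤ p → W' p = none)
    (h : StepRel x j r S mark rules W W') :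
    ∃ t' c', M.Reach x t' c' ∧ Represents M q j r S W' c' := by
  rcases h with rfl | ⟨ρ, hρ, u, hu, hin, hloc, hu'⟩
  · exact ⟨t, c, hc, hW⟩
  obtain ⟨s, y, σ, a, ha, rfl⟩ := (hrules ρ).1 hρ
  obtain rfl := hu.unique hW.inp
  simp only [stepRule, decide_eq_true_eq] at hin hloc hu'
  obtain ⟨rfl, rfl, hcell⟩ := (localStep_iff hW hh x.length hS).1 hloc
  rw [min_eq_left hc.inHead_le] at hin
  rw [← hin] at ha
  refine ⟨t + 1, _, hc.step ha, hcell, hW', ?_⟩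
  rw [exec_inHead hc.inHead_le]
  exact hu'

/-- Every step of the machine is reflected by related words. -/
theorem StepRel.complete (hrules : ∀ ρ, ρ ∈ rules ↔ ∃ s y σ, ∃ a ∈ M.trans s y σ,
      ρ = stepRule M q s y σ a) (hS : 0 < S) (hrS : r ≤ S) (hrq : x.length + 1 < r ^ q)
    {W : ℕ → Option (Column M q)} {t : ℕ}
    {c : Cfg M.State M.Sym M.tapes} (hc : M.Reach x t c) (hW : Represents M q j r S W c)
    (hh : ∀ i, c.head i < S) {a : Instr M.State M.Sym M.tapes}
    (ha : a ∈ M.trans c.state (inputSym x c.inHead) c.scanned) :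
    ∃ W', StepRel x j r S mark rules W W' ∧ Represents M q j r S W' (c.exec x.length a) := by
  have hW' : Represents M q j r S (encode M q j r S (c.exec x.length a)) (c.exec x.length a) :=
    represents_encode hrS ((hc.step ha).inHead_le.trans_lt hrq)
  refine ⟨_, .inr ⟨stepRule M q c.state (inputSym x c.inHead) c.scanned a,
    (hrules _).2 ⟨_, _, _, a, ha, rfl⟩, c.inHead, hW.inp, ?_, ?_, ?_⟩, hW'⟩
  · rw [min_eq_left hc.inHead_le]
    rfl
  · simp only [stepRule, decide_eq_true_eq]
    exact (localStep_iff hW hh x.length hS).2 ⟨rfl, rfl, hW'.cell⟩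
  · have := hW'.inp
    rwa [exec_inHead hc.inHead_le] at this

/-- The condition decided by `simulate` is acceptance of the simulated machine. -/
theorem levelRel_iff_accepts (hrules : ∀ ρ, ρ ∈ rules ↔ ∃ s y σ, ∃ a ∈ M.trans s y σ,
      ρ = stepRule M q s y σ a) (hr : 0 < r) (hrS : r ≤ S) (hrq : x.length + 1 < r ^ q) {K : ℕ}
    (hM : ∀ t c, M.Reach x t c → t ≤ (r + 1) ^ K ∧ ∀ i, c.head i < S)
    {A E : List (Option (Column M q))} (hA : ∀ δ, some δ ∈ A)
    (hE : ∀ o, o ∈ E ↔ ∃ δ, o = some δ ∧ δ.st ∈ M.accept) :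
    (∃ G : ℕ → Option (Column M q), (∀ p < S, G p ∈ E) ∧
      LevelRel A S r (StepRel x j r S mark rules) K
        (initWord S ⟨fun _ => M.blank, fun _ => true, fun _ => true, M.start⟩
          ⟨fun _ => M.blank, fun _ => false, fun _ => false, M.start⟩) (window S G 0)) ↔
      M.Accepts x := by
  have hS : 0 < S := hr.trans_le hrS
  set W₀ : ℕ → Option (Column M q) :=
    initWord S ⟨fun _ => M.blank, fun _ => true, fun _ => true, M.start⟩
      ⟨fun _ => M.blank, fun _ => false, fun _ => false, M.start⟩ with hW₀
  have hrep : Represents M q j r S W₀ (Cfg.start M.start M.blank) := represents_initWord hr hS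
  have hwin : ∀ (G : ℕ → Option (Column M q)) p, S ≤ p → window S G 0 p = none := fun G p hp =>
    if_neg (by omega)
  constructor
  · rintro ⟨G, hG, hlev⟩
    have key : ∀ {W}, Relation.ReflTransGen
        (fun W W' => StepRel x j r S mark rules W W' ∧ ∀ p, S ≤ p → W' p = none) W₀ W →
        ∃ t c, M.Reach x t c ∧ Represents M q j r S W c := by
      intro W h
      induction h with
      | refl => exact ⟨0, _, .start, hrep⟩
      | tail _ h ih =>
        obtain ⟨t, c, hc, hW⟩ := ih
        exact h.1.sound hrules hS hc hW (hM t c hc).2 h.2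
    obtain ⟨t, c, hc, hW⟩ := key (hlev.reflTransGen hrep.blank (hwin G))
    refine ⟨t, c, hc, ?_⟩
    obtain ⟨δ, h1, -, -, h2⟩ := hW.cell 0 hS
    rw [window, if_pos hS] at h1
    obtain ⟨δ', h3, h4⟩ := (hE _).1 (hG 0 hS)
    rw [Nat.zero_add] at h1
    rw [h1] at h3
    cases h3
    rwa [← h2]
  · rintro ⟨t, c, hc, hacc⟩
    have hpath : ∀ {t c}, M.Reach x t c → ∃ f : ℕ → ℕ → Option (Column M q), f 0 = W₀ ∧
        (∀ i, StepRel x j r S mark rules (f i) (f (i + 1))) ∧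
        (∀ i, ∃ c', Represents M q j r S (f i) c') ∧
        ∀ i, t ≤ i → Represents M q j r S (f i) c := by
      intro t c hc
      induction hc with
      | start =>
        exact ⟨fun _ => W₀, rfl, fun _ => .inl rfl, fun _ => ⟨_, hrep⟩, fun _ _ => hrep⟩
      | @step t c a hc ha ih =>
        obtain ⟨f, h0, h1, h2, h3⟩ := ih
        obtain ⟨W', hW', hrep'⟩ := StepRel.complete hrules hS hrS hrq hc (h3 t le_rfl)
          (hM t c hc).2 ha
        refine ⟨fun i => if i ≤ t then f i else W', ?_, fun i => ?_, fun i => ?_, fun i hi => ?_⟩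
        · simpa using h0
        · rcases lt_trichotomy i t with h | rfl | h
          · simpa [h.le, Nat.succ_le_of_lt h] using h1 i
          · simpa using hW'
          · simp only [show ¬ i ≤ t by omega, show ¬ i + 1 ≤ t by omega, if_false]
            exact .inl rfl
        · by_cases h : i ≤ t
          · simpa [h] using h2 i
          · simpa [h] using ⟨_, hrep'⟩
        · simpa [show ¬ i ≤ t by omega] using hrep'
    obtain ⟨f, h0, h1, h2, h3⟩ := hpath hc
    have hlast := h3 ((r + 1) ^ K) (hM t c hc).1
    refine ⟨f ((r + 1) ^ K), fun p hp => ?_, ?_⟩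
    · obtain ⟨δ, hδ, -, -, hst⟩ := hlast.cell p hp
      rw [hδ, hE]
      exact ⟨δ, rfl, hst ▸ hacc⟩
    · have hw : window S (f ((r + 1) ^ K)) 0 = f ((r + 1) ^ K) := by
        funext p
        rw [window, Nat.zero_add]
        split_ifs with hp
        · rfl
        · exact (hlast.blank p (by omega)).symm
      rw [hw, ← h0]
      refine LevelRel.of_path (fun i p hp => ?_) (fun i p hp => ?_) h1
      · obtain ⟨c', hc'⟩ := h2 i
        obtain ⟨δ, hδ, -⟩ := hc'.cell p hp
        rw [hδ]
        exact hA δ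
      · obtain ⟨c', hc'⟩ := h2 i
        exact hc'.blank p hp

end Simulation

end AltTime

namespace AltTime

open Prog

/-! ### The length of the rulers -/

theorem powSum_lt {e r : ℕ} (he : e ≠ 0) (hr : 2 ≤ r) : powSum e r < r ^ (e + 1) := by
  have hle : ∀ s, powSum e s ≤ s * s ^ e := by
    intro s
    induction s with
    | zero => simp [powSum]
    | succ s ih =>
      rw [powSum_succ, Nat.succ_mul]
      have : s * s ^ e ≤ s * (s + 1) ^ e := by gcongr; omega
      omega
  obtain ⟨s, rfl⟩ : ∃ s, r = s + 1 := ⟨r - 1, by omega⟩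
  have h1 : s * s ^ e < s * (s + 1) ^ e :=
    Nat.mul_lt_mul_of_pos_left (Nat.pow_lt_pow_left (Nat.lt_succ_self s) he) (by omega)
  have := hle s
  rw [powSum_succ, pow_succ, mul_comm, Nat.succ_mul]
  omega

theorem pow_le_mul_powSum (e s : ℕ) : s ^ (e + 1) ≤ (e + 1) * powSum e s := by
  have step : ∀ s e : ℕ, (s + 1) ^ (e + 1) ≤ s ^ (e + 1) + (e + 1) * (s + 1) ^ e := by
    intro s e
    induction e with
    | zero => simp
    | succ e ih =>
      calc (s + 1) ^ (e + 1 + 1) = (s + 1) ^ (e + 1) * (s + 1) := pow_succ _ _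
        _ ≤ (s ^ (e + 1) + (e + 1) * (s + 1) ^ e) * (s + 1) := Nat.mul_le_mul_right _ ih
        _ = s ^ (e + 1 + 1) + s ^ (e + 1) + (e + 1) * (s + 1) ^ (e + 1) := by ring
        _ ≤ s ^ (e + 1 + 1) + (s + 1) ^ (e + 1) + (e + 1) * (s + 1) ^ (e + 1) := by
          gcongr; omega
        _ = s ^ (e + 1 + 1) + (e + 1 + 1) * (s + 1) ^ (e + 1) := by ring
  induction s with
  | zero => simp
  | succ s ih =>
    rw [powSum_succ, Nat.mul_add]
    exact (step s e).trans (Nat.add_le_add_right ih _)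

theorem two_le_rulerLength {e n : ℕ} (hn : 1 ≤ n) : 2 ≤ rulerLength e n := by
  have h := lt_powSum_rulerLength e n
  by_contra hlt
  have : rulerLength e n = 0 ∨ rulerLength e n = 1 := by omega
  rcases this with h0 | h0 <;> rw [h0] at h <;> simp [powSum] at h
  omega

/-- All positions of the input head have `q` digits in base `r`. -/
theorem lt_rulerLength_pow {q n : ℕ} (hq : 2 ≤ q) (hn : 1 ≤ n) :
    n + 1 < rulerLength (q - 1) n ^ q := by
  have h := powSum_lt (e := q - 1) (by omega) (two_le_rulerLength (e := q - 1) hn)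
  rw [Nat.sub_add_cancel (by omega)] at h
  exact (lt_powSum_rulerLength _ _).trans_lt h

/-- The sum `1 ^ (q - 1) + ⋯ + (r - 1) ^ (q - 1)` is at most `n` and at least `(r - 1) ^ q / q`. -/
theorem rulerLength_pow_le {q n : ℕ} (hq : 1 ≤ q) (hn : 1 ≤ n) :
    rulerLength (q - 1) n ^ q ≤ 2 ^ q * q * n := by
  set r := rulerLength (q - 1) n with hr
  have hr2 : 2 ≤ r := two_le_rulerLength hn
  have h1 : powSum (q - 1) (r - 1) ≤ n := powSum_le_of_lt_rulerLength (by omega)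
  have h2 := pow_le_mul_powSum (q - 1) (r - 1)
  rw [Nat.sub_add_cancel hq] at h2
  calc r ^ q ≤ (2 * (r - 1)) ^ q := Nat.pow_le_pow_left (by omega) q
    _ = 2 ^ q * (r - 1) ^ q := mul_pow _ _ _
    _ ≤ 2 ^ q * (q * n) := Nat.mul_le_mul_left _ (h2.trans (Nat.mul_le_mul_left _ h1))
    _ = 2 ^ q * q * n := by ring

theorem rpow_div_eq {r q : ℕ} (hq : q ≠ 0) (m : ℕ) :
    (((r ^ q : ℕ) : ℝ)) ^ ((m : ℝ) / q) = (r : ℝ) ^ m := by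
  have hq' : (q : ℝ) ≠ 0 := Nat.cast_ne_zero.2 hq
  rw [Nat.cast_pow, ← Real.rpow_natCast, ← Real.rpow_mul (Nat.cast_nonneg r),
    mul_div_cancel₀ _ hq', Real.rpow_natCast]

/-! ### Bounds for the resources -/

theorem checkTime_le {q j S R c : ℕ} (hS : S ≤ R) (hR : 1 ≤ R) :
    checkTime q j S R c ≤ checkTime q j 1 1 c * R := by
  have h1 := Nat.mul_le_mul_right (j * (j + 3)) hS
  have h2 := Nat.mul_le_mul_left j hR
  have h3 := Nat.mul_le_mul_left q hR
  have h4 := Nat.mul_le_mul_left c hR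
  simp only [checkTime]
  generalize j * (j + 3) = u at *
  generalize q * (q + 3) = v at *
  linarith

theorem levelTime_le {j S r R a : ℕ} (hrS : r * S ≤ R) (hS : S ≤ R) (hr : r ≤ R) (hR : 1 ≤ R) :
    levelTime j S r a ≤ levelTime j 1 1 a * R := by
  have h1 := Nat.mul_le_mul_right (j * (j + 3)) hS
  have h2 := Nat.mul_le_mul_left j hR
  have h3 := Nat.mul_le_mul_right ((j + 1) * (j + 1 + 3)) hrS
  have h4 := Nat.mul_le_mul_right (j * (j + 3)) hrS
  have h5 := Nat.mul_le_mul_right j hr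
  have h6 := Nat.mul_le_mul_right a hrS
  simp only [levelTime]
  generalize j * (j + 3) = u at *
  generalize (j + 1) * (j + 1 + 3) = v at *
  linarith

theorem buildTime_le {q r : ℕ} (hq : 2 ≤ q) (hr : 2 ≤ r) :
    buildTime (q - 1) r ≤ (10 + (q - 1) * (q - 1 + 3) + 2 * (q - 1)) * r ^ q := by
  set e := q - 1 with he
  have hlt := powSum_lt (e := e) (by omega) hr
  rw [he, Nat.sub_add_cancel (by omega), ← he] at hlt
  set D := 9 + e * (e + 3) + 2 * e with hD
  have h1 : ∀ u, growTime e u + 1 ≤ D * (u + 1) ^ e := by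
    intro u
    have h2 : u + 1 ≤ (u + 1) ^ e := Nat.le_self_pow (by omega) _
    have h3 := Nat.mul_le_mul_left e (show 1 ≤ (u + 1) ^ e by omega)
    rw [growTime, hD]
    generalize (u + 1) ^ e = P at *
    generalize e * (e + 3) = v at *
    nlinarith
  have h2 : buildTime e r ≤ D * powSum e r + 1 := by
    rw [buildTime, powSum, Finset.mul_sum]
    exact Nat.add_le_add_right (Finset.sum_le_sum fun u _ => h1 u) 1
  calc buildTime e r ≤ D * powSum e r + 1 := h2
    _ ≤ D * r ^ q + r ^ q := by
      have := Nat.mul_le_mul_left D hlt.le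
      omega
    _ = (10 + e * (e + 3) + 2 * e) * r ^ q := by rw [hD]; ring

/-- The simulation takes linear time: all loops have at most `r ^ q = O(n)` rounds. -/
theorem exists_simulateTime_le (q j K n₀ a e c : ℕ) (hjq : j + 1 ≤ q) (hj : 1 ≤ j) :
    ∃ C, ∀ n, 1 ≤ n →
      simulateTime q j K n₀ a e c (rulerLength (q - 1) n) n ≤ C * (n + 1) := by
  set B := checkTime q j 1 1 c + K * levelTime j 1 1 a + 5 + ((e + 1 + j * (j + 3)) + 2 * j) +
    ((1 + j * (j + 3)) + 2 * j) + (10 + (q - 1) * (q - 1 + 3) + 2 * (q - 1)) with hB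
  refine ⟨B * (2 ^ q * q) + (3 + 4 * n₀ + 1), fun n hn => ?_⟩
  set r := rulerLength (q - 1) n with hr
  have hr2 : 2 ≤ r := two_le_rulerLength hn
  set R := r ^ q with hR
  have hRn : R ≤ 2 ^ q * q * n := rulerLength_pow_le (by omega) hn
  have hpow : ∀ i ≤ q, r ^ i ≤ R := fun i hi => Nat.pow_le_pow_right (by omega) hi
  have hS : r ^ j ≤ R := hpow j (by omega)
  have hR1 : 1 ≤ R := by simpa using hpow 0 (by omega)
  have hrR : r ≤ R := by simpa using hpow 1 (by omega)
  have hrS : r * r ^ j ≤ R := by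
    rw [← pow_succ']; exact hpow _ hjq
  have h1 := checkTime_le (q := q) (j := j) (c := c) hS hR1
  have h2 := Nat.mul_le_mul_left K (levelTime_le (j := j) (a := a) hrS hS hrR hR1)
  have h3 := buildTime_le (q := q) (by omega) hr2
  have h4 := Nat.mul_le_mul_right (j * (j + 3)) hS
  have h5 := Nat.mul_le_mul_left j hR1
  have h6 := Nat.mul_le_mul_right e hS
  have key : simulateTime q j K n₀ a e c r n ≤ B * R + (2 * (n + 1) + 1 + 4 * n₀ + 1) := by
    rw [simulateTime, hB, ← hR]
    rw [← hR] at h3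
    generalize j * (j + 3) = u at *
    generalize buildTime (q - 1) r = b at *
    generalize 10 + (q - 1) * (q - 1 + 3) + 2 * (q - 1) = v at *
    generalize levelTime j 1 1 a = l at *
    linarith
  calc _ ≤ B * R + (2 * (n + 1) + 1 + 4 * n₀ + 1) := key
    _ ≤ B * (2 ^ q * q * n) + (2 * (n + 1) + 1 + 4 * n₀ + 1) :=
      Nat.add_le_add_right (Nat.mul_le_mul_left _ hRn) _
    _ ≤ (B * (2 ^ q * q) + (3 + 4 * n₀ + 1)) * (n + 1) := by
      generalize 2 ^ q * q = d
      nlinarith [Nat.zero_le (B * d), Nat.zero_le (n₀ * n)]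

theorem simulateWitness_le {j K a e c r : ℕ} (hr : 1 ≤ r) :
    simulateWitness j K a e c r ≤ (c + 1 + K * (a + 1) + e) * r ^ (j + 1) := by
  have h1 : r ≤ r ^ (j + 1) := Nat.le_self_pow (by omega) r
  have h2 : r ^ j ≤ r ^ (j + 1) := Nat.pow_le_pow_right hr (by omega)
  have h3 : r * r ^ j = r ^ (j + 1) := by ring
  rw [simulateWitness, h3]
  have h4 := Nat.mul_le_mul_left c (hr.trans h1)
  have h5 := Nat.mul_le_mul_left K h1
  have h6 := Nat.mul_le_mul_right e h2
  generalize r ^ (j + 1) = P at *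
  nlinarith

/-! ### The simulation theorem -/

/-- Nondeterministic time `n ^ k` and space `n ^ (i / q)` is simulated in linear time with boundedly
many alternations and `O(n ^ ((i + 2) / q))` guessed bits, no bits being guessed on inputs of length
less than a given `n₀`. -/
theorem exists_atm {α : Type} [Finite α] (M : NTM α) (C k q i n₁ : ℕ) (hiq : i + 2 ≤ q)
    (hM : ∀ x : List α, n₁ ≤ x.length → ∀ t c, M.Reach x t c →
      (t : ℝ) ≤ C * (x.length : ℝ) ^ k + C ∧
      ∀ l, ((c.head l + 1 : ℕ) : ℝ) ≤ C * (x.length : ℝ) ^ ((i : ℝ) / q) + C) :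
    ∃ B n₂ : ℕ, ∀ n₀, n₂ ≤ n₀ → ∃ (N : ATM α) (a C' : ℕ), ∀ x : List α,
      (M.Accepts x ↔ N.Accepts x) ∧
      ∀ (c : Cfg N.State N.Sym N.tapes) (τ : List (Option Quantifier)), N.Run x c τ →
        (τ.length : ℝ) ≤ C' * x.length + C' ∧ alternations τ ≤ a ∧
        (x.length < n₀ → witnessLength τ = 0) ∧
        (n₀ ≤ x.length → (witnessLength τ : ℝ) ≤ B * (x.length : ℝ) ^ (((i + 2 : ℕ) : ℝ) / q)) := by
  classical
  have hq0 : q ≠ 0 := by omega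
  have hcol := Column.finite M q
  obtain ⟨rules, hrules⟩ := exists_rules M q
  obtain ⟨A, hA⟩ : ∃ A : List (Option (Column M q)), ∀ δ, some δ ∈ A :=
    ⟨(Set.toFinite Set.univ).toFinset.toList, fun δ => by simp⟩
  obtain ⟨E, hE⟩ : ∃ E : List (Option (Column M q)), ∀ o, o ∈ E ↔
      ∃ δ, o = some δ ∧ δ.st ∈ M.accept :=
    ⟨(Set.toFinite {o | ∃ δ : Column M q, o = some δ ∧ δ.st ∈ M.accept}).toFinset.toList,
      fun o => by simp⟩
  set j := i + 1 with hj
  set K := q * k + 1 with hK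
  set B₀ := rules.length + 1 + K * (A.length + 1) + E.length with hB₀
  refine ⟨B₀ * (2 ^ q * q), n₁ + 1 + (2 * C + 1) ^ q, fun n₀ hn₀ => ?_⟩
  obtain ⟨C₁, hC₁⟩ := exists_simulateTime_le q j K n₀ A.length E.length rules.length hiq
    (by omega)
  have htape := Tape.finite (q := q) (j := j)
  obtain ⟨m, ⟨e⟩⟩ := Finite.exists_equiv_fin (Tape q j)
  let P : Prog α (Tape q j) (Option (Column M q)) := Prog.simulate n₀
    (fun x => decide (M.Accepts x)) Column.mark rules A E
    ⟨fun _ => M.blank, fun _ => true, fun _ => true, M.start⟩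
    ⟨fun _ => M.blank, fun _ => false, fun _ => false, M.start⟩ K
  refine ⟨P.toATM e none, 2 * K, C₁ + 2 * n₀ + 1, fun x => ?_⟩
  have hspec : ∃ t w, (P.toATM e none).Spec x
      (Cfg.start (P.toATM e none).start (P.toATM e none).blank) (t + 1) w (2 * K) (M.Accepts x) ∧
      t + 1 ≤ (C₁ + 2 * n₀ + 1) * x.length + (C₁ + 2 * n₀ + 1) ∧ (x.length < n₀ → w = 0) ∧
      (n₀ ≤ x.length →
        (w : ℝ) ≤ (B₀ * (2 ^ q * q) : ℕ) * (x.length : ℝ) ^ (((i + 2 : ℕ) : ℝ) / q)) := by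
    rcases Nat.lt_or_ge x.length n₀ with hx | hx
    · refine ⟨2 * n₀, 0, ?_, by nlinarith [Nat.zero_le (C₁ * x.length)], fun _ => rfl,
        fun h => by omega⟩
      have h := Prog.sp_simulate_of_lt (x := x) (k := fun _ _ _ _ φ => ¬ φ) (j := j) n₀
        (fun x => decide (M.Accepts x)) Column.mark rules A E
        ⟨fun _ => M.blank, fun _ => true, fun _ => true, M.start⟩
        ⟨fun _ => M.blank, fun _ => false, fun _ => false, M.start⟩ K hx
      rw [decide_eq_true_eq] at h
      exact (h.relax le_rfl le_rfl (Nat.zero_le _)).spec_toATM P e none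
    · set n := x.length with hn
      set r := rulerLength (q - 1) n with hr
      have hn1 : 1 ≤ n := by omega
      have hr2 : 2 ≤ r := two_le_rulerLength hn1
      have hrq : n + 1 < r ^ q := lt_rulerLength_pow (by omega) hn1
      have hCr : 2 * C + 1 ≤ r := by
        by_contra hlt
        have := Nat.pow_le_pow_left (Nat.le_of_not_le hlt) q
        omega
      have hnr : (n : ℝ) ≤ ((r ^ q : ℕ) : ℝ) := by exact_mod_cast (by omega : n ≤ r ^ q)
      -- The bounds for the simulated machine in terms of the length of the rulers.
      have hbound : ∀ t c, M.Reach x t c → t ≤ (r + 1) ^ K ∧ ∀ l, c.head l < r ^ j := by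
        intro t c hc
        obtain ⟨h1, h2⟩ := hM x (by omega) t c hc
        constructor
        · have h3 : t ≤ C * n ^ k + C := by exact_mod_cast h1
          have h4 : n ^ k ≤ r ^ (q * k) := by
            rw [pow_mul]; exact Nat.pow_le_pow_left (by omega) k
          have h5 : 1 ≤ r ^ (q * k) := Nat.one_le_pow _ _ (by omega)
          calc t ≤ C * n ^ k + C := h3
            _ ≤ (2 * C + 1) * r ^ (q * k) := by nlinarith
            _ ≤ r * r ^ (q * k) := Nat.mul_le_mul_right _ hCr
            _ = r ^ K := by rw [hK, pow_succ, mul_comm]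
            _ ≤ (r + 1) ^ K := Nat.pow_le_pow_left (by omega) K
        · intro l
          have h3 : (n : ℝ) ^ ((i : ℝ) / q) ≤ (r : ℝ) ^ i := by
            rw [← rpow_div_eq hq0]
            exact Real.rpow_le_rpow (Nat.cast_nonneg n) hnr (by positivity)
          have h4 : ((c.head l + 1 : ℕ) : ℝ) ≤ C * (r : ℝ) ^ i + C :=
            (h2 l).trans (by gcongr)
          have h5 : c.head l + 1 ≤ C * r ^ i + C := by exact_mod_cast h4
          have h6 : 1 ≤ r ^ i := Nat.one_le_pow _ _ (by omega)
          have h7 : (2 * C + 1) * r ^ i ≤ r ^ j := by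
            rw [hj, pow_succ, mul_comm]; exact Nat.mul_le_mul_left _ hCr
          nlinarith
      have hw : ((r : ℝ) ^ (j + 1)) ≤
          ((2 ^ q * q : ℕ) : ℝ) * (n : ℝ) ^ (((i + 2 : ℕ) : ℝ) / q) := by
        have h1 : (1 : ℝ) ≤ ((2 ^ q * q : ℕ) : ℝ) := by
          exact_mod_cast Nat.one_le_iff_ne_zero.2 (by positivity)
        have h2 : (((i + 2 : ℕ) : ℝ) / q) ≤ 1 := by
          rw [div_le_one (by positivity)]
          exact_mod_cast hiq
        have h3 : ((r ^ q : ℕ) : ℝ) ≤ ((2 ^ q * q : ℕ) : ℝ) * n := by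
          exact_mod_cast rulerLength_pow_le (by omega) hn1
        have h4 : j + 1 = i + 2 := by omega
        rw [h4, ← rpow_div_eq hq0]
        calc _ ≤ (((2 ^ q * q : ℕ) : ℝ) * n) ^ (((i + 2 : ℕ) : ℝ) / q) :=
              Real.rpow_le_rpow (Nat.cast_nonneg _) h3 (by positivity)
          _ = ((2 ^ q * q : ℕ) : ℝ) ^ (((i + 2 : ℕ) : ℝ) / q) *
              (n : ℝ) ^ (((i + 2 : ℕ) : ℝ) / q) :=
            Real.mul_rpow (Nat.cast_nonneg _) (Nat.cast_nonneg _)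
          _ ≤ _ := by
            gcongr
            exact Real.rpow_le_self_of_one_le h1 h2
      refine ⟨simulateTime q j K n₀ A.length E.length rules.length r n,
        simulateWitness j K A.length E.length rules.length r, ?_, ?_,
        fun h => absurd h (not_lt.2 hx), fun _ => ?_⟩
      · have h := Prog.sp_simulate (x := x) (k := fun _ _ _ _ φ => ¬ φ) (j := j) n₀
          (fun x => decide (M.Accepts x)) Column.mark rules A E
          ⟨fun _ => M.blank, fun _ => true, fun _ => true, M.start⟩
          ⟨fun _ => M.blank, fun _ => false, fun _ => false, M.start⟩ K hr hrq hx
        rw [levelRel_iff_accepts hrules (by omega) (Nat.le_self_pow (by omega) r) hrq hbound hA hE]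
          at h
        exact h.spec_toATM P e none
      · have := hC₁ n hn1
        nlinarith [Nat.zero_le (n₀ * n)]
      · have h1 := simulateWitness_le (j := j) (K := K) (a := A.length) (e := E.length)
          (c := rules.length) (show 1 ≤ r by omega)
        calc _ ≤ (B₀ : ℝ) * (r : ℝ) ^ (j + 1) := by exact_mod_cast h1
          _ ≤ (B₀ : ℝ) * (((2 ^ q * q : ℕ) : ℝ) * (n : ℝ) ^ (((i + 2 : ℕ) : ℝ) / q)) := by gcongr
          _ = _ := by rw [Nat.cast_mul B₀, mul_assoc]
  obtain ⟨t, w, ⟨hacc, hb⟩, ht, hw₁, hw₂⟩ := hspec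
  refine ⟨hacc.symm, fun c τ hτ => ?_⟩
  obtain ⟨t', w', p', -, h1, h2, h3⟩ := hb.run hτ
  refine ⟨?_, ?_, fun h => ?_, fun h => ?_⟩
  · exact_mod_cast (show τ.length ≤ _ from (by omega : τ.length ≤ t + 1).trans ht)
  · have := changes_le_cons (phaseQuantifier p') τ.reduceOption
    rw [alternations]
    omega
  · have := hw₁ h
    omega
  · refine le_trans ?_ (hw₂ h)
    exact_mod_cast (by omega : witnessLength τ ≤ w)

theorem isLittleO_natCast_rpow {a b : ℝ} (hab : a < b) :
    (fun n : ℕ => (n : ℝ) ^ a) =o[atTop] fun n : ℕ => (n : ℝ) ^ b := by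
  have hpos : ∀ᶠ n : ℕ in atTop, (0 : ℝ) < n :=
    (tendsto_natCast_atTop_atTop (R := ℝ)).eventually_gt_atTop 0
  refine isLittleO_of_tendsto' (hpos.mono fun n hn h => absurd h (by positivity)) ?_
  refine (((tendsto_rpow_neg_atTop (sub_pos.2 hab)).comp
    (tendsto_natCast_atTop_atTop (R := ℝ)))).congr' (hpos.mono fun n hn => ?_)
  simp only [Function.comp_apply, neg_sub, Real.rpow_sub hn]

theorem mem_atimeConstAlt {α : Type} {L : Language α} {w : ℕ → ℝ} {N : ATM α} {a C : ℕ}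
    (h : ∀ x : List α, (x ∈ L ↔ N.Accepts x) ∧
      ∀ (c : Cfg N.State N.Sym N.tapes) (τ : List (Option Quantifier)), N.Run x c τ →
        (τ.length : ℝ) ≤ C * x.length + C ∧ alternations τ ≤ a ∧
        (witnessLength τ : ℝ) ≤ w x.length) :
    L ∈ ATIMEConstAlt α w fun n => (n : ℝ) :=
  ⟨fun _ => a, isBigO_const_const _ one_ne_zero _, N, C, h⟩

end AltTime

theorem mainTheorem10 (α : Type) [Finite α] (k : ℕ) :
    (∀ ε : ℝ, 0 < ε →
      AltTime.NTISP α (fun n => (n : ℝ) ^ k) (fun n => (n : ℝ) ^ (1 - ε)) ⊆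
        AltTime.ATIMEConstAltLittleO α (fun n => (n : ℝ)) (fun n => (n : ℝ))) ∧
    (∀ g : ℕ → ℝ, AltTime.IsSubpolynomial g →
      AltTime.NTISP α (fun n => (n : ℝ) ^ k) g ⊆
        AltTime.ATIMEConstAltSP α (fun n => (n : ℝ))) := by
  constructor
  · rintro ε hε L ⟨M, C, hM⟩
    -- `3 / q ≤ ε`, so space `n ^ (1 - ε)` is at most `n ^ ((q - 3) / q)`.
    obtain ⟨q, hq⟩ := exists_nat_ge (3 / ε + 3)
    have h3ε : 0 < 3 / ε := by positivity
    have hq3 : 3 ≤ q := by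
      have : (3 : ℝ) ≤ q := by linarith
      exact_mod_cast this
    have hq0 : (0 : ℝ) < q := by
      have : 0 < q := by omega
      exact_mod_cast this
    obtain ⟨i, rfl⟩ : ∃ i, q = i + 3 := ⟨q - 3, by omega⟩
    have hexp : 1 - ε ≤ (i : ℝ) / (i + 3 : ℕ) := by
      rw [le_div_iff₀ hq0]
      have h1 : 3 ≤ (i + 3 : ℕ) * ε := by
        have : 3 / ε ≤ (i + 3 : ℕ) := by linarith
        rwa [div_le_iff₀ hε] at this
      push_cast at h1 ⊢
      linarith
    obtain ⟨B, n₂, h⟩ := AltTime.exists_atm M C k (i + 3) i 1 (by omega)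
      fun x hx t c hc => ⟨((hM x).2 t c hc).1, fun l => (((hM x).2 t c hc).2 l).trans (by
        have h1 : (1 : ℝ) ≤ x.length := by exact_mod_cast hx
        have h2 := Real.rpow_le_rpow_of_exponent_le h1 hexp
        gcongr)⟩
    obtain ⟨N, a, C', hN⟩ := h n₂ le_rfl
    refine ⟨fun n => B * (n : ℝ) ^ (((i + 2 : ℕ) : ℝ) / (i + 3 : ℕ)), ?_,
      AltTime.mem_atimeConstAlt (N := N) (a := a) (C := C') fun x =>
        ⟨(hM x).1.trans (hN x).1, fun c τ hτ => ?_⟩⟩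
    · have hlt : ((i + 2 : ℕ) : ℝ) / (i + 3 : ℕ) < 1 := by
        rw [div_lt_one hq0]
        exact_mod_cast Nat.lt_succ_self _
      have := (AltTime.isLittleO_natCast_rpow hlt).const_mul_left (B : ℝ)
      simpa only [Real.rpow_one] using this
    · obtain ⟨h1, h2, h3, h4⟩ := (hN x).2 c τ hτ
      refine ⟨h1, h2, ?_⟩
      rcases Nat.lt_or_ge x.length n₂ with hx | hx
      · rw [h3 hx, Nat.cast_zero]
        positivity
      · exact h4 hx
  · rintro g hg L ⟨M, C, hM⟩ δ hδ
    -- `3 / q < δ`, and space `g` is at most `n ^ (1 / q)` up to a constant.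
    obtain ⟨q, hq⟩ := exists_nat_gt (3 / δ + 3)
    have h3δ : 0 < 3 / δ := by positivity
    have hq3 : 3 ≤ q := by
      have : (3 : ℝ) ≤ q := by linarith
      exact_mod_cast this
    have hq0 : (0 : ℝ) < q := by
      have : 0 < q := by omega
      exact_mod_cast this
    have hlt : ((1 + 2 : ℕ) : ℝ) / q < δ := by
      rw [div_lt_iff₀ hq0]
      have : 3 / δ < q := by linarith
      rw [div_lt_iff₀ hδ] at this
      push_cast
      linarith
    obtain ⟨D, hD⟩ := (hg (((1 : ℕ) : ℝ) / q) (by positivity)).bound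
    obtain ⟨D', hD'⟩ := exists_nat_ge (max D 1)
    obtain ⟨n₁, hn₁⟩ := eventually_atTop.1 hD
    have hD'1 : (1 : ℝ) ≤ D' := (le_max_right _ _).trans hD'
    obtain ⟨B, n₂, h⟩ := AltTime.exists_atm M (C * D') k q 1 n₁ (by omega)
      fun x hx t c hc => by
        have hCD : (C : ℝ) ≤ C * D' := le_mul_of_one_le_right (Nat.cast_nonneg C) hD'1
        push_cast at hD'1 ⊢
        refine ⟨((hM x).2 t c hc).1.trans (by gcongr), fun l => ?_⟩
        have h1 := hn₁ x.length hx
        rw [Real.norm_eq_abs, Real.norm_of_nonneg (by positivity)] at h1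
        have h2 : g x.length ≤ D' * (x.length : ℝ) ^ (((1 : ℕ) : ℝ) / q) :=
          (le_abs_self _).trans (h1.trans (by gcongr; exact (le_max_left _ _).trans hD'))
        have h3 := ((hM x).2 t c hc).2 l
        push_cast at h3 h2
        calc _ ≤ C * g x.length + C := h3
          _ ≤ C * (D' * (x.length : ℝ) ^ ((1 : ℝ) / q)) + C * D' := by gcongr
          _ = _ := by ring
    -- For large `n` the constant `B` is absorbed.
    have hlo := (AltTime.isLittleO_natCast_rpow hlt).const_mul_left (B : ℝ)
    obtain ⟨n₃, hn₃⟩ := eventually_atTop.1 (hlo.bound one_pos)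
    obtain ⟨N, a, C', hN⟩ := h (max n₂ n₃) (le_max_left _ _)
    refine AltTime.mem_atimeConstAlt (N := N) (a := a) (C := C') fun x =>
      ⟨(hM x).1.trans (hN x).1, fun c τ hτ => ?_⟩
    obtain ⟨h1, h2, h3, h4⟩ := (hN x).2 c τ hτ
    refine ⟨h1, h2, ?_⟩
    rcases Nat.lt_or_ge x.length (max n₂ n₃) with hx | hx
    · rw [h3 hx, Nat.cast_zero]
      positivity
    · refine (h4 hx).trans ?_
      have := hn₃ x.length ((le_max_right _ _).trans hx)
      rwa [Real.norm_of_nonneg (by positivity), Real.norm_of_nonneg (by positivity), one_mul]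
        at this
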